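/- Let $M^N$ be a smooth manifold (Hausdorff, second countable, without boundary), let $\omega^{ij}(u)$ be an arbitrary smooth Poisson structure on $M$ (possibly degenerate) and let $T_{ijk}(u)$ be an arbitrary smooth closed 3-form on $M$. Let $\Omega M$ be the space of all smooth maps $\gamma:S^1=\mathbb R/\mathbb Z\to M$, $\gamma(x)=\{u^i(x)\}$. Put $$M^s_j(u,u_x)=\delta^s_j+\omega^{sp}(u)\,T_{pjk}(u)\,u^k_x ,$$ and let $\Omega_{\mathrm{reg}}M\subset\Omega M$ be the set of the loops along which, at every $x\in S^1$, the matrix $M^s_j(u,u_x)$ is invertible. On these loops let $B^i_s(u,u_x)$ be the inverse matrix, $B^i_sM^s_j=\delta^i_j$, and let $A^{ij}(u,u_x)=B^i_s(u,u_x)\,\omega^{sj}(u)$. Call a functional $I:\Omega_{\mathrm{reg}}M\to\mathbb R$ admissible if it has a smooth variational derivative, that is, if there is an assignment to each $\gamma\in\Omega_{\mathrm{reg}}M$ of a field of covectors $\frac{\delta I}{\delta u^i(x)}$ along $\gamma$ such that $\frac{d}{dt}I(\gamma_t)=\int_{S^1}\frac{\delta I}{\delta u^i(x)}\,\partial_tu^i(t,x)\,dx$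 for every smooth one-parameter family $\gamma_t=\{u^i(t,x)\}$ of loops in $\Omega_{\mathrm{reg}}M$, and such that along every smooth finite-dimensional family $\gamma_t$ in $\Omega_{\mathrm{reg}}M$ these covectors depend smoothly on $(t,x)$. Then the variational derivative of an admissible functional is unique, and $$\{I,J\}=\int_{S^1}\frac{\delta I}{\delta u^i(x)}\,A^{ij}(u,u_x)\,\frac{\delta J}{\delta u^j(x)}\,dx$$ is a Poisson bracket on the admissible functionals: they form a vector space, $\{I,J\}$ is again admissible for all admissible $I,J$, the bracket is bilinear and skew-symmetric, $\{I,J\}=-\{J,I\}$, and it satisfies the Jacobi identity $\{\{I,J\},K\}+\{\{J,K\},I\}+\{\{K,I\},J\}=0$. -/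

import Mathlib

open scoped Manifold ContDiff

namespace LoopPoisson

/-! ### Charts, Poisson structures and closed 3-forms -/

section Tensors

variable {N : ℕ} {M : Type*} [TopologicalSpace M] [ChartedSpace (EuclideanSpace ℝ (Fin N)) M]

/-- The differential at `p` of a chart `φ`; its components are the coordinate covectors
`du^1, …, du^N`. -/
noncomputable def chartDiff (φ : OpenPartialHomeomorph M (EuclideanSpace ℝ (Fin N))) (p : M) :
    TangentSpace (𝓡 N) p →L[ℝ] EuclideanSpace ℝ (Fin N) :=
  mfderiv (𝓡 N) 𝓘(ℝ, EuclideanSpace ℝ (Fin N)) φ p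

/-- The coordinate frame of a chart `φ` at `p`: it sends the `i`-th standard basis vector to
`∂/∂u^i`. It is the inverse of `chartDiff φ p` when `p` lies in the domain of the chart. -/
noncomputable def chartFrame (φ : OpenPartialHomeomorph M (EuclideanSpace ℝ (Fin N))) (p : M) :
    EuclideanSpace ℝ (Fin N) →L[ℝ] TangentSpace (𝓡 N) p :=
  (chartDiff φ p).inverse

/-- The contravariant 2-tensor `ω` (written `π` in the code) in the chart `φ`, contracted with the constant covectors
`a` and `b`: the function `u ↦ a_i ω^{ij}(u) b_j`. The tensor is given as the linear maps
`T*_p M → T_p M`, `(ω α)^i = ω^{ij} α_j`. -/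
noncomputable def bivectorInChart
    (π : ∀ p : M, (TangentSpace (𝓡 N) p →L[ℝ] ℝ) →ₗ[ℝ] TangentSpace (𝓡 N) p)
    (φ : OpenPartialHomeomorph M (EuclideanSpace ℝ (Fin N)))
    (a b : EuclideanSpace ℝ (Fin N) →L[ℝ] ℝ) (u : EuclideanSpace ℝ (Fin N)) : ℝ :=
  a (chartDiff φ (φ.symm u) (π (φ.symm u) (b ∘L chartDiff φ (φ.symm u))))

/-- The vector with components `ω^{ij}(u) b_j` in the chart `φ`. -/
noncomputable def sharpInChart
    (π : ∀ p : M, (TangentSpace (𝓡 N) p →L[ℝ] ℝ) →ₗ[ℝ] TangentSpace (𝓡 N) p)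
    (φ : OpenPartialHomeomorph M (EuclideanSpace ℝ (Fin N)))
    (b : EuclideanSpace ℝ (Fin N) →L[ℝ] ℝ) (u : EuclideanSpace ℝ (Fin N)) :
    EuclideanSpace ℝ (Fin N) :=
  chartDiff φ (φ.symm u) (π (φ.symm u) (b ∘L chartDiff φ (φ.symm u)))

/-- The covariant 3-form `T` in the chart `φ`: its value on the standard basis vectors
`e_i, e_j, e_k` is the component function `T_{ijk}(u)`. -/
noncomputable def formInChart
    (T : ∀ p : M, TangentSpace (𝓡 N) p [⋀^Fin 3]→L[ℝ] ℝ)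
    (φ : OpenPartialHomeomorph M (EuclideanSpace ℝ (Fin N))) (u : EuclideanSpace ℝ (Fin N)) :
    EuclideanSpace ℝ (Fin N) [⋀^Fin 3]→L[ℝ] ℝ :=
  (T (φ.symm u)).compContinuousLinearMap (chartFrame φ (φ.symm u))

end Tensors

/-- A smooth Poisson structure `ω^{ij}(u)`, possibly degenerate, on a manifold `M`, given
by the linear maps `T*_p M → T_p M`, `(ω α)^i = ω^{ij} α_j`. -/
structure PoissonStructure (N : ℕ) (M : Type*) [TopologicalSpace M]
    [ChartedSpace (EuclideanSpace ℝ (Fin N)) M] where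
  /-- the linear map `α ↦ ω^{ij} α_j` -/
  sharp : ∀ p : M, (TangentSpace (𝓡 N) p →L[ℝ] ℝ) →ₗ[ℝ] TangentSpace (𝓡 N) p
  /-- `ω^{ij} = -ω^{ji}` -/
  skew : ∀ (p : M) (α β : TangentSpace (𝓡 N) p →L[ℝ] ℝ), α (sharp p β) = -β (sharp p α)
  /-- the components of `ω` in each chart are smooth functions -/
  smooth : ∀ φ ∈ atlas (EuclideanSpace ℝ (Fin N)) M, ∀ a b : EuclideanSpace ℝ (Fin N) →L[ℝ] ℝ,
    ContDiffOn ℝ ∞ (bivectorInChart sharp φ a b) φ.target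
  /-- the Jacobi identity, that is
  `ω^{rk} ∂_r ω^{ij} + ω^{ri} ∂_r ω^{jk} + ω^{rj} ∂_r ω^{ki} = 0` in each chart -/
  jacobi : ∀ φ ∈ atlas (EuclideanSpace ℝ (Fin N)) M, ∀ u ∈ φ.target,
    ∀ a b c : EuclideanSpace ℝ (Fin N) →L[ℝ] ℝ,
      fderiv ℝ (bivectorInChart sharp φ a b) u (sharpInChart sharp φ c u) +
      fderiv ℝ (bivectorInChart sharp φ b c) u (sharpInChart sharp φ a u) +
      fderiv ℝ (bivectorInChart sharp φ c a) u (sharpInChart sharp φ b u) = 0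

/-- A smooth closed differential 3-form `T_{ijk}(u)` on a manifold `M`. -/
structure ClosedThreeForm (N : ℕ) (M : Type*) [TopologicalSpace M]
    [ChartedSpace (EuclideanSpace ℝ (Fin N)) M] where
  /-- the alternating trilinear form on each tangent space -/
  form : ∀ p : M, TangentSpace (𝓡 N) p [⋀^Fin 3]→L[ℝ] ℝ
  /-- the form is smooth in each chart -/
  smooth : ∀ φ ∈ atlas (EuclideanSpace ℝ (Fin N)) M,
    ContDiffOn ℝ ∞ (formInChart form φ) φ.target
  /-- the exterior derivative vanishes in each chart -/
  closed : ∀ φ ∈ atlas (EuclideanSpace ℝ (Fin N)) M, ∀ u ∈ φ.target,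
    extDeriv (formInChart form φ) u = 0

/-! ### The matrix operator -/

section Operator

variable {N : ℕ} {M : Type*} [TopologicalSpace M] [ChartedSpace (EuclideanSpace ℝ (Fin N)) M]

/-- The covector `z ↦ T(z, w, v)`, with components `T_{pjk} w^j v^k`. -/
noncomputable def ClosedThreeForm.contract (T : ClosedThreeForm N M) (p : M)
    (w v : TangentSpace (𝓡 N) p) : TangentSpace (𝓡 N) p →L[ℝ] ℝ :=
  (T.form p).toContinuousMultilinearMap.toContinuousLinearMap ![0, w, v] 0

theorem ClosedThreeForm.contract_apply (T : ClosedThreeForm N M) (p : M)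
    (w v z : TangentSpace (𝓡 N) p) : T.contract p w v z = T.form p ![z, w, v] := by
  simp only [contract, ContinuousMultilinearMap.toContinuousLinearMap_apply]
  have : Function.update ![0, w, v] 0 z = ![z, w, v] := by
    ext i; fin_cases i <;> rfl
  rw [this]; rfl

theorem ClosedThreeForm.form_add (T : ClosedThreeForm N M) (p : M)
    (z w w' v : TangentSpace (𝓡 N) p) :
    T.form p ![z, w + w', v] = T.form p ![z, w, v] + T.form p ![z, w', v] := by
  have h := (T.form p).map_update_add ![z, 0, v] 1 w w'
  have e : ∀ y, Function.update ![z, 0, v] 1 y = ![z, y, v] := by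
    intro y; ext i; fin_cases i <;> rfl
  simpa only [e] using h

theorem ClosedThreeForm.form_smul (T : ClosedThreeForm N M) (p : M) (r : ℝ)
    (z w v : TangentSpace (𝓡 N) p) :
    T.form p ![z, r • w, v] = r • T.form p ![z, w, v] := by
  have h := (T.form p).map_update_smul ![z, 0, v] 1 r w
  have e : ∀ y, Function.update ![z, 0, v] 1 y = ![z, y, v] := by
    intro y; ext i; fin_cases i <;> rfl
  simpa only [e] using h

/-- The linear map `T_p M → T*_p M` with the matrix `T_{pjk} v^k` (row `p`, column `j`). -/
noncomputable def ClosedThreeForm.contractMap (T : ClosedThreeForm N M) (p : M)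
    (v : TangentSpace (𝓡 N) p) :
    TangentSpace (𝓡 N) p →ₗ[ℝ] (TangentSpace (𝓡 N) p →L[ℝ] ℝ) where
  toFun w := T.contract p w v
  map_add' w w' := by
    ext z
    simp only [add_apply, T.contract_apply, T.form_add]
  map_smul' r w := by
    ext z
    simp only [smul_apply, T.contract_apply, T.form_smul, RingHom.id_apply]

/-- The endomorphism of `T_p M` with the matrix `M^s_j = δ^s_j + ω^{sp} T_{pjk} v^k`. -/
noncomputable def opM (π : PoissonStructure N M) (T : ClosedThreeForm N M) (p : M)
    (v : TangentSpace (𝓡 N) p) : Module.End ℝ (TangentSpace (𝓡 N) p) :=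
  LinearMap.id + π.sharp p ∘ₗ T.contractMap p v

/-- The linear map `T*_p M → T_p M` with the matrix `A^{ij} = B^i_s ω^{sj}`, where `B` is the
inverse of `opM π T p v` (and `0`, by convention, if there is no inverse). -/
noncomputable def opA (π : PoissonStructure N M) (T : ClosedThreeForm N M) (p : M)
    (v : TangentSpace (𝓡 N) p) :
    (TangentSpace (𝓡 N) p →L[ℝ] ℝ) →ₗ[ℝ] TangentSpace (𝓡 N) p :=
  (Ring.inverse (opM π T p v) : Module.End ℝ (TangentSpace (𝓡 N) p)) ∘ₗ π.sharp p

end Operator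

/-! ### The loop space and functionals on it -/

/-- A point of the loop space: a smooth map from the circle `S¹ = ℝ/ℤ` to `M`. -/
structure Loop (N : ℕ) (M : Type*) [TopologicalSpace M]
    [ChartedSpace (EuclideanSpace ℝ (Fin N)) M] where
  /-- the underlying map -/
  toFun : UnitAddCircle → M
  /-- the map is smooth -/
  smooth : ContMDiff 𝓘(ℝ, ℝ) (𝓡 N) ∞ (fun x : ℝ => toFun (x : UnitAddCircle))

section Functionals

variable {N : ℕ} {M : Type*} [TopologicalSpace M] [ChartedSpace (EuclideanSpace ℝ (Fin N)) M]

instance : CoeFun (Loop N M) (fun _ => UnitAddCircle → M) := ⟨Loop.toFun⟩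

/-- The velocity `u_x` of a loop. -/
noncomputable def Loop.velocity (γ : Loop N M) (x : ℝ) :
    TangentSpace (𝓡 N) (γ (x : UnitAddCircle)) :=
  mfderiv 𝓘(ℝ, ℝ) (𝓡 N) (fun y : ℝ => γ (y : UnitAddCircle)) x (1 : ℝ)

/-- A family of loops `c t`, depending on a parameter `t`, is smooth on the set `O` of parameters
if `c t x` is a smooth function of `(t, x)`. -/
def IsSmoothFamilyOn {P : Type} [NormedAddCommGroup P] [NormedSpace ℝ P] (O : Set P)
    (c : P → Loop N M) : Prop :=
  ContMDiffOn 𝓘(ℝ, P × ℝ) (𝓡 N) ∞ (fun q : P × ℝ => c q.1 (q.2 : UnitAddCircle))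
    (O ×ˢ Set.univ)

/-- A field of covectors along loops: it assigns to each loop `γ` of the set `U` and each `x ∈ S¹`
a covector at `γ x`. -/
abbrev CovectorField (U : Set (Loop N M)) : Type _ :=
  ∀ (γ : U) (x : UnitAddCircle), TangentSpace (𝓡 N) (γ.1 x) →L[ℝ] ℝ

/-- `α` is the variational derivative `δI/δu^i(x)` of the functional `I`:
`d/dt I(c_t) = ∫ α_i(c_t)(x) ∂_t c_t^i(x) dx` for each smooth one-parameter family of loops, and
the components of `α(c_t)(x)` in each chart are smooth functions of `(t, x)` for each smooth
finite-dimensional family of loops `c_t`. -/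
structure IsVariationalDerivative (U : Set (Loop N M)) (I : U → ℝ) (α : CovectorField U) :
    Prop where
  hasDerivAt : ∀ (O : Set ℝ) (c : ℝ → U), IsOpen O → IsSmoothFamilyOn O (fun t => (c t).1) →
    ∀ t ∈ O, HasDerivAt (fun s => I (c s))
      (∫ x in (0 : ℝ)..1, α (c t) (x : UnitAddCircle)
        (mfderiv 𝓘(ℝ, ℝ) (𝓡 N) (fun s : ℝ => (c s).1 (x : UnitAddCircle)) t (1 : ℝ))) t
  smooth : ∀ (P : Type) [NormedAddCommGroup P] [NormedSpace ℝ P] [FiniteDimensional ℝ P]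
    (O : Set P) (c : P → U), IsOpen O → IsSmoothFamilyOn O (fun t => (c t).1) →
    ∀ φ ∈ atlas (EuclideanSpace ℝ (Fin N)) M,
      ContDiffOn ℝ ∞
        (fun q : P × ℝ => (α (c q.1) (q.2 : UnitAddCircle)) ∘L
          chartFrame φ ((c q.1).1 (q.2 : UnitAddCircle)))
        {q : P × ℝ | q.1 ∈ O ∧ (c q.1).1 (q.2 : UnitAddCircle) ∈ φ.source}

/-- The functionals that have a (smooth) variational derivative. -/
def IsAdmissible (U : Set (Loop N M)) (I : U → ℝ) : Prop :=
  ∃ α : CovectorField U, IsVariationalDerivative U I α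

open Classical in
/-- The variational derivative of an admissible functional (`0` for other functionals). -/
noncomputable def varDeriv (U : Set (Loop N M)) (I : U → ℝ) : CovectorField U :=
  if h : IsAdmissible U I then h.choose else fun _ _ => 0

/-- The loops along which the matrix `M^s_j = δ^s_j + ω^{sp} T_{pjk} u^k_x` is invertible. -/
def regularLoops (π : PoissonStructure N M) (T : ClosedThreeForm N M) : Set (Loop N M) :=
  {γ | ∀ x : ℝ, IsUnit (opM π T (γ (x : UnitAddCircle)) (γ.velocity x))}

/-- The bracket `{I, J} = ∫ (δI/δu^i(x)) A^{ij}(u, u_x) (δJ/δu^j(x)) dx`. -/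
noncomputable def bracket (π : PoissonStructure N M) (T : ClosedThreeForm N M)
    (I J : regularLoops π T → ℝ) : regularLoops π T → ℝ := fun γ =>
  ∫ x in (0 : ℝ)..1,
    varDeriv (regularLoops π T) I γ (x : UnitAddCircle)
      (opA π T (γ.1 (x : UnitAddCircle)) (γ.1.velocity x)
        (varDeriv (regularLoops π T) J γ (x : UnitAddCircle)))

end Functionals

end LoopPoisson

namespace LoopPoisson

section Proofs

set_option maxSynthPendingDepth 3
set_option linter.unusedSectionVars false

/-! ### Differentiation under the integral sign and symmetry of second derivatives -/

section Integrals

variable {P : Type*} [NormedAddCommGroup P] [NormedSpace ℝ P]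

/-! Everything rests on the implicit form of the Hamiltonian vector. For a covector field `α` put `X
= A α`. Since `B` inverts `M`, this means `X = ω(α - T(X, u_x, ·))`. Differentiating this equation,
instead of the inverse matrix `B`, shows how the density `α(A β)` varies. With `Y = A β`, `α̃ = α -
T(X, u_x, ·)`, `β̃ = β - T(Y, u_x, ·)`, and a prime for the derivative along a variation `ξ` of the
loop, the unknown `Y'` cancels by skewness of `ω` and `T`, leaving `α'(Y) - β'(X) + α̃(ω' β̃) +
T'(Y, u_x, X) + T(Y, ξ_x, X)` (`fderiv_pairing`, `fderiv_bracketDensity`). Skewness of the bracket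
is the same cancellation without derivatives (`pairing_skew`).

Jacobi identity. `{{I,J},K}` is the derivative of `{I,J}` along the Hamiltonian field `Z` of `K`. In
the cyclic sum of the formula above, the terms with derivatives of covectors are antisymmetrized
second variations of `I`, `J`, `K`; their integrals vanish by equality of mixed partial derivatives
(`IsVariationalDerivative.integral_cross`). The terms with `ω'` cancel by the Jacobi identity of
`ω`. Closedness of `T` turns the remaining ones into the total derivative `∂_x T(X, Y, Z)`, which
integrates to zero over the circle (`sum_fderiv_bracketDensity`).

Admissibility of `{I,J}`. The formula must be rewritten as a covector applied to `ξ` pointwise.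
Symmetry of the second variation replaces `α'(Y)`, the derivative of `α` along `ξ` evaluated on `Y`,
by the derivative of `α` along `Y` evaluated on `ξ`, and similarly for `β`. Integration by parts
removes `ξ_x` from `T(Y, ξ_x, X)`. What remains is linear in the value of `ξ` at each point and
gives the variational derivative (`variation_bracketDensity`, `isGradientAt_pairing`).

Both arguments need finite-dimensional families of regular loops with prescribed velocities, on a
manifold without a global chart. They come from a `LocalAddition`: a composition of finitely many
cut-off chart translations, which moves the points near a compact set in every tangent direction and
depends on finitely many parameters. Regularity is an open condition, so small variations stay in
the regular loops (`eventually_mem_regularLoops`). The same families give uniqueness of the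
variational derivative (`IsGradientAt.unique`), and uniqueness glues the locally constructed
gradients of `{I,J}` into one that is smooth along every family (`isAdmissible_pairing`). -/

theorem continuous_slice {f : P × ℝ → ℝ} {O : Set P} (hf : ContinuousOn f (O ×ˢ Set.univ))
    {p : P} (hp : p ∈ O) : Continuous fun x : ℝ => f (p, x) :=
  hf.comp_continuous (by fun_prop) fun x => ⟨hp, trivial⟩

/-- Differentiation under the integral sign. -/
theorem hasFDerivAt_integral_of_contDiffOn [FiniteDimensional ℝ P] {f : P × ℝ → ℝ} {O : Set P}
    (hO : IsOpen O) (hf : ContDiffOn ℝ ∞ f (O ×ˢ Set.univ)) {p : P} (hp : p ∈ O) :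
    HasFDerivAt (fun p => ∫ x in (0 : ℝ)..1, f (p, x))
      (∫ x in (0 : ℝ)..1, (fderiv ℝ f (p, x)).comp (ContinuousLinearMap.inl ℝ P ℝ)) p := by
  have hOu : IsOpen (O ×ˢ (Set.univ : Set ℝ)) := hO.prod isOpen_univ
  have hdf : ContinuousOn (fun q => (fderiv ℝ f q).comp (ContinuousLinearMap.inl ℝ P ℝ))
      (O ×ˢ Set.univ) :=
    (hf.continuousOn_fderiv_of_isOpen hOu (by simp)).clm_comp continuousOn_const
  -- A closed ball of the finite-dimensional parameter space times `[0, 1]` is compact, so the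
  -- parameter derivative of the integrand has a constant bound there.
  obtain ⟨r, hr, hrO⟩ := Metric.nhds_basis_closedBall.mem_iff.1 (hO.mem_nhds hp)
  have hK : IsCompact (Metric.closedBall p r ×ˢ Set.Icc (0 : ℝ) 1) :=
    (isCompact_closedBall p r).prod isCompact_Icc
  obtain ⟨C, hC⟩ := hK.exists_bound_of_continuousOn
    (hdf.mono (Set.prod_mono hrO (Set.subset_univ _)))
  refine intervalIntegral.hasFDerivAt_integral_of_dominated_of_fderiv_le (𝕜 := ℝ)
    (F := fun p x => f (p, x))
    (F' := fun p x => (fderiv ℝ f (p, x)).comp (ContinuousLinearMap.inl ℝ P ℝ))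
    (bound := fun _ => C) (Metric.closedBall_mem_nhds p hr) ?_ ?_ ?_ ?_ ?_ ?_
  · filter_upwards [hO.mem_nhds hp] with p' hp'
    exact (continuous_slice hf.continuousOn hp').aestronglyMeasurable
  · exact (continuous_slice hf.continuousOn hp).intervalIntegrable _ _
  · exact (hdf.comp_continuous (f := fun x : ℝ => (p, x)) (by fun_prop)
      fun x => ⟨hp, trivial⟩).aestronglyMeasurable
  · refine Filter.Eventually.of_forall fun x hx p' hp' => hC (p', x) ⟨hp', ?_⟩
    rw [Set.uIoc_of_le zero_le_one] at hx
    exact ⟨hx.1.le, hx.2⟩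
  · exact intervalIntegrable_const
  · refine Filter.Eventually.of_forall fun x _ p' hp' => ?_
    have h := ((hf.contDiffAt (hOu.mem_nhds (x := (p', x)) ⟨hrO hp', trivial⟩)).differentiableAt
      (by simp)).hasFDerivAt
    exact h.comp p' (hasFDerivAt_prodMk_left p' x)

theorem integral_fderiv_apply {f : P × ℝ → ℝ} {O : Set P}
    (hO : IsOpen O) (hf : ContDiffOn ℝ ∞ f (O ×ˢ Set.univ)) {p : P} (hp : p ∈ O) (e : P) :
    (∫ x in (0 : ℝ)..1, (fderiv ℝ f (p, x)).comp (ContinuousLinearMap.inl ℝ P ℝ)) e =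
      ∫ x in (0 : ℝ)..1, fderiv ℝ f (p, x) (e, 0) := by
  have hOu : IsOpen (O ×ˢ (Set.univ : Set ℝ)) := hO.prod isOpen_univ
  have hdf : ContinuousOn (fun q => (fderiv ℝ f q).comp (ContinuousLinearMap.inl ℝ P ℝ))
      (O ×ˢ Set.univ) :=
    (hf.continuousOn_fderiv_of_isOpen hOu (by simp)).clm_comp continuousOn_const
  rw [ContinuousLinearMap.intervalIntegral_apply]
  · rfl
  · exact (hdf.comp_continuous (f := fun x : ℝ => (p, x)) (by fun_prop)
      fun x => ⟨hp, trivial⟩).intervalIntegrable _ _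

theorem hasDerivAt_integral_line [FiniteDimensional ℝ P] {f : P × ℝ → ℝ} {O : Set P}
    (hO : IsOpen O) (hf : ContDiffOn ℝ ∞ f (O ×ˢ Set.univ)) {p : P} (hp : p ∈ O) (e : P) :
    HasDerivAt (fun t : ℝ => ∫ x in (0 : ℝ)..1, f (p + t • e, x))
      (∫ x in (0 : ℝ)..1, fderiv ℝ f (p, x) (e, 0)) 0 := by
  rw [← integral_fderiv_apply hO hf hp]
  have h := hasFDerivAt_integral_of_contDiffOn hO hf hp
  have hl : HasDerivAt (fun t : ℝ => p + t • e) e 0 := by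
    simpa using ((hasDerivAt_id (0 : ℝ)).smul_const e).const_add p
  exact HasFDerivAt.comp_hasDerivAt (0 : ℝ) (by simpa using h) hl

/-- If the derivatives of `g` along two directions are the integrals of two smooth densities, then
the symmetry of the second derivatives of `g` holds under the integral sign. -/
theorem integral_cross_derivative [FiniteDimensional ℝ P] {g : P → ℝ} {O : Set P}
    (hO : IsOpen O) {e₁ e₂ : P} {θ₁ θ₂ : P × ℝ → ℝ}
    (h₁ : ContDiffOn ℝ ∞ θ₁ (O ×ˢ Set.univ)) (h₂ : ContDiffOn ℝ ∞ θ₂ (O ×ˢ Set.univ))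
    (hg₁ : ∀ p ∈ O, HasDerivAt (fun t : ℝ => g (p + t • e₁)) (∫ x in (0 : ℝ)..1, θ₁ (p, x)) 0)
    (hg₂ : ∀ p ∈ O, HasDerivAt (fun t : ℝ => g (p + t • e₂)) (∫ x in (0 : ℝ)..1, θ₂ (p, x)) 0)
    {p : P} (hp : p ∈ O) :
    ∫ x in (0 : ℝ)..1, (fderiv ℝ θ₂ (p, x) (e₁, 0) - fderiv ℝ θ₁ (p, x) (e₂, 0)) = 0 := by
  have hOu : IsOpen (O ×ˢ (Set.univ : Set ℝ)) := hO.prod isOpen_univ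
  -- Only derivatives of `g` along the two directions are known, so `g` is studied on the plane
  -- through `p` that they span.
  let ℓ : ℝ × ℝ → P := fun z => p + z.1 • e₁ + z.2 • e₂
  have hℓc : Continuous ℓ := by fun_prop
  have hℓ0 : ℓ (0, 0) = p := by simp [ℓ]
  have hev : ∀ᶠ z in nhds ((0, 0) : ℝ × ℝ), ℓ z ∈ O :=
    hℓc.continuousAt.eventually (hO.mem_nhds (by rwa [hℓ0]))
  let H : (P × ℝ → ℝ) → P → ℝ := fun θ p => ∫ x in (0 : ℝ)..1, θ (p, x)
  have hH : ∀ θ : P × ℝ → ℝ, ContDiffOn ℝ ∞ θ (O ×ˢ Set.univ) → ∀ p ∈ O,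
      DifferentiableAt ℝ (H θ) p :=
    fun θ h p hp => (hasFDerivAt_integral_of_contDiffOn hO h hp).differentiableAt
  let G : ℝ → ℝ → ℝ := fun s t => g (ℓ (s, t))
  let G₁ : ℝ → ℝ → ℝ →L[ℝ] ℝ := fun s t => ContinuousLinearMap.toSpanSingleton ℝ (H θ₁ (ℓ (s, t)))
  let G₂ : ℝ → ℝ → ℝ →L[ℝ] ℝ := fun s t => ContinuousLinearMap.toSpanSingleton ℝ (H θ₂ (ℓ (s, t)))
  have d₁ : ∀ z, ℓ z ∈ O → HasFDerivAt (G · z.2) (G₁ z.1 z.2) z.1 := by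
    intro z hz
    have h := hg₁ _ hz
    have h' : HasDerivAt (fun s => G s z.2) (H θ₁ (ℓ z)) z.1 := by
      have := HasDerivAt.scomp_of_eq (h := fun s : ℝ => s - z.1) (x := z.1) h
        ((hasDerivAt_id z.1).sub_const z.1) (by simp)
      rw [one_smul] at this
      refine this.congr_of_eventuallyEq (Filter.Eventually.of_forall fun s => ?_)
      simp only [G, ℓ, Function.comp]
      congr 1
      module
    exact h'.hasFDerivAt
  have d₂ : ∀ z, ℓ z ∈ O → HasFDerivAt (G z.1 ·) (G₂ z.1 z.2) z.2 := by
    intro z hz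
    have h := hg₂ _ hz
    have h' : HasDerivAt (fun s => G z.1 s) (H θ₂ (ℓ z)) z.2 := by
      have := HasDerivAt.scomp_of_eq (h := fun s : ℝ => s - z.2) (x := z.2) h
        ((hasDerivAt_id z.2).sub_const z.2) (by simp)
      rw [one_smul] at this
      refine this.congr_of_eventuallyEq (Filter.Eventually.of_forall fun s => ?_)
      simp only [G, ℓ, Function.comp]
      congr 1
      module
    exact h'.hasFDerivAt
  have hHd : ∀ θ : P × ℝ → ℝ, ContDiffOn ℝ ∞ θ (O ×ˢ Set.univ) → ∀ z, ℓ z ∈ O →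
      HasFDerivAt (fun z => H θ (ℓ z)) ((fderiv ℝ (H θ) (ℓ z)).comp
        ((ContinuousLinearMap.fst ℝ ℝ ℝ).smulRight e₁ +
          (ContinuousLinearMap.snd ℝ ℝ ℝ).smulRight e₂)) z := by
    intro θ h z hz
    have hl : HasFDerivAt ℓ ((ContinuousLinearMap.fst ℝ ℝ ℝ).smulRight e₁ +
          (ContinuousLinearMap.snd ℝ ℝ ℝ).smulRight e₂) z := by
      have a := (((ContinuousLinearMap.fst ℝ ℝ ℝ).smulRight e₁).hasFDerivAt (x := z)).const_add p
      have b := ((ContinuousLinearMap.snd ℝ ℝ ℝ).smulRight e₂).hasFDerivAt (x := z)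
      exact a.add b
    exact (hH θ h _ hz).hasFDerivAt.comp z hl
  let Gp : ℝ × ℝ → ℝ × ℝ →L[ℝ] ℝ := fun z => (G₁ z.1 z.2).coprod (G₂ z.1 z.2)
  have hGp : ∀ z, Gp z = H θ₁ (ℓ z) • ContinuousLinearMap.fst ℝ ℝ ℝ +
      H θ₂ (ℓ z) • ContinuousLinearMap.snd ℝ ℝ ℝ := by
    intro z
    ext <;> simp [Gp, G₁, G₂]
  have cG : ∀ θ : P × ℝ → ℝ, ContDiffOn ℝ ∞ θ (O ×ˢ Set.univ) → ∀ z, ℓ z ∈ O →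
      ContinuousAt (fun z => ContinuousLinearMap.toSpanSingleton ℝ (H θ (ℓ z))) z := by
    intro θ h z hz
    exact (ContinuousLinearMap.toSpanSingletonCLE (𝕜 := ℝ) (E := ℝ)).continuous.continuousAt.comp
      (hHd θ h z hz).continuousAt
  -- Both partial derivatives exist near the origin and are continuous, hence `G` is differentiable
  -- there; its derivative `Gp` is again differentiable, which is what the symmetry theorem
  -- requires.
  have hG : ∀ᶠ z in nhds ((0, 0) : ℝ × ℝ), HasFDerivAt (Function.uncurry G) (Gp z) z := by
    filter_upwards [hev.eventually_nhds] with z hz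
    exact (hasStrictFDerivAt_uncurry_coprod (f₁ := G₁) (f₂ := G₂) (hz.mono d₁) (hz.mono d₂)
      (cG _ h₁ z hz.self_of_nhds) (cG _ h₂ z hz.self_of_nhds)).hasFDerivAt
  have hp0 : ℓ (0, 0) ∈ O := by rwa [hℓ0]
  have hG' := ((hHd θ₁ h₁ (0, 0) hp0).smul_const (ContinuousLinearMap.fst ℝ ℝ ℝ)).add
    ((hHd θ₂ h₂ (0, 0) hp0).smul_const (ContinuousLinearMap.snd ℝ ℝ ℝ))
  have hG'' := hG'.congr_of_eventuallyEq (f₁ := Gp) (Filter.Eventually.of_forall hGp)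
  have key := second_derivative_symmetric_of_eventually hG hG'' (1, 0) (0, 1)
  simp only [add_apply, ContinuousLinearMap.smulRight_apply, ContinuousLinearMap.comp_apply,
    ContinuousLinearMap.coe_fst', ContinuousLinearMap.coe_snd', smul_apply, hℓ0, one_smul,
    zero_smul, add_zero, zero_add, smul_eq_mul, mul_zero, mul_one] at key
  rw [(hasFDerivAt_integral_of_contDiffOn hO h₁ hp).fderiv,
    (hasFDerivAt_integral_of_contDiffOn hO h₂ hp).fderiv,
    integral_fderiv_apply hO h₁ hp, integral_fderiv_apply hO h₂ hp] at key
  have ci : ∀ θ : P × ℝ → ℝ, ContDiffOn ℝ ∞ θ (O ×ˢ Set.univ) → ∀ e : P,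
      IntervalIntegrable (fun x => fderiv ℝ θ (p, x) (e, 0)) MeasureTheory.volume 0 1 := by
    intro θ h e
    refine Continuous.intervalIntegrable ?_ _ _
    exact ((h.continuousOn_fderiv_of_isOpen hOu (by simp)).comp_continuous
      (f := fun x : ℝ => (p, x)) (by fun_prop) fun x => ⟨hp, trivial⟩).clm_apply continuous_const
  rw [intervalIntegral.integral_sub (ci _ h₂ _) (ci _ h₁ _), key, sub_self]

end Integrals

/-! ### Pointwise algebra of the twisted Hamiltonian vectors -/

section Algebra

variable {V : Type*} [NormedAddCommGroup V] [NormedSpace ℝ V]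

/-- Alternating 3-forms as iterated linear maps: `trilin τ x y z = τ ![x, y, z]`. -/
noncomputable def trilin : (V [⋀^Fin 3]→L[ℝ] ℝ) →L[ℝ] V →L[ℝ] V →L[ℝ] V →L[ℝ] ℝ :=
  let c₃ : (V [× 3]→L[ℝ] ℝ) →L[ℝ] V →L[ℝ] V [× 2]→L[ℝ] ℝ :=
    (continuousMultilinearCurryLeftEquiv ℝ (fun _ : Fin 3 => V) ℝ).toContinuousLinearEquiv
  let c₂ : (V [× 2]→L[ℝ] ℝ) →L[ℝ] V →L[ℝ] V [× 1]→L[ℝ] ℝ :=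
    (continuousMultilinearCurryLeftEquiv ℝ (fun _ : Fin 2 => V) ℝ).toContinuousLinearEquiv
  let c₁ : (V [× 1]→L[ℝ] ℝ) →L[ℝ] V →L[ℝ] ℝ :=
    (continuousMultilinearCurryFin1 ℝ V ℝ).toContinuousLinearEquiv
  ContinuousLinearMap.compL ℝ V _ _ (ContinuousLinearMap.compL ℝ V _ _ c₁ ∘L c₂) ∘L c₃ ∘L
    ContinuousAlternatingMap.toContinuousMultilinearMapCLM ℝ

theorem trilin_apply (τ : V [⋀^Fin 3]→L[ℝ] ℝ) (x y z : V) : trilin τ x y z = τ ![x, y, z] := by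
  change τ _ = _
  congr 1
  ext i
  fin_cases i <;> rfl

theorem contDiff_trilin : ContDiff ℝ ∞ (trilin (V := V)) := ContinuousLinearMap.contDiff _

/-- A trilinear form is alternating if it is skew in neighbouring arguments. -/
structure IsAlt (S : V →L[ℝ] V →L[ℝ] V →L[ℝ] ℝ) : Prop where
  swap₁₂ : ∀ x y z, S x y z = -S y x z
  swap₂₃ : ∀ x y z, S x y z = -S x z y

theorem isAlt_trilin (τ : V [⋀^Fin 3]→L[ℝ] ℝ) : IsAlt (trilin τ) := by
  constructor
  · intro x y z
    simp only [trilin_apply]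
    have := τ.toAlternatingMap.map_swap ![y, x, z] (show (0 : Fin 3) ≠ 1 by decide)
    have e : ![y, x, z] ∘ Equiv.swap (0 : Fin 3) 1 = ![x, y, z] := by
      ext i; fin_cases i <;> simp [Equiv.swap_apply_def]
    rw [e] at this
    exact this
  · intro x y z
    simp only [trilin_apply]
    have := τ.toAlternatingMap.map_swap ![x, z, y] (show (1 : Fin 3) ≠ 2 by decide)
    have e : ![x, z, y] ∘ Equiv.swap (1 : Fin 3) 2 = ![x, y, z] := by
      ext i; fin_cases i <;> simp [Equiv.swap_apply_def]
    rw [e] at this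
    exact this

/-- A covariant 3-form is closed at `u` iff the cyclic sum of its derivatives vanishes. -/
theorem cyclic_fderiv_of_extDeriv_eq_zero {T : V → V [⋀^Fin 3]→L[ℝ] ℝ} {u : V}
    (hT : DifferentiableAt ℝ T u) (h : extDeriv T u = 0) (w x y z : V) :
    fderiv ℝ (fun u => trilin (T u)) u w x y z - fderiv ℝ (fun u => trilin (T u)) u x w y z
      + fderiv ℝ (fun u => trilin (T u)) u y w x z
      - fderiv ℝ (fun u => trilin (T u)) u z w x y = 0 := by
  have hS : HasFDerivAt (fun u => trilin (T u)) (trilin ∘L fderiv ℝ T u) u :=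
    trilin.hasFDerivAt.comp u hT.hasFDerivAt
  have hev : ∀ (m : Fin 3 → V) (v : V), fderiv ℝ (fun u => T u m) u v = fderiv ℝ T u v m := by
    intro m v
    rw [fderiv_continuousAlternatingMap_apply_const_apply hT]
  have h0 := congrArg (fun τ => τ ![w, x, y, z]) h
  simp only [extDeriv_apply hT, hev] at h0
  replace h0 := (Fin.sum_univ_four _).symm.trans h0
  rw [hS.fderiv]
  simp only [ContinuousLinearMap.comp_apply, trilin_apply]
  have r0 : Fin.removeNth (0 : Fin 4) ![w, x, y, z] = ![x, y, z] := by
    ext i; fin_cases i <;> rfl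
  have r1 : Fin.removeNth (1 : Fin 4) ![w, x, y, z] = ![w, y, z] := by
    ext i; fin_cases i <;> rfl
  have r2 : Fin.removeNth (2 : Fin 4) ![w, x, y, z] = ![w, x, z] := by
    ext i; fin_cases i <;> rfl
  have r3 : Fin.removeNth (3 : Fin 4) ![w, x, y, z] = ![w, x, y] := by
    ext i; fin_cases i <;> rfl
  simp [r0,r1,r2,r3] at h0
  linear_combination h0

variable {σ : (V →L[ℝ] ℝ) →L[ℝ] V} {S : V →L[ℝ] V →L[ℝ] V →L[ℝ] ℝ}

/-- The pairing `a(X_b)` of a covector with a twisted Hamiltonian vector is skew. -/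
theorem pairing_skew (hσ : ∀ a b : V →L[ℝ] ℝ, a (σ b) = -b (σ a)) (hS : IsAlt S) {a b : V →L[ℝ] ℝ}
    {X Y v : V} (hX : X = σ (a - S X v)) (hY : Y = σ (b - S Y v)) : a Y = -b X := by
  have h := hσ (a - S X v) (b - S Y v)
  rw [← hX, ← hY] at h
  simp only [sub_apply] at h
  have h1 := hS.swap₂₃ X v Y
  have h2 := hS.swap₂₃ Y v X
  have h3 := hS.swap₁₂ X Y v
  linarith

variable {Q : Type*} [NormedAddCommGroup Q] [NormedSpace ℝ Q]

/-- The derivative of the density `a(X_b)` of the bracket. -/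
theorem fderiv_pairing {a b : Q → V →L[ℝ] ℝ} {σ : Q → (V →L[ℝ] ℝ) →L[ℝ] V}
    {S : Q → V →L[ℝ] V →L[ℝ] V →L[ℝ] ℝ} {v Y : Q → V} {X : V} {q : Q}
    (ha : DifferentiableAt ℝ a q) (hb : DifferentiableAt ℝ b q) (hσ : DifferentiableAt ℝ σ q)
    (hS : DifferentiableAt ℝ S q) (hv : DifferentiableAt ℝ v q) (hY : DifferentiableAt ℝ Y q)
    (hskew : ∀ a b : V →L[ℝ] ℝ, a (σ q b) = -b (σ q a)) (halt : IsAlt (S q))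
    (hX : X = σ q (a q - S q X (v q)))
    (hYeq : ∀ᶠ r in nhds q, Y r = σ r (b r - S r (Y r) (v r))) (e : Q) :
    fderiv ℝ (fun r => a r (Y r)) q e =
      fderiv ℝ a q e (Y q) - fderiv ℝ b q e X
      + (a q - S q X (v q)) (fderiv ℝ σ q e (b q - S q (Y q) (v q)))
      + fderiv ℝ S q e (Y q) (v q) X + S q (Y q) (fderiv ℝ v q e) X := by
  have h1 := (ha.hasFDerivAt.clm_apply hY.hasFDerivAt).fderiv
  have hSY := (hS.hasFDerivAt.clm_apply hY.hasFDerivAt).clm_apply hv.hasFDerivAt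
  have hbt := hb.hasFDerivAt.sub hSY
  have h2 := (hσ.hasFDerivAt.clm_apply hbt).congr_of_eventuallyEq hYeq
  have h3 := congrArg (fun L => L e) (hY.hasFDerivAt.unique h2)
  rw [h1]
  -- Moving `σ` off the derivative of its argument replaces it by the pairing of that derivative
  -- with `X`. The term `S Y' v X` that appears cancels against `S X v Y'`, the difference between
  -- `a` and `a - S X v` on `Y'`; hence the conclusion does not contain `Y'`.
  have hsk := hskew (a q - S q X (v q)) (fderiv ℝ b q e -
    (fderiv ℝ S q e (Y q) (v q) + S q (fderiv ℝ Y q e) (v q) + S q (Y q) (fderiv ℝ v q e)))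
  rw [← hX] at hsk
  have s4 := halt.swap₁₂ (fderiv ℝ Y q e) (v q) X
  have s5 := halt.swap₂₃ (v q) (fderiv ℝ Y q e) X
  have s6 := halt.swap₁₂ (v q) X (fderiv ℝ Y q e)
  have h4 := congrArg (a q) h3
  have h5 := congrArg (S q X (v q)) h3
  simp only [ContinuousLinearMap.flip_apply, add_apply, sub_apply, ContinuousLinearMap.comp_apply,
    map_add, map_sub, Pi.sub_apply] at h4 h5 hsk ⊢
  linarith

end Algebra

/-! ### Tensors and the operator `M` in a chart -/

section Charts

variable {N : ℕ} {M : Type*} [TopologicalSpace M] [ChartedSpace (EuclideanSpace ℝ (Fin N)) M]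

local notation "𝔼" => EuclideanSpace ℝ (Fin N)

theorem isInvertible_chartDiff [IsManifold (𝓡 N) ∞ M] {φ : OpenPartialHomeomorph M 𝔼}
    (hφ : φ ∈ atlas 𝔼 M) {p : M} (hp : p ∈ φ.source) : (chartDiff φ p).IsInvertible :=
  have : IsManifold (𝓡 N) 1 M := IsManifold.of_le (n := ∞) (by simp)
  ⟨(mdifferentiable_of_mem_atlas (I := 𝓡 N) hφ).mfderiv hp, rfl⟩

theorem chartFrame_chartDiff [IsManifold (𝓡 N) ∞ M] {φ : OpenPartialHomeomorph M 𝔼}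
    (hφ : φ ∈ atlas 𝔼 M) {p : M} (hp : p ∈ φ.source) (v : TangentSpace (𝓡 N) p) :
    chartFrame φ p (chartDiff φ p v) = v := by
  obtain ⟨e, he⟩ := isInvertible_chartDiff hφ hp
  rw [chartFrame, ← he, ContinuousLinearMap.inverse_equiv]
  exact e.symm_apply_apply v

theorem chartDiff_chartFrame [IsManifold (𝓡 N) ∞ M] {φ : OpenPartialHomeomorph M 𝔼}
    (hφ : φ ∈ atlas 𝔼 M) {p : M} (hp : p ∈ φ.source) (v : 𝔼) :
    chartDiff φ p (chartFrame φ p v) = v := by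
  obtain ⟨e, he⟩ := isInvertible_chartDiff hφ hp
  rw [chartFrame, ← he, ContinuousLinearMap.inverse_equiv]
  exact e.apply_symm_apply v

/-- The velocity of a curve in a chart. -/
theorem hasDerivAt_chart_comp [IsManifold (𝓡 N) ∞ M] {φ : OpenPartialHomeomorph M 𝔼}
    (hφ : φ ∈ atlas 𝔼 M) {κ : ℝ → M} {t : ℝ} (hκ : MDifferentiableAt 𝓘(ℝ, ℝ) (𝓡 N) κ t)
    (ht : κ t ∈ φ.source) :
    HasDerivAt (fun s => φ (κ s)) (chartDiff φ (κ t) (mfderiv 𝓘(ℝ, ℝ) (𝓡 N) κ t (1 : ℝ))) t := by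
  have : IsManifold (𝓡 N) 1 M := IsManifold.of_le (n := ∞) (by simp)
  have h1 := ((mdifferentiable_of_mem_atlas (I := 𝓡 N) hφ).mdifferentiableAt ht).hasMFDerivAt
  let L : ℝ →L[ℝ] 𝔼 := mfderiv 𝓘(ℝ, ℝ) (𝓡 N) κ t
  let D : 𝔼 →L[ℝ] 𝔼 := chartDiff φ (κ t)
  have h2 : HasFDerivAt (fun s => φ (κ s)) (D ∘L L) t :=
    (h1.comp t hκ.hasMFDerivAt).hasFDerivAt
  exact h2.hasDerivAt

/-- The bivector in a chart as a map of covectors to vectors. -/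
noncomputable def sharpChart (π : PoissonStructure N M) (φ : OpenPartialHomeomorph M 𝔼) (u : 𝔼) :
    (𝔼 →L[ℝ] ℝ) →L[ℝ] 𝔼 :=
  LinearMap.toContinuousLinearMap
    { toFun := fun b => sharpInChart π.sharp φ b u
      map_add' := fun b b' => by
        simp only [sharpInChart, ContinuousLinearMap.add_comp, map_add]
      map_smul' := fun r b => by
        simp only [sharpInChart, ContinuousLinearMap.smul_comp, map_smul, RingHom.id_apply] }

theorem sharpChart_skew (π : PoissonStructure N M) (φ : OpenPartialHomeomorph M 𝔼) (u : 𝔼)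
    (a b : 𝔼 →L[ℝ] ℝ) : a (sharpChart π φ u b) = -b (sharpChart π φ u a) :=
  π.skew (φ.symm u) (a ∘L chartDiff φ (φ.symm u)) (b ∘L chartDiff φ (φ.symm u))

theorem contDiffOn_sharpChart (π : PoissonStructure N M) {φ : OpenPartialHomeomorph M 𝔼}
    (hφ : φ ∈ atlas 𝔼 M) : ContDiffOn ℝ ∞ (sharpChart π φ) φ.target := by
  rw [contDiffOn_clm_apply]
  intro b
  rw [contDiffOn_euclidean]
  intro i
  exact π.smooth φ hφ (EuclideanSpace.proj i) b

/-- The Jacobi identity of the Poisson structure. -/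
theorem sharpChart_jacobi (π : PoissonStructure N M) {φ : OpenPartialHomeomorph M 𝔼}
    (hφ : φ ∈ atlas 𝔼 M) {u : 𝔼} (hu : u ∈ φ.target) (a b c : 𝔼 →L[ℝ] ℝ) :
    a (fderiv ℝ (sharpChart π φ) u (sharpChart π φ u c) b) +
      b (fderiv ℝ (sharpChart π φ) u (sharpChart π φ u a) c) +
      c (fderiv ℝ (sharpChart π φ) u (sharpChart π φ u b) a) = 0 := by
  have hd : DifferentiableAt ℝ (sharpChart π φ) u :=
    ((contDiffOn_sharpChart π hφ).contDiffAt (φ.open_target.mem_nhds hu)).differentiableAt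
      (by simp)
  have key : ∀ a b : 𝔼 →L[ℝ] ℝ, ∀ w, fderiv ℝ (bivectorInChart π.sharp φ a b) u w =
      a (fderiv ℝ (sharpChart π φ) u w b) := by
    intro a b w
    have h := a.hasFDerivAt.comp u (hd.hasFDerivAt.clm_apply (hasFDerivAt_const b u))
    have e : (⇑a ∘ fun y => sharpChart π φ y b) = bivectorInChart π.sharp φ a b := rfl
    rw [e] at h
    rw [h.fderiv]
    simp
  have h := π.jacobi φ hφ u hu a b c
  simp only [key] at h
  exact h

/-- The 3-form in a chart as an iterated linear map. -/
noncomputable def formChart (T : ClosedThreeForm N M) (φ : OpenPartialHomeomorph M 𝔼) (u : 𝔼) :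
    𝔼 →L[ℝ] 𝔼 →L[ℝ] 𝔼 →L[ℝ] ℝ :=
  trilin (formInChart T.form φ u)

theorem isAlt_formChart (T : ClosedThreeForm N M) (φ : OpenPartialHomeomorph M 𝔼) (u : 𝔼) :
    IsAlt (formChart T φ u) := isAlt_trilin _

theorem contDiffOn_formChart (T : ClosedThreeForm N M) {φ : OpenPartialHomeomorph M 𝔼}
    (hφ : φ ∈ atlas 𝔼 M) : ContDiffOn ℝ ∞ (formChart T φ) φ.target :=
  contDiff_trilin.comp_contDiffOn (T.smooth φ hφ)

theorem isAlt_fderiv_formChart (T : ClosedThreeForm N M) {φ : OpenPartialHomeomorph M 𝔼}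
    (hφ : φ ∈ atlas 𝔼 M) {u : 𝔼} (hu : u ∈ φ.target) (w : 𝔼) :
    IsAlt (fderiv ℝ (formChart T φ) u w) := by
  have hd : DifferentiableAt ℝ (formInChart T.form φ) u :=
    ((T.smooth φ hφ).contDiffAt (φ.open_target.mem_nhds hu)).differentiableAt (by simp)
  have h : HasFDerivAt (formChart T φ) (trilin ∘L fderiv ℝ (formInChart T.form φ) u) u :=
    trilin.hasFDerivAt.comp u hd.hasFDerivAt
  rw [h.fderiv]
  exact isAlt_trilin _

/-- The 3-form is closed. -/
theorem formChart_closed (T : ClosedThreeForm N M) {φ : OpenPartialHomeomorph M 𝔼}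
    (hφ : φ ∈ atlas 𝔼 M) {u : 𝔼} (hu : u ∈ φ.target) (w x y z : 𝔼) :
    fderiv ℝ (formChart T φ) u w x y z - fderiv ℝ (formChart T φ) u x w y z
      + fderiv ℝ (formChart T φ) u y w x z - fderiv ℝ (formChart T φ) u z w x y = 0 :=
  cyclic_fderiv_of_extDeriv_eq_zero
    (((T.smooth φ hφ).contDiffAt (φ.open_target.mem_nhds hu)).differentiableAt (by simp))
    (T.closed φ hφ u hu) w x y z

variable [IsManifold (𝓡 N) ∞ M]

theorem chartDiff_sharp (π : PoissonStructure N M) {φ : OpenPartialHomeomorph M 𝔼}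
    (hφ : φ ∈ atlas 𝔼 M) {p : M} (hp : p ∈ φ.source) (α : TangentSpace (𝓡 N) p →L[ℝ] ℝ) :
    chartDiff φ p (π.sharp p α) = sharpChart π φ (φ p) (α ∘L chartFrame φ p) := by
  -- `φ.symm (φ p)` equals `p` only propositionally, and the tangent spaces depend on the point;
  -- stating the claim for a variable point allows substitution.
  have key : ∀ p', p' = p → chartDiff φ p (π.sharp p α) =
      chartDiff φ p' (π.sharp p' ((α ∘L chartFrame φ p) ∘L chartDiff φ p')) := by
    rintro _ rfl
    congr 2
    ext v
    simp [chartFrame_chartDiff hφ hp]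
  exact key _ (φ.left_inv hp)

theorem form_eq_formChart (T : ClosedThreeForm N M) {φ : OpenPartialHomeomorph M 𝔼}
    (hφ : φ ∈ atlas 𝔼 M) {p : M} (hp : p ∈ φ.source) (x y z : TangentSpace (𝓡 N) p) :
    T.form p ![x, y, z] =
      formChart T φ (φ p) (chartDiff φ p x) (chartDiff φ p y) (chartDiff φ p z) := by
  have key : ∀ p' (h : p' = p), T.form p ![x, y, z] = T.form p' (chartFrame φ p' ∘
      ![chartDiff φ p x, chartDiff φ p y, chartDiff φ p z]) := by
    rintro _ rfl
    congr 1
    ext i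
    fin_cases i <;> simp [chartFrame_chartDiff hφ hp]
  rw [formChart, trilin_apply]
  exact key _ (φ.left_inv hp)

/-- The operator `1 + ω T(·, ·, v)` in a chart. -/
noncomputable def opChart {V : Type*} [NormedAddCommGroup V] [NormedSpace ℝ V]
    (σ : (V →L[ℝ] ℝ) →L[ℝ] V) (S : V →L[ℝ] V →L[ℝ] V →L[ℝ] ℝ)
    (v : V) : V →L[ℝ] V := 1 + σ ∘L (S.flip v)

theorem opChart_apply {V : Type*} [NormedAddCommGroup V] [NormedSpace ℝ V]
    (σ : (V →L[ℝ] ℝ) →L[ℝ] V) (S : V →L[ℝ] V →L[ℝ] V →L[ℝ] ℝ)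
    (v w : V) : opChart σ S v w = w + σ (S w v) := rfl

/-- The free argument of `contract` is the first one, that of `formChart` applied to two vectors is
the last; the cyclic permutation between them is even, so no sign appears. -/
theorem contract_comp_chartFrame (T : ClosedThreeForm N M) {φ : OpenPartialHomeomorph M 𝔼}
    (hφ : φ ∈ atlas 𝔼 M) {p : M} (hp : p ∈ φ.source) (w v : TangentSpace (𝓡 N) p) :
    T.contract p w v ∘L chartFrame φ p =
      formChart T φ (φ p) (chartDiff φ p w) (chartDiff φ p v) := by
  ext z
  rw [ContinuousLinearMap.comp_apply, T.contract_apply, form_eq_formChart T hφ hp,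
    chartDiff_chartFrame hφ hp, (isAlt_formChart T φ _).swap₁₂, (isAlt_formChart T φ _).swap₂₃,
    neg_neg]

theorem chartDiff_opM (π : PoissonStructure N M) (T : ClosedThreeForm N M)
    {φ : OpenPartialHomeomorph M 𝔼} (hφ : φ ∈ atlas 𝔼 M) {p : M} (hp : p ∈ φ.source)
    (v w : TangentSpace (𝓡 N) p) :
    chartDiff φ p (opM π T p v w) =
      opChart (sharpChart π φ (φ p)) (formChart T φ (φ p)) (chartDiff φ p v) (chartDiff φ p w) := by
  rw [opChart_apply, ← contract_comp_chartFrame T hφ hp, ← chartDiff_sharp π hφ hp]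
  exact map_add (chartDiff φ p) w (π.sharp p (T.contract p w v))

/-- The two operators are conjugate by the chart differential. Passing to bounded operators on a
fixed space makes openness of the units and smoothness of inversion available. -/
theorem isUnit_opM_iff (π : PoissonStructure N M) (T : ClosedThreeForm N M)
    {φ : OpenPartialHomeomorph M 𝔼} (hφ : φ ∈ atlas 𝔼 M) {p : M} (hp : p ∈ φ.source)
    (v : TangentSpace (𝓡 N) p) :
    IsUnit (opM π T p v) ↔
      IsUnit (opChart (sharpChart π φ (φ p)) (formChart T φ (φ p)) (chartDiff φ p v)) := by
  have hbij : Function.Bijective (chartDiff φ p) := by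
    obtain ⟨e, he⟩ := isInvertible_chartDiff hφ hp
    rw [← he]; exact e.bijective
  have hc : chartDiff φ p ∘ opM π T p v =
      opChart (sharpChart π φ (φ p)) (formChart T φ (φ p)) (chartDiff φ p v) ∘ chartDiff φ p := by
    ext1 w; exact chartDiff_opM π T hφ hp v w
  rw [Module.End.isUnit_iff, ContinuousLinearMap.isUnit_iff_bijective]
  constructor
  · intro h
    have := hbij.comp h
    rw [hc] at this
    exact (Function.Bijective.of_comp_iff _ hbij).1 this
  · intro h
    have := h.comp hbij
    rw [← hc] at this
    exact (Function.Bijective.of_comp_iff' hbij _).1 this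

/-- The defining equation of the vector `A α`. -/
theorem opA_chart_eq (π : PoissonStructure N M) (T : ClosedThreeForm N M)
    {φ : OpenPartialHomeomorph M 𝔼} (hφ : φ ∈ atlas 𝔼 M) {p : M} (hp : p ∈ φ.source)
    {v : TangentSpace (𝓡 N) p} (hu : IsUnit (opM π T p v)) (α : TangentSpace (𝓡 N) p →L[ℝ] ℝ) :
    opChart (sharpChart π φ (φ p)) (formChart T φ (φ p)) (chartDiff φ p v)
      (chartDiff φ p (opA π T p v α)) = sharpChart π φ (φ p) (α ∘L chartFrame φ p) := by
  rw [← chartDiff_opM π T hφ hp, ← chartDiff_sharp π hφ hp]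
  congr 1
  have h := Ring.mul_inverse_cancel _ hu
  exact congrArg (fun L : Module.End ℝ (TangentSpace (𝓡 N) p) => L (π.sharp p α)) h

end Charts

/-! ### Smooth families of loops in charts -/

section Families

variable {N : ℕ} {M : Type*} [TopologicalSpace M] [ChartedSpace (EuclideanSpace ℝ (Fin N)) M]

local notation "𝔼" => EuclideanSpace ℝ (Fin N)

variable {P : Type} [NormedAddCommGroup P] [NormedSpace ℝ P]

/-- A family of loops in a chart. -/
def coord (φ : OpenPartialHomeomorph M 𝔼) (c : P → Loop N M) (q : P × ℝ) : 𝔼 :=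
  φ (c q.1 (q.2 : UnitAddCircle))

/-- The set of the parameters `(p, x)` for which `c p x` lies in the domain of the chart. -/
def chartDomain (O : Set P) (c : P → Loop N M) (φ : OpenPartialHomeomorph M 𝔼) : Set (P × ℝ) :=
  {q | q.1 ∈ O ∧ c q.1 (q.2 : UnitAddCircle) ∈ φ.source}

/-- The derivative of a family of loops with respect to the parameters and the loop variable. -/
noncomputable def famDeriv (c : P → Loop N M) (q : P × ℝ) :
    P × ℝ →L[ℝ] TangentSpace (𝓡 N) (c q.1 (q.2 : UnitAddCircle)) :=
  mfderiv 𝓘(ℝ, P × ℝ) (𝓡 N) (fun q : P × ℝ => c q.1 (q.2 : UnitAddCircle)) q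

variable {O : Set P} {c : P → Loop N M}

theorem isOpen_chartDomain (hO : IsOpen O) (hc : IsSmoothFamilyOn O c)
    (φ : OpenPartialHomeomorph M 𝔼) : IsOpen (chartDomain O c φ) := by
  have h := hc.continuousOn.isOpen_inter_preimage (hO.prod isOpen_univ) φ.open_source
  convert h using 1
  ext q
  simp [chartDomain]

theorem IsSmoothFamilyOn.contMDiffAt (hO : IsOpen O) (hc : IsSmoothFamilyOn O c) {q : P × ℝ}
    (hq : q.1 ∈ O) : ContMDiffAt 𝓘(ℝ, P × ℝ) (𝓡 N) ∞
      (fun q : P × ℝ => c q.1 (q.2 : UnitAddCircle)) q :=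
  ContMDiffOn.contMDiffAt hc ((hO.prod isOpen_univ).mem_nhds ⟨hq, trivial⟩)

theorem IsSmoothFamilyOn.hasMFDerivAt (hO : IsOpen O) (hc : IsSmoothFamilyOn O c) {q : P × ℝ}
    (hq : q.1 ∈ O) : HasMFDerivAt 𝓘(ℝ, P × ℝ) (𝓡 N)
      (fun q : P × ℝ => c q.1 (q.2 : UnitAddCircle)) q (famDeriv c q) :=
  ((hc.contMDiffAt hO hq).mdifferentiableAt (by simp)).hasMFDerivAt

/-- Smoothness is local in charts. -/
theorem contDiffOn_of_chartDomain {G : Type*} [NormedAddCommGroup G] [NormedSpace ℝ G]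
    {f : P × ℝ → G} (hO : IsOpen O) (hc : IsSmoothFamilyOn O c)
    (h : ∀ φ ∈ atlas 𝔼 M, ContDiffOn ℝ ∞ f (chartDomain O c φ)) :
    ContDiffOn ℝ ∞ f (O ×ˢ Set.univ) := by
  rintro q ⟨hq, -⟩
  have hm : q ∈ chartDomain O c (chartAt 𝔼 (c q.1 (q.2 : UnitAddCircle))) :=
    ⟨hq, mem_chart_source _ _⟩
  exact ((h _ (chart_mem_atlas _ _)).contDiffAt
    ((isOpen_chartDomain hO hc _).mem_nhds hm)).contDiffWithinAt

variable [IsManifold (𝓡 N) ∞ M] {φ : OpenPartialHomeomorph M (EuclideanSpace ℝ (Fin N))}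

theorem contDiffOn_coord (hO : IsOpen O) (hc : IsSmoothFamilyOn O c) (hφ : φ ∈ atlas 𝔼 M) :
    ContDiffOn ℝ ∞ (coord φ c) (chartDomain O c φ) := by
  intro q hq
  have h1 : ContMDiffAt (𝓡 N) (𝓡 N) ∞ φ (c q.1 (q.2 : UnitAddCircle)) :=
    contMDiffAt_of_mem_maximalAtlas (IsManifold.subset_maximalAtlas hφ) hq.2
  have h2 := h1.comp q (hc.contMDiffAt hO hq.1)
  exact (contMDiffAt_iff_contDiffAt.1 h2).contDiffWithinAt

theorem coord_mem_target {q : P × ℝ} (hq : q ∈ chartDomain O c φ) : coord φ c q ∈ φ.target :=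
  φ.map_source hq.2

theorem chartDiff_famDeriv (hO : IsOpen O) (hc : IsSmoothFamilyOn O c) (hφ : φ ∈ atlas 𝔼 M)
    {q : P × ℝ} (hq : q ∈ chartDomain O c φ) (ξ : P × ℝ) :
    chartDiff φ (c q.1 (q.2 : UnitAddCircle)) (famDeriv c q ξ) = fderiv ℝ (coord φ c) q ξ := by
  have : IsManifold (𝓡 N) 1 M := IsManifold.of_le (n := ∞) (by simp)
  have h1 := ((mdifferentiable_of_mem_atlas (I := 𝓡 N) hφ).mdifferentiableAt hq.2).hasMFDerivAt
  let L : P × ℝ →L[ℝ] 𝔼 := famDeriv c q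
  let D : 𝔼 →L[ℝ] 𝔼 := chartDiff φ (c q.1 (q.2 : UnitAddCircle))
  have h2 : HasFDerivAt (coord φ c) (D ∘L L) q :=
    (h1.comp q (hc.hasMFDerivAt hO hq.1)).hasFDerivAt
  rw [h2.fderiv]
  rfl

theorem velocity_eq_famDeriv (hO : IsOpen O) (hc : IsSmoothFamilyOn O c) {p : P} (hp : p ∈ O)
    (x : ℝ) : (c p).velocity x = famDeriv c (p, x) (0, 1) := by
  have h1 : HasMFDerivAt 𝓘(ℝ, ℝ) 𝓘(ℝ, P × ℝ) (fun y : ℝ => (p, y)) x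
      (ContinuousLinearMap.inr ℝ P ℝ) := (hasFDerivAt_prodMk_right p x).hasMFDerivAt
  have h2 := HasMFDerivAt.comp x (hc.hasMFDerivAt hO (q := (p, x)) hp) h1
  exact congrArg (fun L : ℝ →L[ℝ] 𝔼 => L 1) h2.mfderiv

theorem chartDiff_velocity (hO : IsOpen O) (hc : IsSmoothFamilyOn O c) (hφ : φ ∈ atlas 𝔼 M)
    {q : P × ℝ} (hq : q ∈ chartDomain O c φ) :
    chartDiff φ (c q.1 (q.2 : UnitAddCircle)) ((c q.1).velocity q.2) =
      fderiv ℝ (coord φ c) q (0, 1) := by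
  rw [velocity_eq_famDeriv hO hc hq.1, chartDiff_famDeriv hO hc hφ hq]

theorem mfderiv_line_eq_famDeriv (hO : IsOpen O) (hc : IsSmoothFamilyOn O c) {p e : P} {t : ℝ}
    (hp : p + t • e ∈ O) (x : ℝ) :
    mfderiv 𝓘(ℝ, ℝ) (𝓡 N) (fun s : ℝ => c (p + s • e) (x : UnitAddCircle)) t (1 : ℝ) =
      famDeriv c (p + t • e, x) (e, 0) := by
  have hl : HasFDerivAt (fun s : ℝ => (p + s • e, x))
      ((ContinuousLinearMap.toSpanSingleton ℝ e).prod 0) t := by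
    have := ((hasDerivAt_id t).smul_const e).const_add p
    rw [one_smul] at this
    exact this.hasFDerivAt.prodMk (hasFDerivAt_const x t)
  have h1 : HasMFDerivAt 𝓘(ℝ, ℝ) 𝓘(ℝ, P × ℝ) (fun s : ℝ => (p + s • e, x)) t
      ((ContinuousLinearMap.toSpanSingleton ℝ e).prod 0) := hl.hasMFDerivAt
  have h2 := HasMFDerivAt.comp t (hc.hasMFDerivAt hO (q := (p + t • e, x)) hp) h1
  have h3 := congrArg (fun L : ℝ →L[ℝ] 𝔼 => L 1) h2.mfderiv
  refine h3.trans ?_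
  change famDeriv c (p + t • e, x) ((1 : ℝ) • e, 0) = _
  rw [one_smul]

end Families

/-! ### Second variations of functionals -/

section VariationalDerivative

variable {N : ℕ} {M : Type*} [TopologicalSpace M] [ChartedSpace (EuclideanSpace ℝ (Fin N)) M]
  [IsManifold (𝓡 N) ∞ M]

local notation "𝔼" => EuclideanSpace ℝ (Fin N)

variable {P : Type} [NormedAddCommGroup P] [NormedSpace ℝ P]
variable {U : Set (Loop N M)} {O : Set P} {c : P → U}
  {φ : OpenPartialHomeomorph M (EuclideanSpace ℝ (Fin N))}

/-- The components of a covector field in a chart, along a family of loops. -/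
noncomputable def covCoord (φ : OpenPartialHomeomorph M 𝔼) (α : CovectorField U) (c : P → U)
    (q : P × ℝ) : 𝔼 →L[ℝ] ℝ :=
  (α (c q.1) (q.2 : UnitAddCircle)) ∘L chartFrame φ ((c q.1).1 (q.2 : UnitAddCircle))

/-- The value of a covector field on the variation of a family of loops in the direction `e`. -/
noncomputable def varDensity (α : CovectorField U) (c : P → U) (e : P) (q : P × ℝ) : ℝ :=
  α (c q.1) (q.2 : UnitAddCircle) (famDeriv (fun p => (c p).1) q (e, 0))

theorem covCoord_apply_chartDiff (hφ : φ ∈ atlas 𝔼 M) (α : CovectorField U) {q : P × ℝ}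
    (hq : q ∈ chartDomain O (fun p => (c p).1) φ)
    (w : TangentSpace (𝓡 N) ((c q.1).1 (q.2 : UnitAddCircle))) :
    α (c q.1) (q.2 : UnitAddCircle) w =
      covCoord φ α c q (chartDiff φ ((c q.1).1 (q.2 : UnitAddCircle)) w) := by
  rw [covCoord, ContinuousLinearMap.comp_apply, chartFrame_chartDiff hφ hq.2]

theorem varDensity_eq (hO : IsOpen O) (hc : IsSmoothFamilyOn O fun p => (c p).1)
    (hφ : φ ∈ atlas 𝔼 M) (α : CovectorField U) {q : P × ℝ}
    (hq : q ∈ chartDomain O (fun p => (c p).1) φ) (e : P) :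
    varDensity α c e q =
      covCoord φ α c q (fderiv ℝ (coord φ fun p => (c p).1) q (e, 0)) := by
  rw [varDensity, covCoord_apply_chartDiff hφ α hq, chartDiff_famDeriv hO hc hφ hq]

theorem IsVariationalDerivative.contDiffOn_covCoord [FiniteDimensional ℝ P] {I : U → ℝ}
    {α : CovectorField U} (hα : IsVariationalDerivative U I α) (hO : IsOpen O)
    (hc : IsSmoothFamilyOn O fun p => (c p).1) (hφ : φ ∈ atlas 𝔼 M) :
    ContDiffOn ℝ ∞ (covCoord φ α c) (chartDomain O (fun p => (c p).1) φ) :=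
  hα.smooth P O c hO hc φ hφ

theorem contDiffOn_fderiv_coord {c : P → Loop N M} (hO : IsOpen O) (hc : IsSmoothFamilyOn O c)
    (hφ : φ ∈ atlas 𝔼 M) (ξ : P × ℝ) :
    ContDiffOn ℝ ∞ (fun q => fderiv ℝ (coord φ c) q ξ) (chartDomain O c φ) :=
  ((contDiffOn_coord hO hc hφ).fderiv_of_isOpen (isOpen_chartDomain hO hc φ)
    (m := ∞) (by simp)).clm_apply contDiffOn_const

theorem contDiffOn_varDensity_of_covCoord
    {α : CovectorField U} (hO : IsOpen O)
    (hc : IsSmoothFamilyOn O fun p => (c p).1)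
    (hα : ∀ φ ∈ atlas 𝔼 M, ContDiffOn ℝ ∞ (covCoord φ α c) (chartDomain O (fun p => (c p).1) φ))
    (e : P) : ContDiffOn ℝ ∞ (varDensity α c e) (O ×ˢ Set.univ) := by
  refine contDiffOn_of_chartDomain hO hc fun φ hφ => ?_
  exact ((hα φ hφ).clm_apply (contDiffOn_fderiv_coord hO hc hφ (e, 0))).congr
    fun q hq => varDensity_eq hO hc hφ α hq e

/-- A line in the parameter space restricts the family to a one-parameter family, to which the
definition of the variational derivative applies. -/
theorem IsVariationalDerivative.hasDerivAt_line {I : U → ℝ}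
    {α : CovectorField U} (hα : IsVariationalDerivative U I α) (hO : IsOpen O)
    (hc : IsSmoothFamilyOn O fun p => (c p).1) {p : P} (hp : p ∈ O) (e : P) :
    HasDerivAt (fun t : ℝ => I (c (p + t • e))) (∫ x in (0 : ℝ)..1, varDensity α c e (p, x)) 0 := by
  have hl : Continuous fun t : ℝ => p + t • e := by fun_prop
  have h0 : p + (0 : ℝ) • e = p := by simp
  have hs : IsSmoothFamilyOn ((fun t : ℝ => p + t • e) ⁻¹' O)
      (fun t : ℝ => (c (p + t • e)).1) := by
    have hm : ContMDiff 𝓘(ℝ, ℝ × ℝ) 𝓘(ℝ, P × ℝ) ∞ fun z : ℝ × ℝ => (p + z.1 • e, z.2) :=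
      contMDiff_iff_contDiff.2 (by fun_prop)
    exact ContMDiffOn.comp hc hm.contMDiffOn fun z hz => ⟨hz.1, trivial⟩
  have h := hα.hasDerivAt _ (fun t : ℝ => c (p + t • e)) (hO.preimage hl) hs 0
    (by simpa [h0] using hp)
  convert h using 1
  refine intervalIntegral.integral_congr fun x _ => ?_
  have key : ∀ p', p' = p → varDensity α c e (p, x) = α (c p') (x : UnitAddCircle)
      (famDeriv (fun p => (c p).1) (p', x) (e, 0)) := by
    rintro _ rfl; rfl
  refine (key _ h0).trans ?_
  congr 1
  exact (mfderiv_line_eq_famDeriv hO hc (by simpa [h0] using hp) x).symm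

/-- The symmetry of the second variation. -/
theorem IsVariationalDerivative.integral_cross [FiniteDimensional ℝ P] {I : U → ℝ}
    {α : CovectorField U} (hα : IsVariationalDerivative U I α) (hO : IsOpen O)
    (hc : IsSmoothFamilyOn O fun p => (c p).1) {p : P} (hp : p ∈ O) (e₁ e₂ : P) :
    ∫ x in (0 : ℝ)..1, (fderiv ℝ (varDensity α c e₂) (p, x) (e₁, 0) -
      fderiv ℝ (varDensity α c e₁) (p, x) (e₂, 0)) = 0 := by
  have h := fun e => contDiffOn_varDensity_of_covCoord hO hc
    (fun φ hφ => hα.contDiffOn_covCoord hO hc hφ) e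
  exact integral_cross_derivative (g := fun p => I (c p)) hO (h e₁) (h e₂)
    (fun p hp => hα.hasDerivAt_line hO hc hp e₁) (fun p hp => hα.hasDerivAt_line hO hc hp e₂) hp

/-- The density of the second variation in a chart. -/
theorem cross_density_eq {α : CovectorField U} (hO : IsOpen O)
    (hc : IsSmoothFamilyOn O fun p => (c p).1) (hφ : φ ∈ atlas 𝔼 M) {q : P × ℝ}
    (hq : q ∈ chartDomain O (fun p => (c p).1) φ)
    (hα : ContDiffAt ℝ ∞ (covCoord φ α c) q) (e₁ e₂ : P) :
    fderiv ℝ (varDensity α c e₂) q (e₁, 0) - fderiv ℝ (varDensity α c e₁) q (e₂, 0) =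
      fderiv ℝ (covCoord φ α c) q (e₁, 0) (fderiv ℝ (coord φ fun p => (c p).1) q (e₂, 0)) -
      fderiv ℝ (covCoord φ α c) q (e₂, 0) (fderiv ℝ (coord φ fun p => (c p).1) q (e₁, 0)) := by
  have hD := (isOpen_chartDomain hO hc φ).mem_nhds hq
  have hu := (contDiffOn_coord hO hc hφ).contDiffAt hD
  have hdu : DifferentiableAt ℝ (fderiv ℝ (coord φ fun p => (c p).1)) q :=
    (hu.fderiv_right (m := ∞) (by simp)).differentiableAt (by simp)
  have key : ∀ e e' : P, fderiv ℝ (varDensity α c e) q (e', 0) =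
      fderiv ℝ (covCoord φ α c) q (e', 0) (fderiv ℝ (coord φ fun p => (c p).1) q (e, 0)) +
      covCoord φ α c q (fderiv ℝ (fderiv ℝ (coord φ fun p => (c p).1)) q (e', 0) (e, 0)) := by
    intro e e'
    have hev : varDensity α c e =ᶠ[nhds q] fun q => covCoord φ α c q
        (fderiv ℝ (coord φ fun p => (c p).1) q (e, 0)) := by
      filter_upwards [hD] with r hr using varDensity_eq hO hc hφ α hr e
    rw [hev.fderiv_eq, ((hα.differentiableAt (by simp)).hasFDerivAt.clm_apply
      (hdu.hasFDerivAt.clm_apply (hasFDerivAt_const _ _))).fderiv]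
    simp [add_comm]
  -- Each derivative also contains the covector applied to a mixed second derivative of the
  -- coordinates; these parts are equal and drop out of the difference.
  have hsymm : IsSymmSndFDerivAt ℝ (coord φ fun p => (c p).1) q :=
    hu.isSymmSndFDerivAt (by
      rw [minSmoothness_of_isRCLikeNormedField]
      exact WithTop.coe_le_coe.2 (le_top : (2 : ℕ∞) ≤ ⊤))
  rw [key, key, hsymm (e₁, 0) (e₂, 0)]
  ring

end VariationalDerivative

/-! ### Velocities as fields on the circle -/

section CircleVelocity

variable {N : ℕ} {M : Type*} [TopologicalSpace M] [ChartedSpace (EuclideanSpace ℝ (Fin N)) M]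

local notation "𝔼" => EuclideanSpace ℝ (Fin N)

theorem Loop.velocity_periodic (γ : Loop N M) :
    Function.Periodic (fun x : ℝ => (γ.velocity x : 𝔼)) 1 := by
  intro x
  have hcoe : ∀ y : ℝ, ((y + 1 : ℝ) : UnitAddCircle) = y := fun y => by
    simp
  have h2 : MDifferentiableAt 𝓘(ℝ, ℝ) (𝓡 N) (fun y : ℝ => γ (y : UnitAddCircle)) (x + 1) :=
    (γ.smooth (x + 1)).mdifferentiableAt (by simp)
  have h1 : HasMFDerivAt 𝓘(ℝ, ℝ) 𝓘(ℝ, ℝ) (fun y : ℝ => y + 1) x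
      (ContinuousLinearMap.id ℝ ℝ) := ((hasFDerivAt_id x).add_const 1).hasMFDerivAt
  have h3 := (HasMFDerivAt.comp x h2.hasMFDerivAt h1).mfderiv
  have e : ((fun y : ℝ => γ (y : UnitAddCircle)) ∘ fun y : ℝ => y + 1) =
      fun y : ℝ => γ (y : UnitAddCircle) := by
    ext y
    simp only [Function.comp, hcoe]
  rw [e] at h3
  exact (congrArg (fun L : ℝ →L[ℝ] 𝔼 => L 1) h3).symm

/-- The velocity of a loop as a vector field along the circle. -/
noncomputable def Loop.vel (γ : Loop N M) (y : UnitAddCircle) : TangentSpace (𝓡 N) (γ y) :=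
  (γ.velocity_periodic.lift y : 𝔼)

theorem exists_mem_Icc_coe_eq (y : UnitAddCircle) :
    ∃ x ∈ Set.Icc (0 : ℝ) 1, (x : UnitAddCircle) = y := by
  obtain ⟨x, hx, rfl⟩ := (AddCircle.coe_image_Icc_eq (1 : ℝ) 0).symm.subset (Set.mem_univ y)
  exact ⟨x, by simpa using hx, rfl⟩

/-- The operator depends only on the point of the circle, so its invertibility can be tested over a
compact interval. This is what makes regularity stable under small variations. -/
theorem mem_regularLoops_iff (π : PoissonStructure N M) (T : ClosedThreeForm N M) (γ : Loop N M) :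
    γ ∈ regularLoops π T ↔ ∀ x ∈ Set.Icc (0 : ℝ) 1,
      IsUnit (opM π T (γ (x : UnitAddCircle)) (γ.velocity x)) := by
  refine ⟨fun h x _ => h x, fun h x => ?_⟩
  have key : ∀ y : UnitAddCircle, IsUnit (opM π T (γ y) (γ.vel y)) := by
    intro y
    obtain ⟨x, hx, rfl⟩ := exists_mem_Icc_coe_eq y
    exact h x hx
  exact key x

end CircleVelocity

/-! ### Smooth dependence of the operator in a chart -/

section ChartSmooth

variable {V : Type*} [NormedAddCommGroup V] [NormedSpace ℝ V]
  {Q : Type*} [NormedAddCommGroup Q] [NormedSpace ℝ Q]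

theorem contDiffOn_opChart {σ : Q → (V →L[ℝ] ℝ) →L[ℝ] V} {S : Q → V →L[ℝ] V →L[ℝ] V →L[ℝ] ℝ}
    {v : Q → V} {s : Set Q} (hσ : ContDiffOn ℝ ∞ σ s) (hS : ContDiffOn ℝ ∞ S s)
    (hv : ContDiffOn ℝ ∞ v s) : ContDiffOn ℝ ∞ (fun q => opChart (σ q) (S q) (v q)) s := by
  have hf : ContDiffOn ℝ ∞ (fun q => (S q).flip) s :=
    (ContinuousLinearMap.flipₗᵢ ℝ V V (V →L[ℝ] ℝ)).contDiff.comp_contDiffOn hS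
  exact contDiffOn_const.add (hσ.clm_comp (hf.clm_apply hv))

end ChartSmooth

/-! ### Openness of regularity -/

section Regular

variable {N : ℕ} {M : Type*} [TopologicalSpace M] [ChartedSpace (EuclideanSpace ℝ (Fin N)) M]
  [IsManifold (𝓡 N) ∞ M]

local notation "𝔼" => EuclideanSpace ℝ (Fin N)

variable (π : PoissonStructure N M) (T : ClosedThreeForm N M)
variable {P : Type} [NormedAddCommGroup P] [NormedSpace ℝ P]
  {φ : OpenPartialHomeomorph M (EuclideanSpace ℝ (Fin N))} {O : Set P}

/-- The bivector in a chart along a family of loops. -/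
noncomputable def sharpAlong (φ : OpenPartialHomeomorph M 𝔼) (c : P → Loop N M) (q : P × ℝ) :
    (𝔼 →L[ℝ] ℝ) →L[ℝ] 𝔼 := sharpChart π φ (coord φ c q)

/-- The 3-form in a chart along a family of loops. -/
noncomputable def formAlong (φ : OpenPartialHomeomorph M 𝔼) (c : P → Loop N M) (q : P × ℝ) :
    𝔼 →L[ℝ] 𝔼 →L[ℝ] 𝔼 →L[ℝ] ℝ := formChart T φ (coord φ c q)

/-- The velocities of a family of loops in a chart. -/
noncomputable def velAlong (φ : OpenPartialHomeomorph M 𝔼) (c : P → Loop N M) (q : P × ℝ) : 𝔼 :=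
  fderiv ℝ (coord φ c) q (0, 1)

variable {c : P → Loop N M}

theorem contDiffOn_sharpAlong (hO : IsOpen O) (hc : IsSmoothFamilyOn O c) (hφ : φ ∈ atlas 𝔼 M) :
    ContDiffOn ℝ ∞ (sharpAlong π φ c) (chartDomain O c φ) :=
  (contDiffOn_sharpChart π hφ).comp (contDiffOn_coord hO hc hφ) fun _ hq => coord_mem_target hq

theorem contDiffOn_formAlong (hO : IsOpen O) (hc : IsSmoothFamilyOn O c) (hφ : φ ∈ atlas 𝔼 M) :
    ContDiffOn ℝ ∞ (formAlong T φ c) (chartDomain O c φ) :=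
  (contDiffOn_formChart T hφ).comp (contDiffOn_coord hO hc hφ) fun _ hq => coord_mem_target hq

theorem contDiffOn_opChart_along (hO : IsOpen O) (hc : IsSmoothFamilyOn O c)
    (hφ : φ ∈ atlas 𝔼 M) : ContDiffOn ℝ ∞
      (fun q => opChart (sharpAlong π φ c q) (formAlong T φ c q) (velAlong φ c q))
      (chartDomain O c φ) :=
  contDiffOn_opChart (contDiffOn_sharpAlong π hO hc hφ) (contDiffOn_formAlong T hO hc hφ)
    (contDiffOn_fderiv_coord hO hc hφ _)

theorem isUnit_opM_iff_along (hO : IsOpen O) (hc : IsSmoothFamilyOn O c) (hφ : φ ∈ atlas 𝔼 M)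
    {q : P × ℝ} (hq : q ∈ chartDomain O c φ) :
    IsUnit (opM π T (c q.1 (q.2 : UnitAddCircle)) ((c q.1).velocity q.2)) ↔
      IsUnit (opChart (sharpAlong π φ c q) (formAlong T φ c q) (velAlong φ c q)) := by
  rw [isUnit_opM_iff π T hφ hq.2, chartDiff_velocity hO hc hφ hq]
  rfl

/-- Regularity of a loop is an open condition. -/
theorem eventually_mem_regularLoops (hO : IsOpen O) (hc : IsSmoothFamilyOn O c) {p : P}
    (hp : p ∈ O) (hreg : c p ∈ regularLoops π T) : ∀ᶠ p' in nhds p, c p' ∈ regularLoops π T := by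
  have hloc : ∀ x ∈ Set.Icc (0 : ℝ) 1, ∀ᶠ q in nhds p ×ˢ nhds x,
      IsUnit (opM π T (c q.1 (q.2 : UnitAddCircle)) ((c q.1).velocity q.2)) := by
    intro x _
    rw [← nhds_prod_eq]
    set φ := chartAt 𝔼 (c p (x : UnitAddCircle))
    have hφ : φ ∈ atlas 𝔼 M := chart_mem_atlas _ _
    have hq : (p, x) ∈ chartDomain O c φ := ⟨hp, mem_chart_source _ _⟩
    have hD := (isOpen_chartDomain hO hc φ).mem_nhds hq
    have hcont := ((contDiffOn_opChart_along π T hO hc hφ).contDiffAt hD).continuousAt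
    have hu := (isUnit_opM_iff_along π T hO hc hφ hq).1 (hreg x)
    -- The units of the Banach algebra of endomorphisms form an open set.
    filter_upwards [hD, hcont.eventually (Units.isOpen.mem_nhds hu)] with r hr hr'
    exact (isUnit_opM_iff_along π T hO hc hφ hr).2 hr'
  -- Local invertibility at each `x` becomes one parameter neighbourhood for all `x`, by compactness
  -- of the interval.
  have h := isCompact_Icc.eventually_forall_of_forall_eventually
    (x₀ := p) (K := Set.Icc (0 : ℝ) 1) (P := fun p' x => IsUnit (opM π T (c p' (x : UnitAddCircle))
      ((c p').velocity x))) (fun x hx => by rw [nhds_prod_eq]; exact hloc x hx)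
  filter_upwards [h] with p' hp'
  exact (mem_regularLoops_iff π T _).2 hp'

/-- A smooth family of maps of the circle through a regular loop is a smooth family of regular
loops for the parameters close to the given one. -/
theorem exists_regular_family {C : P → UnitAddCircle → M} (hO : IsOpen O)
    (hC : ContMDiffOn 𝓘(ℝ, P × ℝ) (𝓡 N) ∞ (fun q : P × ℝ => C q.1 (q.2 : UnitAddCircle))
      (O ×ˢ Set.univ)) {p₀ : P} (hp₀ : p₀ ∈ O) (γ : regularLoops π T) (hγ : C p₀ = γ.1.toFun) :
    ∃ O' ⊆ O, IsOpen O' ∧ p₀ ∈ O' ∧ ∃ c : P → regularLoops π T,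
      IsSmoothFamilyOn O' (fun p => (c p).1) ∧ ∀ p ∈ O', (c p).1.toFun = C p := by
  classical
  have hsm : ∀ p ∈ O, ContMDiff 𝓘(ℝ, ℝ) (𝓡 N) ∞ (fun x : ℝ => C p (x : UnitAddCircle)) := by
    intro p hp
    have hm : ContMDiff 𝓘(ℝ, ℝ) 𝓘(ℝ, P × ℝ) ∞ fun x : ℝ => (p, x) :=
      contMDiff_iff_contDiff.2 (by fun_prop)
    have := ContMDiffOn.comp hC hm.contMDiffOn (s := Set.univ) fun z _ => ⟨hp, trivial⟩
    exact contMDiffOn_univ.1 this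
  -- Families are total functions of the parameter. Where the map need not be a smooth loop, and
  -- below where the loop need not be regular, the value is the irrelevant default `γ`.
  let c₁ : P → Loop N M := fun p => if h : p ∈ O then ⟨C p, hsm p h⟩ else γ.1
  have hc₁ : ∀ p ∈ O, (c₁ p).toFun = C p := fun p hp => by simp [c₁, hp]
  have hfam : IsSmoothFamilyOn O c₁ := hC.congr fun q hq => congrFun (hc₁ q.1 hq.1) _
  have h0 : c₁ p₀ = γ.1 := by
    have := (hc₁ p₀ hp₀).trans hγ
    cases h : c₁ p₀
    cases h' : γ.1
    simp_all
  have hev := eventually_mem_regularLoops π T hO hfam hp₀ (by rw [h0]; exact γ.2)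
  obtain ⟨O', hO', hO'o, hpO'⟩ := mem_nhds_iff.1 (Filter.inter_mem hev (hO.mem_nhds hp₀))
  let c : P → regularLoops π T := fun p => if h : c₁ p ∈ regularLoops π T then ⟨c₁ p, h⟩ else γ
  have hc : ∀ p ∈ O', (c p).1 = c₁ p := fun p hp => by
    have : c₁ p ∈ regularLoops π T := (hO' hp).1
    simp [c, this]
  refine ⟨O', fun p hp => (hO' hp).2, hO'o, hpO', c, ?_, fun p hp => ?_⟩
  · refine (ContMDiffOn.mono hfam (Set.prod_mono (fun p hp => (hO' hp).2) subset_rfl)).congr ?_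
    intro q hq
    change (c q.1).1.toFun _ = _
    rw [hc q.1 hq.1]
  · rw [hc p hp, hc₁ p (hO' hp).2]

end Regular

/-! ### Hamiltonian fields along loops and the density of the bracket -/

section HamiltonianFields

variable {N : ℕ} {M : Type*} [TopologicalSpace M] [ChartedSpace (EuclideanSpace ℝ (Fin N)) M]

local notation "𝔼" => EuclideanSpace ℝ (Fin N)

variable {π : PoissonStructure N M} {T : ClosedThreeForm N M}
variable {P : Type} [NormedAddCommGroup P] [NormedSpace ℝ P]
  {φ : OpenPartialHomeomorph M (EuclideanSpace ℝ (Fin N))} {O : Set P}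
  {c : P → regularLoops π T}

/-- The vector field `A^{ij} α_j` along a loop. -/
noncomputable def hamVec (α : CovectorField (regularLoops π T)) (γ : regularLoops π T)
    (y : UnitAddCircle) : TangentSpace (𝓡 N) (γ.1 y) :=
  opA π T (γ.1 y) (γ.1.vel y) (α γ y)

/-- The vector field `A^{ij} α_j` in a chart along a family of loops. -/
noncomputable def hamCoord (φ : OpenPartialHomeomorph M 𝔼) (α : CovectorField (regularLoops π T))
    (c : P → regularLoops π T) (q : P × ℝ) : 𝔼 :=
  chartDiff φ ((c q.1).1 (q.2 : UnitAddCircle)) (hamVec α (c q.1) q.2)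

/-- The density of the bracket along a family of loops. -/
noncomputable def bracketDensity (α β : CovectorField (regularLoops π T))
    (c : P → regularLoops π T) (q : P × ℝ) : ℝ :=
  α (c q.1) (q.2 : UnitAddCircle) (hamVec β (c q.1) q.2)

variable [IsManifold (𝓡 N) ∞ M]

theorem opChart_hamCoord (hO : IsOpen O) (hc : IsSmoothFamilyOn O fun p => (c p).1)
    (hφ : φ ∈ atlas 𝔼 M) (α : CovectorField (regularLoops π T)) {q : P × ℝ}
    (hq : q ∈ chartDomain O (fun p => (c p).1) φ) :
    opChart (sharpAlong π φ (fun p => (c p).1) q) (formAlong T φ (fun p => (c p).1) q)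
      (velAlong φ (fun p => (c p).1) q) (hamCoord φ α c q) =
      sharpAlong π φ (fun p => (c p).1) q (covCoord φ α c q) := by
  have h := opA_chart_eq π T hφ hq.2 ((c q.1).2 q.2) (α (c q.1) q.2)
  rw [chartDiff_velocity (c := fun p => (c p).1) hO hc hφ hq] at h
  exact h

/-- This implicit equation replaces the inverse matrix in the computations of variations; the
inverse itself serves only to show that the field is smooth. -/
theorem hamCoord_eq (hO : IsOpen O) (hc : IsSmoothFamilyOn O fun p => (c p).1)
    (hφ : φ ∈ atlas 𝔼 M) (α : CovectorField (regularLoops π T)) {q : P × ℝ}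
    (hq : q ∈ chartDomain O (fun p => (c p).1) φ) :
    hamCoord φ α c q = sharpAlong π φ (fun p => (c p).1) q (covCoord φ α c q -
      formAlong T φ (fun p => (c p).1) q (hamCoord φ α c q) (velAlong φ (fun p => (c p).1) q)) := by
  have h := opChart_hamCoord hO hc hφ α hq
  rw [opChart_apply] at h
  rw [map_sub, ← h, add_sub_cancel_right]

/-- The field is the inverse operator applied to a smooth vector, and inversion in a Banach algebra
is smooth at units. -/
theorem contDiffOn_hamCoord (hO : IsOpen O) (hc : IsSmoothFamilyOn O fun p => (c p).1)
    (hφ : φ ∈ atlas 𝔼 M) {α : CovectorField (regularLoops π T)}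
    (hα : ContDiffOn ℝ ∞ (covCoord φ α c) (chartDomain O (fun p => (c p).1) φ)) :
    ContDiffOn ℝ ∞ (hamCoord φ α c) (chartDomain O (fun p => (c p).1) φ) := by
  have hu : ∀ q ∈ chartDomain O (fun p => (c p).1) φ,
      IsUnit (opChart (sharpAlong π φ (fun p => (c p).1) q) (formAlong T φ (fun p => (c p).1) q)
        (velAlong φ (fun p => (c p).1) q)) := fun q hq =>
    (isUnit_opM_iff_along π T hO hc hφ hq).1 ((c q.1).2 q.2)
  have hinv : ContDiffOn ℝ ∞ (fun q => Ring.inverse (opChart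
      (sharpAlong π φ (fun p => (c p).1) q) (formAlong T φ (fun p => (c p).1) q)
        (velAlong φ (fun p => (c p).1) q))) (chartDomain O (fun p => (c p).1) φ) := by
    intro q hq
    obtain ⟨w, hw⟩ := hu q hq
    have h1 := contDiffAt_ringInverse ℝ (n := ∞) w
    rw [hw] at h1
    exact h1.comp_contDiffWithinAt q (contDiffOn_opChart_along π T hO hc hφ q hq)
  refine (hinv.clm_apply ((contDiffOn_sharpAlong π hO hc hφ).clm_apply hα)).congr fun q hq => ?_
  rw [← opChart_hamCoord hO hc hφ α hq]
  have h := Ring.inverse_mul_cancel _ (hu q hq)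
  exact (congrArg (fun L : 𝔼 →L[ℝ] 𝔼 => L (hamCoord φ α c q)) h).symm

theorem bracketDensity_eq (hφ : φ ∈ atlas 𝔼 M) (α β : CovectorField (regularLoops π T))
    {q : P × ℝ} (hq : q ∈ chartDomain O (fun p => (c p).1) φ) :
    bracketDensity α β c q = covCoord φ α c q (hamCoord φ β c q) :=
  covCoord_apply_chartDiff hφ α hq _

theorem contDiffOn_bracketDensity (hO : IsOpen O) (hc : IsSmoothFamilyOn O fun p => (c p).1)
    {α β : CovectorField (regularLoops π T)}
    (hα : ∀ φ ∈ atlas 𝔼 M, ContDiffOn ℝ ∞ (covCoord φ α c) (chartDomain O (fun p => (c p).1) φ))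
    (hβ : ∀ φ ∈ atlas 𝔼 M, ContDiffOn ℝ ∞ (covCoord φ β c) (chartDomain O (fun p => (c p).1) φ)) :
    ContDiffOn ℝ ∞ (bracketDensity α β c) (O ×ˢ Set.univ) := by
  refine contDiffOn_of_chartDomain hO hc fun φ hφ => ?_
  exact ((hα φ hφ).clm_apply (contDiffOn_hamCoord hO hc hφ (hβ φ hφ))).congr
    fun q hq => bracketDensity_eq hφ α β hq

theorem bracketDensity_skew (hO : IsOpen O) (hc : IsSmoothFamilyOn O fun p => (c p).1)
    (α β : CovectorField (regularLoops π T)) {q : P × ℝ} (hq : q.1 ∈ O) :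
    bracketDensity α β c q = -bracketDensity β α c q := by
  set φ := chartAt 𝔼 ((c q.1).1 (q.2 : UnitAddCircle))
  have hφ : φ ∈ atlas 𝔼 M := chart_mem_atlas _ _
  have hq : q ∈ chartDomain O (fun p => (c p).1) φ := ⟨hq, mem_chart_source _ _⟩
  rw [bracketDensity_eq hφ α β hq, bracketDensity_eq hφ β α hq]
  exact pairing_skew (sharpChart_skew π φ _) (isAlt_formChart T φ _)
    (hamCoord_eq hO hc hφ α hq) (hamCoord_eq hO hc hφ β hq)

/-- The variation of the density of the bracket in a chart. -/
theorem fderiv_bracketDensity (hO : IsOpen O) (hc : IsSmoothFamilyOn O fun p => (c p).1)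
    (hφ : φ ∈ atlas 𝔼 M) {α β : CovectorField (regularLoops π T)}
    (hα : ContDiffOn ℝ ∞ (covCoord φ α c) (chartDomain O (fun p => (c p).1) φ))
    (hβ : ContDiffOn ℝ ∞ (covCoord φ β c) (chartDomain O (fun p => (c p).1) φ))
    {q : P × ℝ} (hq : q ∈ chartDomain O (fun p => (c p).1) φ) (e : P) :
    fderiv ℝ (bracketDensity α β c) q (e, 0) =
      fderiv ℝ (covCoord φ α c) q (e, 0) (hamCoord φ β c q)
      - fderiv ℝ (covCoord φ β c) q (e, 0) (hamCoord φ α c q)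
      + (covCoord φ α c q - formAlong T φ (fun p => (c p).1) q (hamCoord φ α c q)
          (velAlong φ (fun p => (c p).1) q))
        (fderiv ℝ (sharpChart π φ) (coord φ (fun p => (c p).1) q)
          (fderiv ℝ (coord φ fun p => (c p).1) q (e, 0))
          (covCoord φ β c q - formAlong T φ (fun p => (c p).1) q (hamCoord φ β c q)
            (velAlong φ (fun p => (c p).1) q)))
      + fderiv ℝ (formChart T φ) (coord φ (fun p => (c p).1) q)
          (fderiv ℝ (coord φ fun p => (c p).1) q (e, 0)) (hamCoord φ β c q)
          (velAlong φ (fun p => (c p).1) q) (hamCoord φ α c q)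
      + formAlong T φ (fun p => (c p).1) q (hamCoord φ β c q)
          (fderiv ℝ (fun q => fderiv ℝ (coord φ fun p => (c p).1) q (e, 0)) q (0, 1))
          (hamCoord φ α c q) := by
  have hD := (isOpen_chartDomain hO hc φ).mem_nhds hq
  have hu := (contDiffOn_coord hO hc hφ).contDiffAt hD
  have hdu : DifferentiableAt ℝ (fderiv ℝ (coord φ fun p => (c p).1)) q :=
    (hu.fderiv_right (m := ∞) (by simp)).differentiableAt (by simp)
  have hsymm : IsSymmSndFDerivAt ℝ (coord φ fun p => (c p).1) q :=
    hu.isSymmSndFDerivAt (by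
      rw [minSmoothness_of_isRCLikeNormedField]
      exact WithTop.coe_le_coe.2 (le_top : (2 : ℕ∞) ≤ ⊤))
  have hd : ∀ {G : Type} [NormedAddCommGroup G] [NormedSpace ℝ G] {f : P × ℝ → G},
      ContDiffOn ℝ ∞ f (chartDomain O (fun p => (c p).1) φ) → DifferentiableAt ℝ f q :=
    fun h => (h.contDiffAt hD).differentiableAt (by simp)
  have hut := coord_mem_target hq
  have hσ : HasFDerivAt (sharpAlong π φ fun p => (c p).1)
      (fderiv ℝ (sharpChart π φ) (coord φ (fun p => (c p).1) q) ∘L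
        fderiv ℝ (coord φ fun p => (c p).1) q) q :=
    (((contDiffOn_sharpChart π hφ).contDiffAt (φ.open_target.mem_nhds hut)).differentiableAt
      (by simp)).hasFDerivAt.comp q (hu.differentiableAt (by simp)).hasFDerivAt
  have hS : HasFDerivAt (formAlong T φ fun p => (c p).1)
      (fderiv ℝ (formChart T φ) (coord φ (fun p => (c p).1) q) ∘L
        fderiv ℝ (coord φ fun p => (c p).1) q) q :=
    (((contDiffOn_formChart T hφ).contDiffAt (φ.open_target.mem_nhds hut)).differentiableAt
      (by simp)).hasFDerivAt.comp q (hu.differentiableAt (by simp)).hasFDerivAt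
  have hv : ∀ ξ ζ : P × ℝ, fderiv ℝ (fun q => fderiv ℝ (coord φ fun p => (c p).1) q ξ) q ζ =
      fderiv ℝ (fderiv ℝ (coord φ fun p => (c p).1)) q ζ ξ := by
    intro ξ ζ
    rw [(hdu.hasFDerivAt.clm_apply (hasFDerivAt_const ξ q)).fderiv]
    simp
  have hev : bracketDensity α β c =ᶠ[nhds q] fun q => covCoord φ α c q (hamCoord φ β c q) := by
    filter_upwards [hD] with r hr using bracketDensity_eq hφ α β hr
  have hY : ∀ᶠ r in nhds q, hamCoord φ β c r = sharpAlong π φ (fun p => (c p).1) r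
      (covCoord φ β c r - formAlong T φ (fun p => (c p).1) r (hamCoord φ β c r)
        (velAlong φ (fun p => (c p).1) r)) := by
    filter_upwards [hD] with r hr using hamCoord_eq hO hc hφ β hr
  -- The derivative of the velocity in the direction `e` becomes the derivative along the loop of
  -- the variation, by symmetry of the second derivative of the coordinates.
  rw [hev.fderiv_eq, fderiv_pairing (hd hα) (hd hβ) hσ.differentiableAt hS.differentiableAt
    (hd (contDiffOn_fderiv_coord hO hc hφ (0, 1))) (hd (contDiffOn_hamCoord hO hc hφ hβ))
    (sharpChart_skew π φ _) (isAlt_formChart T φ _) (hamCoord_eq hO hc hφ α hq) hY,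
    hσ.fderiv, hS.fderiv, hv, hv, hsymm (0, 1) (e, 0)]
  rfl

end HamiltonianFields

/-! ### Finite-dimensional families of maps that realize all tangent vectors -/

section LocalAddition

/-- A smooth family of maps of a manifold to itself, with parameters in a vector space `F` and the
identity at the parameter `0`. At the points of positive weight each tangent vector is realized as
the velocity of a variation of the parameter, in a smooth way. -/
structure LocalAddition (N : ℕ) (M : Type*) [TopologicalSpace M]
    [ChartedSpace (EuclideanSpace ℝ (Fin N)) M] (F : Type*) [NormedAddCommGroup F]
    [NormedSpace ℝ F] where
  /-- the family of maps -/
  toFun : M × F → M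
  smooth : ContMDiff ((𝓡 N).prod 𝓘(ℝ, F)) (𝓡 N) ∞ toFun
  zero : ∀ p, toFun (p, 0) = p
  /-- the parameter that realizes a multiple of a given tangent vector -/
  lift : ∀ p : M, TangentSpace (𝓡 N) p →L[ℝ] F
  lift_smooth : ∀ φ ∈ atlas (EuclideanSpace ℝ (Fin N)) M,
    ContDiffOn ℝ ∞ (fun u => lift (φ.symm u) ∘L chartFrame φ (φ.symm u)) φ.target
  /-- the factor of the multiple -/
  weight : M → ℝ
  weight_smooth : ContMDiff (𝓡 N) 𝓘(ℝ, ℝ) ∞ weight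
  weight_nonneg : ∀ p, 0 ≤ weight p
  hasDerivAt : ∀ φ ∈ atlas (EuclideanSpace ℝ (Fin N)) M, ∀ p ∈ φ.source,
    ∀ v : TangentSpace (𝓡 N) p,
      HasDerivAt (fun s : ℝ => φ (toFun (p, s • lift p v))) (weight p • chartDiff φ p v) 0

variable {N : ℕ} {M : Type*} [TopologicalSpace M] [ChartedSpace (EuclideanSpace ℝ (Fin N)) M]

local notation "𝔼" => EuclideanSpace ℝ (Fin N)

/-- The family that does not move anything. -/
noncomputable def LocalAddition.trivial [IsManifold (𝓡 N) ∞ M] : LocalAddition N M PUnit.{1} where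
  toFun := Prod.fst
  smooth := contMDiff_fst
  zero _ := rfl
  lift _ := 0
  lift_smooth φ _ := by
    simp only [ContinuousLinearMap.zero_comp]
    exact contDiffOn_const
  weight _ := 0
  weight_smooth := contMDiff_const
  weight_nonneg _ := le_rfl
  hasDerivAt φ _ p _ v := by
    simp only [zero_smul]
    exact hasDerivAt_const _ _

variable [IsManifold (𝓡 N) ∞ M]

theorem contMDiffAt_atlas {φ : OpenPartialHomeomorph M 𝔼} (hφ : φ ∈ atlas 𝔼 M) {p : M}
    (hp : p ∈ φ.source) : ContMDiffAt (𝓡 N) 𝓘(ℝ, 𝔼) ∞ φ p :=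
  contMDiffAt_of_mem_maximalAtlas (IsManifold.subset_maximalAtlas hφ) hp

theorem contMDiffAt_atlas_symm {φ : OpenPartialHomeomorph M 𝔼} (hφ : φ ∈ atlas 𝔼 M) {u : 𝔼}
    (hu : u ∈ φ.target) : ContMDiffAt 𝓘(ℝ, 𝔼) (𝓡 N) ∞ φ.symm u :=
  contMDiffAt_symm_of_mem_maximalAtlas (IsManifold.subset_maximalAtlas hφ) hu

theorem contDiffAt_transition {φ ψ : OpenPartialHomeomorph M 𝔼} (hφ : φ ∈ atlas 𝔼 M)
    (hψ : ψ ∈ atlas 𝔼 M) {u : 𝔼} (hu : u ∈ φ.target) (hu' : φ.symm u ∈ ψ.source) :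
    ContDiffAt ℝ ∞ (fun u => ψ (φ.symm u)) u :=
  contMDiffAt_iff_contDiffAt.1
    (ContMDiffAt.comp u (contMDiffAt_atlas hψ hu') (contMDiffAt_atlas_symm hφ hu))

/-- The change of coordinates. -/
theorem chartDiff_eq_fderiv_transition {φ ψ : OpenPartialHomeomorph M 𝔼} (hφ : φ ∈ atlas 𝔼 M)
    (hψ : ψ ∈ atlas 𝔼 M) {p : M} (hp : p ∈ φ.source) (hp' : p ∈ ψ.source)
    (v : TangentSpace (𝓡 N) p) :
    chartDiff ψ p v = fderiv ℝ (fun u => ψ (φ.symm u)) (φ p) (chartDiff φ p v) := by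
  have : IsManifold (𝓡 N) 1 M := IsManifold.of_le (n := ∞) (by simp)
  have h1 := ((mdifferentiable_of_mem_atlas (I := 𝓡 N) hφ).mdifferentiableAt hp).hasMFDerivAt
  have h2 : HasMFDerivAt 𝓘(ℝ, 𝔼) 𝓘(ℝ, 𝔼) (fun u => ψ (φ.symm u)) (φ p)
      (fderiv ℝ (fun u => ψ (φ.symm u)) (φ p)) :=
    ((contDiffAt_transition hφ hψ (φ.map_source hp) (by rwa [φ.left_inv hp])).differentiableAt
      (by simp)).hasFDerivAt.hasMFDerivAt
  have h3 := HasMFDerivAt.comp p h2 h1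
  have hev : (ψ : M → 𝔼) =ᶠ[nhds p] (fun u => ψ (φ.symm u)) ∘ φ := by
    filter_upwards [φ.open_source.mem_nhds hp] with p' hp'
    simp [φ.left_inv hp']
  have h4 := (h3.congr_of_eventuallyEq hev).mfderiv
  exact congrArg (fun L : 𝔼 →L[ℝ] 𝔼 => L v) h4

/-- The composition of two families of maps. -/
noncomputable def LocalAddition.comp {F₁ F₂ : Type*} [NormedAddCommGroup F₁] [NormedSpace ℝ F₁]
    [NormedAddCommGroup F₂] [NormedSpace ℝ F₂] (A₁ : LocalAddition N M F₁)
    (A₂ : LocalAddition N M F₂) : LocalAddition N M (F₁ × F₂) where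
  toFun z := A₁.toFun (A₂.toFun (z.1, z.2.2), z.2.1)
  smooth := by
    have h1 : ContMDiff ((𝓡 N).prod 𝓘(ℝ, F₁ × F₂)) 𝓘(ℝ, F₂) ∞
        fun z : M × (F₁ × F₂) => z.2.2 :=
      (contMDiff_iff_contDiff.2 contDiff_snd).comp contMDiff_snd
    have h2 : ContMDiff ((𝓡 N).prod 𝓘(ℝ, F₁ × F₂)) 𝓘(ℝ, F₁) ∞
        fun z : M × (F₁ × F₂) => z.2.1 :=
      (contMDiff_iff_contDiff.2 contDiff_fst).comp contMDiff_snd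
    exact A₁.smooth.comp ((A₂.smooth.comp (contMDiff_fst.prodMk h1)).prodMk h2)
  zero p := by simp [A₁.zero, A₂.zero]
  lift p := (A₁.lift p).prod (A₂.lift p)
  lift_smooth φ hφ := contDiffOn_clm_apply.2 fun v =>
    ((A₁.lift_smooth φ hφ).clm_apply contDiffOn_const).prodMk
      ((A₂.lift_smooth φ hφ).clm_apply contDiffOn_const)
  weight p := A₁.weight p + A₂.weight p
  weight_smooth := A₁.weight_smooth.add A₂.weight_smooth
  weight_nonneg p := add_nonneg (A₁.weight_nonneg p) (A₂.weight_nonneg p)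
  hasDerivAt φ hφ p hp v := by
    -- The derivative of the outer map at parameter `0` is the identity in the point (`hD1`) and the
    -- weight of `A₁` in the lifted parameter (`hD2`). By linearity the velocities of the two
    -- motions add, and so do the weights.
    let Ψ : 𝔼 × F₁ → 𝔼 := fun z => φ (A₁.toFun (φ.symm z.1, z.2))
    have hu := φ.map_source hp
    have hΨ : ContDiffAt ℝ ∞ Ψ (φ p, 0) := by
      have h1 : ContMDiffAt 𝓘(ℝ, 𝔼 × F₁) (𝓡 N) ∞ (fun z : 𝔼 × F₁ => φ.symm z.1) (φ p, 0) :=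
        ContMDiffAt.comp (φ p, (0 : F₁)) (contMDiffAt_atlas_symm hφ hu)
          (contMDiff_iff_contDiff.2 contDiff_fst).contMDiffAt
      have h2 : ContMDiffAt 𝓘(ℝ, 𝔼 × F₁) 𝓘(ℝ, F₁) ∞ (fun z : 𝔼 × F₁ => z.2) (φ p, 0) :=
        (contMDiff_iff_contDiff.2 contDiff_snd).contMDiffAt
      have h3 := ContMDiffAt.comp (φ p, (0 : F₁)) (A₁.smooth _) (h1.prodMk h2)
      have hs : A₁.toFun (φ.symm (φ p), 0) ∈ φ.source := by
        rw [A₁.zero, φ.left_inv hp]; exact hp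
      exact contMDiffAt_iff_contDiffAt.1 (ContMDiffAt.comp (φ p, (0 : F₁))
        (contMDiffAt_atlas hφ hs) h3)
    obtain ⟨D, hD⟩ : ∃ D, HasFDerivAt Ψ D (φ p, 0) :=
      ⟨_, (hΨ.differentiableAt (by simp)).hasFDerivAt⟩
    have hD1 : ∀ ξ, D (ξ, 0) = ξ := by
      intro ξ
      have h1 := HasFDerivAt.comp (f := fun u => (u, (0 : F₁))) (φ p) hD
        (hasFDerivAt_prodMk_left (𝕜 := ℝ) (φ p) (0 : F₁))
      have h2 : HasFDerivAt (Ψ ∘ fun u => (u, 0)) (ContinuousLinearMap.id ℝ 𝔼) (φ p) := by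
        refine (hasFDerivAt_id (φ p)).congr_of_eventuallyEq ?_
        filter_upwards [φ.open_target.mem_nhds hu] with u hu
        simp [Ψ, A₁.zero, φ.right_inv hu]
      exact congrArg (fun L : 𝔼 →L[ℝ] 𝔼 => L ξ) (h1.unique h2)
    have hl1 : HasDerivAt (fun s : ℝ => s • A₁.lift p v) (A₁.lift p v) 0 := by
      simpa using (hasDerivAt_id (0 : ℝ)).smul_const (A₁.lift p v)
    have hD2 : D (0, A₁.lift p v) = A₁.weight p • chartDiff φ p v := by
      have h0 : HasDerivAt (fun s : ℝ => (φ p, s • A₁.lift p v)) (0, A₁.lift p v) 0 :=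
        (hasDerivAt_const _ _).prodMk hl1
      have h1 := HasFDerivAt.comp_hasDerivAt_of_eq (0 : ℝ) hD h0 (by simp)
      have h2 := A₁.hasDerivAt φ hφ p hp v
      refine h1.unique ?_
      simpa [Ψ, Function.comp_def, φ.left_inv hp] using h2
    have h2 := (A₂.hasDerivAt φ hφ p hp v).prodMk hl1
    have h3 := HasFDerivAt.comp_hasDerivAt_of_eq (0 : ℝ) hD h2 (by simp [A₂.zero])
    have hval : D (A₂.weight p • chartDiff φ p v, A₁.lift p v) =
        (A₁.weight p + A₂.weight p) • chartDiff φ p v := by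
      have : (A₂.weight p • chartDiff φ p v, A₁.lift p v) =
          (A₂.weight p • chartDiff φ p v, (0 : F₁)) + (0, A₁.lift p v) := by simp
      rw [this, map_add, hD1, hD2, add_smul, add_comm]
    rw [hval] at h3
    refine h3.congr_of_eventuallyEq ?_
    have hc : Continuous fun s : ℝ => A₂.toFun (p, s • A₂.lift p v) :=
      A₂.smooth.continuous.comp (by fun_prop)
    have hs : ∀ᶠ s in nhds (0 : ℝ), A₂.toFun (p, s • A₂.lift p v) ∈ φ.source :=
      hc.continuousAt.eventually (φ.open_source.mem_nhds (by simpa [A₂.zero] using hp))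
    filter_upwards [hs] with s hs
    simp [Ψ, φ.left_inv hs]

variable [T2Space M]

/-- The family of maps that translates in a chart, cut off by a bump function. -/
theorem exists_localAddition_near (p₀ : M) : ∃ A : LocalAddition N M 𝔼,
    ∀ᶠ p in nhds p₀, 0 < A.weight p := by
  set ψ := chartAt 𝔼 p₀ with hψdef
  have hψ : ψ ∈ atlas 𝔼 M := chart_mem_atlas _ _
  have hp₀ : p₀ ∈ ψ.source := mem_chart_source _ _
  obtain ⟨r, hr, hball⟩ := Metric.nhds_basis_closedBall.mem_iff.1
    (ψ.open_target.mem_nhds (ψ.map_source hp₀))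
  let f : SmoothBumpFunction (𝓡 N) p₀ :=
    { rIn := r / 4, rOut := r / 2, rIn_pos := by positivity, rIn_lt_rOut := by linarith
      closedBall_subset := by
        intro z hz
        have : z ∈ ψ.target := hball (Metric.closedBall_subset_closedBall (by linarith) hz.1)
        simpa [hψdef] using this }
  -- `g w • w` is bounded by `r / 2`, and where `f` is nonzero the point is within `r / 2` of the
  -- centre. Hence the translated point stays in the ball of radius `r` inside the chart, for every
  -- parameter.
  let g : ContDiffBump (0 : 𝔼) := ⟨r / 4, r / 2, by positivity, by linarith⟩
  have hg : ∀ w : 𝔼, ‖g w • w‖ ≤ r / 2 := by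
    intro w
    by_cases hw : w ∈ Metric.ball (0 : 𝔼) g.rOut
    · rw [norm_smul, Real.norm_of_nonneg g.nonneg]
      have h1 : ‖w‖ < r / 2 := by simpa using hw
      nlinarith [g.le_one (x := w), g.nonneg (x := w), norm_nonneg w]
    · have : g w = 0 := g.zero_of_le_dist (by simpa using hw)
      rw [this, zero_smul, norm_zero]
      positivity
  have hfz : ∀ p ∈ ψ.source, f p ≠ 0 → ψ p ∈ Metric.ball (ψ p₀) (r / 2) := by
    intro p hp hfp
    have : p ∈ Function.support f := hfp
    rw [f.support_eq_inter_preimage] at this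
    simpa [hψdef] using this.2
  have htar : ∀ p ∈ ψ.source, ∀ w : 𝔼, ψ p + f p • g w • w ∈ ψ.target := by
    intro p hp w
    by_cases hfp : f p = 0
    · simpa [hfp] using ψ.map_source hp
    · refine hball ?_
      have h1 := hfz p hp hfp
      rw [Metric.mem_ball, dist_eq_norm] at h1
      rw [Metric.mem_closedBall, dist_eq_norm, add_sub_right_comm]
      have h2 : ‖f p • g w • w‖ ≤ r / 2 := by
        rw [norm_smul, Real.norm_of_nonneg f.nonneg]
        nlinarith [f.le_one (x := p), f.nonneg (x := p), hg w, norm_nonneg (g w • w)]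
      linarith [norm_add_le (ψ p - ψ p₀) (f p • g w • w)]
  -- The closed support of the bump function lies in the chart domain, so extending by the identity
  -- and by zero outside the chart preserves smoothness.
  have hout : ∀ p ∉ ψ.source, f =ᶠ[nhds p] 0 := by
    intro p hp
    have : p ∉ tsupport f := fun h => hp (f.tsupport_subset_chartAt_source h)
    exact notMem_tsupport_iff_eventuallyEq.1 this
  classical
  let Φ : M × 𝔼 → M := fun z =>
    if z.1 ∈ ψ.source then ψ.symm (ψ z.1 + f z.1 • g z.2 • z.2) else z.1
  have hΦf : ∀ p w, f p = 0 → Φ (p, w) = p := by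
    intro p w h
    by_cases hp : p ∈ ψ.source
    · simp [Φ, hp, h]
    · simp [Φ, hp]
  refine ⟨
    { toFun := Φ
      smooth := ?_
      zero := ?_
      lift := fun p => f p • chartDiff ψ p
      lift_smooth := ?_
      -- One factor `f` comes from the map `Φ`, the other from the lift, where it is needed to
      -- extend the chart differential smoothly by zero.
      weight := fun p => f p * f p
      weight_smooth := f.contMDiff.mul f.contMDiff
      weight_nonneg := fun p => mul_self_nonneg _
      hasDerivAt := ?_ }, ?_⟩
  · rintro ⟨p, w⟩
    by_cases hp : p ∈ ψ.source
    · have hev : Φ =ᶠ[nhds (p, w)] fun z => ψ.symm (ψ z.1 + f z.1 • g z.2 • z.2) := by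
        have : ∀ᶠ z in nhds (p, w), z.1 ∈ ψ.source :=
          continuous_fst.continuousAt.eventually (ψ.open_source.mem_nhds hp)
        filter_upwards [this] with z hz
        simp [Φ, hz]
      refine ContMDiffAt.congr_of_eventuallyEq ?_ hev
      have h1 : ContMDiffAt ((𝓡 N).prod 𝓘(ℝ, 𝔼)) 𝓘(ℝ, 𝔼) ∞ (fun z : M × 𝔼 => ψ z.1) (p, w) :=
        ContMDiffAt.comp (p, w) (contMDiffAt_atlas hψ hp) contMDiffAt_fst
      have h2 : ContMDiffAt ((𝓡 N).prod 𝓘(ℝ, 𝔼)) 𝓘(ℝ, ℝ) ∞ (fun z : M × 𝔼 => f z.1) (p, w) :=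
        ContMDiffAt.comp (p, w) f.contMDiffAt contMDiffAt_fst
      have h3 : ContMDiffAt ((𝓡 N).prod 𝓘(ℝ, 𝔼)) 𝓘(ℝ, 𝔼) ∞
          (fun z : M × 𝔼 => g z.2 • z.2) (p, w) := by
        have : ContDiff ℝ ∞ fun w : 𝔼 => g w • w := g.contDiff.smul contDiff_id
        exact ContMDiffAt.comp (I' := 𝓘(ℝ, 𝔼)) (g := fun w : 𝔼 => g w • w) (p, w)
          (contMDiff_iff_contDiff.2 this).contMDiffAt contMDiffAt_snd
      exact ContMDiffAt.comp (p, w) (contMDiffAt_atlas_symm hψ (htar p hp w)) (h1.add (h2.smul h3))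
    · have hev : Φ =ᶠ[nhds (p, w)] Prod.fst := by
        have : ∀ᶠ z in nhds (p, w), f z.1 = 0 :=
          (continuous_fst.continuousAt (x := (p, w))).eventually (hout p hp)
        filter_upwards [this] with z hz using hΦf z.1 z.2 hz
      exact contMDiffAt_fst.congr_of_eventuallyEq hev
  · intro p
    by_cases hp : p ∈ ψ.source
    · simp [Φ, hp]
    · simp [Φ, hp]
  · intro φ hφ u hu
    refine ContDiffAt.contDiffWithinAt ?_
    have hcont : ContinuousAt φ.symm u := φ.continuousAt_symm hu
    have hf : ContDiffAt ℝ ∞ (fun u => f (φ.symm u)) u :=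
      contMDiffAt_iff_contDiffAt.1 (ContMDiffAt.comp u f.contMDiffAt (contMDiffAt_atlas_symm hφ hu))
    by_cases hp : φ.symm u ∈ ψ.source
    · have hev : (fun u => (f (φ.symm u) • chartDiff ψ (φ.symm u)) ∘L chartFrame φ (φ.symm u))
          =ᶠ[nhds u] fun u => f (φ.symm u) • fderiv ℝ (fun u => ψ (φ.symm u)) u := by
        filter_upwards [φ.open_target.mem_nhds hu,
          hcont.eventually (ψ.open_source.mem_nhds hp)] with u' hu' hs'
        ext1 v
        change f (φ.symm u') • chartDiff ψ (φ.symm u') (chartFrame φ (φ.symm u') v) =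
          f (φ.symm u') • fderiv ℝ (fun u => ψ (φ.symm u)) u' v
        rw [chartDiff_eq_fderiv_transition hφ hψ (φ.map_target hu') hs',
          chartDiff_chartFrame hφ (φ.map_target hu'), φ.right_inv hu']
      refine ContDiffAt.congr_of_eventuallyEq ?_ hev
      exact hf.smul ((contDiffAt_transition hφ hψ hu hp).fderiv_right (m := ∞) (by simp))
    · have hev : (fun u => (f (φ.symm u) • chartDiff ψ (φ.symm u)) ∘L chartFrame φ (φ.symm u))
          =ᶠ[nhds u] fun _ => (0 : 𝔼 →L[ℝ] 𝔼) := by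
        filter_upwards [hcont.eventually (hout _ hp)] with u' hu'
        have hz : f (φ.symm u') = 0 := hu'
        ext1 v
        change f (φ.symm u') • chartDiff ψ (φ.symm u') (chartFrame φ (φ.symm u') v) = 0
        rw [hz, zero_smul]
      exact contDiffAt_const.congr_of_eventuallyEq hev
  · intro φ hφ p hp v
    by_cases hfp : f p = 0
    · have : (fun s : ℝ => φ (Φ (p, s • (f p • chartDiff ψ p) v))) = fun _ => φ p := by
        ext1 s
        rw [hΦf p _ hfp]
      rw [this, hfp]
      simpa using hasDerivAt_const (0 : ℝ) (φ p)
    · have hps : p ∈ ψ.source := by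
        by_contra h
        exact hfp (hout p h).self_of_nhds
      have hu := ψ.map_source hps
      have h1 := (contDiffAt_transition hψ hφ hu (by rwa [ψ.left_inv hps])).differentiableAt
        (by simp) |>.hasFDerivAt
      have hl : HasDerivAt (fun s : ℝ => ψ p + s • (f p * f p) • chartDiff ψ p v)
          ((f p * f p) • chartDiff ψ p v) 0 := by
        simpa using ((hasDerivAt_id (0 : ℝ)).smul_const ((f p * f p) • chartDiff ψ p v)).const_add
          (ψ p)
      have h2 := HasFDerivAt.comp_hasDerivAt_of_eq (0 : ℝ) h1 hl (by simp)
      rw [map_smul, ← chartDiff_eq_fderiv_transition hψ hφ hps hp] at h2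
      refine h2.congr_of_eventuallyEq ?_
      -- The cut-off `g` is `1` near `0`, so it has no effect on the velocity at parameter `0`.
      have hg1 : ∀ᶠ s in nhds (0 : ℝ), g (s • (f p • chartDiff ψ p v)) = 1 := by
        have hc : Filter.Tendsto (fun s : ℝ => s • (f p • chartDiff ψ p v : 𝔼)) (nhds 0)
            (nhds 0) := by
          have hc' : Continuous fun s : ℝ => s • (f p • chartDiff ψ p v : 𝔼) := by fun_prop
          simpa using hc'.tendsto 0
        exact hc.eventually g.eventuallyEq_one
      filter_upwards [hg1] with s hs
      change φ (Φ (p, s • (f p • chartDiff ψ p v))) = _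
      have e : ∀ d : 𝔼, f p • s • f p • d = s • (f p * f p) • d := fun d => by module
      simp only [Φ, hps, if_true, hs, one_smul, Function.comp, e]
  · have : ∀ᶠ p in nhds p₀, f p = 1 := f.eventuallyEq_one
    filter_upwards [this] with p hp
    simp [hp]

/-- On a compact set there is a local addition that realizes all tangent vectors. -/
theorem exists_localAddition {K : Set M} (hK : IsCompact K) :
    ∃ (F : Type) (_ : NormedAddCommGroup F) (_ : NormedSpace ℝ F) (_ : FiniteDimensional ℝ F)
      (A : LocalAddition N M F), ∀ p ∈ K, 0 < A.weight p := by
  refine hK.induction_on ?_ ?_ ?_ ?_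
  · exact ⟨PUnit, inferInstance, inferInstance, inferInstance, LocalAddition.trivial, by simp⟩
  · rintro s t hst ⟨F, i1, i2, i3, A, hA⟩
    exact ⟨F, i1, i2, i3, A, fun p hp => hA p (hst hp)⟩
  -- Weights are nonnegative and add under composition, so the composition has positive weight
  -- wherever one of the factors has.
  · rintro s t ⟨F, i1, i2, i3, A, hA⟩ ⟨F', i1', i2', i3', A', hA'⟩
    refine ⟨F × F', inferInstance, inferInstance, inferInstance, A.comp A', ?_⟩
    rintro p (hp | hp)
    · exact add_pos_of_pos_of_nonneg (hA p hp) (A'.weight_nonneg p)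
    · exact add_pos_of_nonneg_of_pos (A.weight_nonneg p) (hA' p hp)
  · intro p _
    obtain ⟨A, hA⟩ := exists_localAddition_near (N := N) p
    exact ⟨_, mem_nhdsWithin_of_mem_nhds hA, 𝔼, inferInstance, inferInstance, inferInstance, A,
      fun p hp => hp⟩

end LocalAddition

/-! ### The infinitesimal action of a local addition -/

section Push

variable {N : ℕ} {M : Type*} [TopologicalSpace M] [ChartedSpace (EuclideanSpace ℝ (Fin N)) M]
  [IsManifold (𝓡 N) ∞ M] {F : Type*} [NormedAddCommGroup F] [NormedSpace ℝ F]

local notation "𝔼" => EuclideanSpace ℝ (Fin N)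

/-- The velocity at `p` of a variation of the parameter of a local addition. -/
noncomputable def LocalAddition.push (A : LocalAddition N M F) (p : M) :
    F →L[ℝ] TangentSpace (𝓡 N) p :=
  (mfderiv 𝓘(ℝ, F) (𝓡 N) (fun w => A.toFun (p, w)) 0 : F →L[ℝ] 𝔼)

theorem chartDiff_injective {φ : OpenPartialHomeomorph M 𝔼} (hφ : φ ∈ atlas 𝔼 M) {p : M}
    (hp : p ∈ φ.source) {v w : TangentSpace (𝓡 N) p} (h : chartDiff φ p v = chartDiff φ p w) :
    v = w := by
  rw [← chartFrame_chartDiff hφ hp v, h, chartFrame_chartDiff hφ hp]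

theorem LocalAddition.hasDerivAt_push (A : LocalAddition N M F) {φ : OpenPartialHomeomorph M 𝔼}
    (hφ : φ ∈ atlas 𝔼 M) {p : M} (hp : p ∈ φ.source) (w : F) :
    HasDerivAt (fun s : ℝ => φ (A.toFun (p, s • w))) (chartDiff φ p (A.push p w)) 0 := by
  have h1 : MDifferentiableAt 𝓘(ℝ, F) (𝓡 N) (fun w => A.toFun (p, w)) ((0 : ℝ) • w) :=
    ((A.smooth.comp (contMDiff_const.prodMk contMDiff_id)) _).mdifferentiableAt (by simp)
  have hpush : ∀ w', w' = 0 → (mfderiv 𝓘(ℝ, F) (𝓡 N) (fun w => A.toFun (p, w)) w' : F →L[ℝ] 𝔼) =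
      A.push p := by
    rintro _ rfl
    rfl
  have hl : HasMFDerivAt 𝓘(ℝ, ℝ) 𝓘(ℝ, F) (fun s : ℝ => s • w) 0
      (ContinuousLinearMap.toSpanSingleton ℝ w) := by
    have := (hasDerivAt_id (0 : ℝ)).smul_const w
    rw [one_smul] at this
    exact this.hasFDerivAt.hasMFDerivAt
  have h2 := HasMFDerivAt.comp (0 : ℝ) h1.hasMFDerivAt hl
  have key : ∀ κ : ℝ → M, κ = (fun w => A.toFun (p, w)) ∘ (fun s : ℝ => s • w) →
      ∀ p', κ 0 = p' → p' ∈ φ.source →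
      HasDerivAt (fun s => φ (κ s)) (chartDiff φ p' (A.push p w : 𝔼)) 0 := by
    rintro κ rfl p' rfl hs
    have h3 := hasDerivAt_chart_comp hφ h2.mdifferentiableAt hs
    convert h3 using 1
    congr 1
    rw [h2.mfderiv]
    refine Eq.trans ?_ (congrArg (fun L : F →L[ℝ] 𝔼 => L ((1 : ℝ) • w))
      (hpush _ (zero_smul ℝ w))).symm
    simp only [one_smul]
    rfl
  exact key _ rfl p (by simp [A.zero]) hp

/-- Both sides are the velocity at `0` of the same curve, seen in a chart. Where the weight is
positive, dividing by it gives a smooth right inverse of `push`. -/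
theorem LocalAddition.push_lift (A : LocalAddition N M F) (p : M) (v : TangentSpace (𝓡 N) p) :
    A.push p (A.lift p v) = A.weight p • v := by
  have hφ : chartAt 𝔼 p ∈ atlas 𝔼 M := chart_mem_atlas _ _
  have hp : p ∈ (chartAt 𝔼 p).source := mem_chart_source _ _
  refine chartDiff_injective hφ hp ?_
  rw [(A.hasDerivAt_push hφ hp (A.lift p v)).unique (A.hasDerivAt _ hφ p hp v)]
  exact (map_smul (chartDiff (chartAt 𝔼 p) p) (A.weight p) v).symm

end Push

/-! ### Extending a family of loops by additional directions -/

section Spread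

variable {N : ℕ} {M : Type*} [TopologicalSpace M] [ChartedSpace (EuclideanSpace ℝ (Fin N)) M]
  [IsManifold (𝓡 N) ∞ M] {F : Type*} [NormedAddCommGroup F] [NormedSpace ℝ F]

local notation "𝔼" => EuclideanSpace ℝ (Fin N)

variable {P G : Type} [NormedAddCommGroup P] [NormedSpace ℝ P] [NormedAddCommGroup G]
  [NormedSpace ℝ G] {O : Set P}

theorem isSmoothFamilyOn_const (γ : Loop N M) (O : Set P) : IsSmoothFamilyOn O fun _ => γ :=
  (γ.smooth.comp (contMDiff_iff_contDiff.2 contDiff_snd)).contMDiffOn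

theorem IsSmoothFamilyOn.comp {Q : Type} [NormedAddCommGroup Q] [NormedSpace ℝ Q]
    {c : P → Loop N M} (hc : IsSmoothFamilyOn O c) {m : Q → P} (hm : ContDiff ℝ ∞ m) :
    IsSmoothFamilyOn (m ⁻¹' O) fun q => c (m q) := by
  have h : ContMDiff 𝓘(ℝ, Q × ℝ) 𝓘(ℝ, P × ℝ) ∞ fun z : Q × ℝ => (m z.1, z.2) :=
    contMDiff_iff_contDiff.2 (by fun_prop)
  exact ContMDiffOn.comp hc h.contMDiffOn fun z hz => ⟨hz.1, trivial⟩

variable {U : Set (Loop N M)}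

/-- `C` is obtained from the family of loops `c` by moving its points with the local addition `A`;
the motion depends linearly on a new parameter. -/
structure IsSpread (A : LocalAddition N M F) (W : P → UnitAddCircle → G →L[ℝ] F) (O : Set P)
    (c : P → U) (O' : Set (G × P)) (C : G × P → U) : Prop where
  isOpen : IsOpen O'
  mem : ∀ z ∈ O', z.2 ∈ O
  smooth : IsSmoothFamilyOn O' fun z => (C z).1
  eq : ∀ z ∈ O', ∀ y, (C z).1 y = A.toFun ((c z.2).1 y, W z.2 y z.1)

theorem IsSpread.eq_of_zero {A : LocalAddition N M F} {W : P → UnitAddCircle → G →L[ℝ] F}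
    {c : P → U} {O' : Set (G × P)} {C : G × P → U} (h : IsSpread A W O c O' C) {p : P}
    (hp : (0, p) ∈ O') : C (0, p) = c p := by
  have h1 : (C (0, p)).1.toFun = (c p).1.toFun := by
    ext y
    rw [h.eq _ hp, map_zero, A.zero]
  apply Subtype.ext
  cases hc : (C (0, p)).1
  cases hc' : (c p).1
  simp_all

/-- The new parameter enters linearly through `W`, so its infinitesimal effect is `push` applied to
`W`; choosing `W` prescribes the variation of the loop. -/
theorem IsSpread.fderiv_coord_left {A : LocalAddition N M F} {W : P → UnitAddCircle → G →L[ℝ] F}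
    {c : P → U} {O' : Set (G × P)} {C : G × P → U} (h : IsSpread A W O c O' C)
    {φ : OpenPartialHomeomorph M 𝔼} (hφ : φ ∈ atlas 𝔼 M) {p : P} {x : ℝ} (hp : (0, p) ∈ O')
    (hx : (c p).1 (x : UnitAddCircle) ∈ φ.source) (g : G) :
    fderiv ℝ (coord φ fun z => (C z).1) ((0, p), x) ((g, 0), 0) =
      chartDiff φ ((c p).1 (x : UnitAddCircle)) (A.push _ (W p x g)) := by
  have hD : ((0, p), x) ∈ chartDomain O' (fun z => (C z).1) φ :=
    ⟨hp, by
      change (C (0, p)).1 (x : UnitAddCircle) ∈ φ.source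
      rw [h.eq_of_zero hp]; exact hx⟩
  have hd := ((contDiffOn_coord h.isOpen h.smooth hφ).contDiffAt
    ((isOpen_chartDomain h.isOpen h.smooth φ).mem_nhds hD)).differentiableAt (by simp)
  have hl : HasDerivAt (fun s : ℝ => ((s • g, p), x)) ((g, (0 : P)), (0 : ℝ)) 0 := by
    have := (hasDerivAt_id (0 : ℝ)).smul_const g
    rw [one_smul] at this
    exact (this.prodMk (hasDerivAt_const _ _)).prodMk (hasDerivAt_const _ _)
  have h1 := HasFDerivAt.comp_hasDerivAt_of_eq (0 : ℝ) hd.hasFDerivAt hl (by simp)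
  refine h1.unique ((A.hasDerivAt_push hφ hx (W p x g)).congr_of_eventuallyEq ?_)
  have hc : Filter.Tendsto (fun s : ℝ => (s • g, p)) (nhds 0) (nhds (0, p)) := by
    have hc' : Continuous fun s : ℝ => (s • g, p) := by fun_prop
    simpa using hc'.tendsto 0
  filter_upwards [hc.eventually (h.isOpen.mem_nhds hp)] with s hs
  simp only [coord, Function.comp]
  rw [h.eq _ hs, map_smul]

variable {π : PoissonStructure N M} {T : ClosedThreeForm N M}

/-- The moved points depend smoothly on all parameters, and at new parameter `0` the loop is a
regular loop of `c`. Openness of regularity supplies the neighbourhood. -/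
theorem exists_isSpread (A : LocalAddition N M F) {W : P → UnitAddCircle → G →L[ℝ] F}
    {c : P → regularLoops π T} (hO : IsOpen O) (hc : IsSmoothFamilyOn O fun p => (c p).1)
    (hW : ContDiffOn ℝ ∞ (fun q : P × ℝ => W q.1 (q.2 : UnitAddCircle)) (O ×ˢ Set.univ))
    {p₀ : P} (hp₀ : p₀ ∈ O) :
    ∃ (O' : Set (G × P)) (C : G × P → regularLoops π T), (0, p₀) ∈ O' ∧ IsSpread A W O c O' C := by
  have hsm : ContMDiffOn 𝓘(ℝ, (G × P) × ℝ) (𝓡 N) ∞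
      (fun q : (G × P) × ℝ => A.toFun ((c q.1.2).1 (q.2 : UnitAddCircle), W q.1.2 q.2 q.1.1))
      ((Set.univ ×ˢ O) ×ˢ Set.univ) := by
    have hm : ContDiff ℝ ∞ fun q : (G × P) × ℝ => (q.1.2, q.2) := by fun_prop
    have h1 : ContMDiffOn 𝓘(ℝ, (G × P) × ℝ) (𝓡 N) ∞
        (fun q : (G × P) × ℝ => (c q.1.2).1 (q.2 : UnitAddCircle))
        ((Set.univ ×ˢ O) ×ˢ Set.univ) :=
      ContMDiffOn.comp hc (contMDiff_iff_contDiff.2 hm).contMDiffOn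
        (by intro q hq; exact ⟨hq.1.2, trivial⟩)
    have h2 : ContDiffOn ℝ ∞ (fun q : (G × P) × ℝ => W q.1.2 q.2 q.1.1)
        ((Set.univ ×ˢ O) ×ˢ Set.univ) :=
      (hW.comp hm.contDiffOn (by intro q hq; exact ⟨hq.1.2, trivial⟩)).clm_apply
        (contDiff_fst.comp contDiff_fst).contDiffOn
    exact A.smooth.comp_contMDiffOn (h1.prodMk (contMDiffOn_iff_contDiffOn.2 h2))
  obtain ⟨O', hO's, hO', hp', C, hC, hCeq⟩ := exists_regular_family π T
    (C := fun z y => A.toFun ((c z.2).1 y, W z.2 y z.1)) (O := Set.univ ×ˢ O)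
    (isOpen_univ.prod hO) hsm
    (p₀ := (0, p₀)) ⟨trivial, hp₀⟩ (c p₀) (by ext y; simp [A.zero])
  exact ⟨O', C, hp', hO', fun z hz => (hO's hz).2, hC, fun z hz y => congrFun (hCeq z hz) y⟩

end Spread

/-! ### Gradients at a single loop -/

section Uniqueness

variable {N : ℕ} {M : Type*} [TopologicalSpace M] [ChartedSpace (EuclideanSpace ℝ (Fin N)) M]

local notation "𝔼" => EuclideanSpace ℝ (Fin N)

/-- The covector field `d` along the loop `γ` is the derivative of the functional `I` at `γ`. -/
structure IsGradientAt {U : Set (Loop N M)} (I : U → ℝ) (γ : U)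
    (d : ∀ y : UnitAddCircle, TangentSpace (𝓡 N) (γ.1 y) →L[ℝ] ℝ) : Prop where
  smooth : ∀ φ ∈ atlas 𝔼 M, ContDiffOn ℝ ∞
    (fun x : ℝ => d (x : UnitAddCircle) ∘L chartFrame φ (γ.1 (x : UnitAddCircle)))
    {x : ℝ | γ.1 (x : UnitAddCircle) ∈ φ.source}
  hasDerivAt : ∀ (O : Set ℝ) (c : ℝ → U), IsOpen O → IsSmoothFamilyOn O (fun t => (c t).1) →
    ∀ t ∈ O, c t = γ → HasDerivAt (fun s => I (c s))
      (∫ x in (0 : ℝ)..1, (d (x : UnitAddCircle) : 𝔼 →L[ℝ] ℝ)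
        (famDeriv (fun t => (c t).1) (t, x) (1, 0) : 𝔼)) t

variable [IsManifold (𝓡 N) ∞ M] {U : Set (Loop N M)}

theorem mfderiv_param_eq_famDeriv {O : Set ℝ} {c : ℝ → Loop N M} (hO : IsOpen O)
    (hc : IsSmoothFamilyOn O c) {t : ℝ} (ht : t ∈ O) (x : ℝ) :
    mfderiv 𝓘(ℝ, ℝ) (𝓡 N) (fun s : ℝ => c s (x : UnitAddCircle)) t (1 : ℝ) =
      famDeriv c (t, x) (1, 0) := by
  have h1 : HasMFDerivAt 𝓘(ℝ, ℝ) 𝓘(ℝ, ℝ × ℝ) (fun s : ℝ => (s, x)) t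
      (ContinuousLinearMap.inl ℝ ℝ ℝ) := (hasFDerivAt_prodMk_left t x).hasMFDerivAt
  have h2 := HasMFDerivAt.comp t (hc.hasMFDerivAt hO (q := (t, x)) ht) h1
  exact congrArg (fun L : ℝ →L[ℝ] 𝔼 => L 1) h2.mfderiv

theorem IsVariationalDerivative.isGradientAt {I : U → ℝ} {α : CovectorField U}
    (hα : IsVariationalDerivative U I α) (γ : U) : IsGradientAt I γ (α γ) where
  smooth φ hφ := by
    have h := hα.smooth ℝ Set.univ (fun _ => γ) isOpen_univ (isSmoothFamilyOn_const γ.1 _) φ hφ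
    have hm : ContDiff ℝ ∞ fun x : ℝ => ((0 : ℝ), x) := by fun_prop
    exact h.comp hm.contDiffOn fun x hx => ⟨trivial, hx⟩
  hasDerivAt O c hO hc t ht h := by
    subst h
    have h1 := hα.hasDerivAt O c hO hc t ht
    convert h1 using 1
    refine intervalIntegral.integral_congr fun x _ => ?_
    exact congrArg (α (c t) x) (mfderiv_param_eq_famDeriv hO hc ht x).symm

/-- Separates the two requirements on a variational derivative: being a gradient at each loop, and
smoothness along families. The gradient of the bracket is constructed only locally, so the two are
verified in different ways. -/
theorem isVariationalDerivative_of_isGradientAt {I : U → ℝ} {α : CovectorField U}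
    (h : ∀ γ, IsGradientAt I γ (α γ))
    (hs : ∀ (P : Type) [NormedAddCommGroup P] [NormedSpace ℝ P] [FiniteDimensional ℝ P]
      (O : Set P) (c : P → U), IsOpen O → IsSmoothFamilyOn O (fun t => (c t).1) →
      ∀ φ ∈ atlas 𝔼 M, ContDiffOn ℝ ∞ (covCoord φ α c) (chartDomain O (fun p => (c p).1) φ)) :
    IsVariationalDerivative U I α where
  hasDerivAt O c hO hc t ht := by
    have h1 := (h (c t)).hasDerivAt O c hO hc t ht rfl
    convert h1 using 1
    refine intervalIntegral.integral_congr fun x _ => ?_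
    exact congrArg (α (c t) x) (mfderiv_param_eq_famDeriv hO hc ht x)
  smooth P _ _ _ O c hO hc φ hφ := hs P O c hO hc φ hφ

theorem isCompact_range_loop (γ : Loop N M) : IsCompact (Set.range γ.toFun) := by
  have : Set.range γ.toFun = (fun x : ℝ => γ (x : UnitAddCircle)) '' Set.Icc 0 1 := by
    ext p
    constructor
    · rintro ⟨y, rfl⟩
      obtain ⟨x, hx, rfl⟩ := exists_mem_Icc_coe_eq y
      exact ⟨x, hx, rfl⟩
    · rintro ⟨x, -, rfl⟩
      exact ⟨x, rfl⟩
  rw [this]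
  exact isCompact_Icc.image γ.smooth.continuous

end Uniqueness

/-! ### Uniqueness of the gradient -/

section UniquenessProof

variable {N : ℕ} {M : Type*} [TopologicalSpace M] [ChartedSpace (EuclideanSpace ℝ (Fin N)) M]
  [IsManifold (𝓡 N) ∞ M]

local notation "𝔼" => EuclideanSpace ℝ (Fin N)

theorem exists_chart_mem (p : M) : ∃ φ ∈ atlas 𝔼 M, p ∈ φ.source :=
  ⟨chartAt 𝔼 p, chart_mem_atlas _ _, mem_chart_source _ _⟩

variable {P G : Type} [NormedAddCommGroup P] [NormedSpace ℝ P] [NormedAddCommGroup G]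
  [NormedSpace ℝ G] {O : Set P} {F : Type*} [NormedAddCommGroup F] [NormedSpace ℝ F]
  {U : Set (Loop N M)}

theorem famDeriv_comp {Q : Type} [NormedAddCommGroup Q] [NormedSpace ℝ Q] {c : P → Loop N M}
    (hO : IsOpen O) (hc : IsSmoothFamilyOn O c) {m : Q → P} {z : Q} {L : Q →L[ℝ] P}
    (hm : HasFDerivAt m L z) (hz : m z ∈ O) (x : ℝ) (e : Q) :
    famDeriv (fun q => c (m q)) (z, x) (e, 0) = famDeriv c (m z, x) (L e, 0) := by
  have h1 : HasMFDerivAt 𝓘(ℝ, Q × ℝ) 𝓘(ℝ, P × ℝ) (fun q : Q × ℝ => (m q.1, q.2)) (z, x)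
      ((L.comp (ContinuousLinearMap.fst ℝ Q ℝ)).prod (ContinuousLinearMap.snd ℝ Q ℝ)) :=
    ((HasFDerivAt.comp (z, x) hm hasFDerivAt_fst).prodMk hasFDerivAt_snd).hasMFDerivAt
  have h2 := HasMFDerivAt.comp (z, x) (hc.hasMFDerivAt hO (q := (m z, x)) hz) h1
  exact congrArg (fun L : Q × ℝ →L[ℝ] 𝔼 => L (e, 0)) h2.mfderiv

theorem IsSpread.famDeriv_left {A : LocalAddition N M F} {W : P → UnitAddCircle → G →L[ℝ] F}
    {c : P → U} {O' : Set (G × P)} {C : G × P → U} (h : IsSpread A W O c O' C)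
    {p : P} (hp : (0, p) ∈ O') (x : ℝ) (g : G) :
    (famDeriv (fun z => (C z).1) ((0, p), x) ((g, 0), 0) : 𝔼) =
      A.push ((c p).1 (x : UnitAddCircle)) (W p x g) := by
  obtain ⟨φ, hφ, hx⟩ := exists_chart_mem (N := N) ((c p).1 (x : UnitAddCircle))
  have hC := h.eq_of_zero hp
  have hD : ((0, p), x) ∈ chartDomain O' (fun z => (C z).1) φ :=
    ⟨hp, by
      change (C (0, p)).1 (x : UnitAddCircle) ∈ φ.source
      rw [hC]; exact hx⟩
  have h1 := h.fderiv_coord_left hφ hp hx g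
  rw [← chartDiff_famDeriv h.isOpen h.smooth hφ hD] at h1
  have key : ∀ γ : U, γ = c p → ∀ v : 𝔼, (chartDiff φ (γ.1 (x : UnitAddCircle)) v : 𝔼) =
      chartDiff φ ((c p).1 (x : UnitAddCircle)) v := by
    rintro _ rfl _; rfl
  exact chartDiff_injective hφ hx ((key _ hC _).symm.trans h1)

variable [T2Space M] {π : PoissonStructure N M} {T : ClosedThreeForm N M}

/-- The derivative of a functional at a regular loop is unique. -/
theorem IsGradientAt.unique {I : regularLoops π T → ℝ} {γ : regularLoops π T}
    {d d' : ∀ y : UnitAddCircle, TangentSpace (𝓡 N) (γ.1 y) →L[ℝ] ℝ} (hd : IsGradientAt I γ d)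
    (hd' : IsGradientAt I γ d') : d = d' := by
  obtain ⟨F, _, _, _, A, hA⟩ := exists_localAddition (N := N) (isCompact_range_loop γ.1)
  let b := Module.finBasis ℝ F
  let δ : ∀ y : UnitAddCircle, TangentSpace (𝓡 N) (γ.1 y) →L[ℝ] ℝ := fun y => d y - d' y
  let Θ : UnitAddCircle → F → ℝ := fun y w => δ y (A.push (γ.1 y) w)
  have hconst : IsSmoothFamilyOn (Set.univ : Set ℝ) (fun _ : ℝ => γ.1) :=
    isSmoothFamilyOn_const γ.1 _
  -- Smoothness of `e` on the field `A.push _ w` along the loop: in a chart this field is a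
  -- parameter derivative of the coordinates of a family of loops, hence smooth.
  have hsm : ∀ (e : ∀ y : UnitAddCircle, TangentSpace (𝓡 N) (γ.1 y) →L[ℝ] ℝ),
      IsGradientAt I γ e → ∀ w, ContDiff ℝ ∞ fun x : ℝ => e x (A.push _ w) := by
    intro e he w
    obtain ⟨O', C, hp, hC⟩ := exists_isSpread (G := F) (P := ℝ) A
      (W := fun _ _ => ContinuousLinearMap.id ℝ F) (c := fun _ => γ) isOpen_univ hconst
      contDiffOn_const (p₀ := (0 : ℝ)) trivial
    rw [contDiff_iff_contDiffAt]
    intro x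
    obtain ⟨φ, hφ, hx⟩ := exists_chart_mem (N := N) (γ.1 (x : UnitAddCircle))
    have hS : IsOpen {x : ℝ | γ.1 (x : UnitAddCircle) ∈ φ.source} :=
      φ.open_source.preimage γ.1.smooth.continuous
    have h1 : ContDiffOn ℝ ∞ (fun x : ℝ => (e (x : UnitAddCircle) ∘L
        chartFrame φ (γ.1 (x : UnitAddCircle)))
          (fderiv ℝ (coord φ fun z => (C z).1) ((0, 0), x) ((w, 0), 0)))
        {x : ℝ | γ.1 (x : UnitAddCircle) ∈ φ.source} := by
      refine (he.smooth φ hφ).clm_apply ?_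
      have hm : ContDiff ℝ ∞ fun x : ℝ => (((0 : F), (0 : ℝ)), x) := by fun_prop
      refine (contDiffOn_fderiv_coord hC.isOpen hC.smooth hφ ((w, 0), 0)).comp hm.contDiffOn ?_
      intro y hy
      refine ⟨hp, ?_⟩
      change (C (0, 0)).1 (y : UnitAddCircle) ∈ φ.source
      rw [hC.eq_of_zero hp]
      exact hy
    refine (h1.contDiffAt (hS.mem_nhds hx)).congr_of_eventuallyEq ?_
    filter_upwards [hS.mem_nhds hx] with y hy
    rw [hC.fderiv_coord_left hφ hp hy]
    rw [ContinuousLinearMap.comp_apply, chartFrame_chartDiff hφ hy]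
    rfl
  have hΘ : ∀ w, ContDiff ℝ ∞ fun x : ℝ => Θ x w := fun w => (hsm d hd w).sub (hsm d' hd' w)
  -- The test variation: it is chosen so that the difference `δ` of the two gradients, evaluated on
  -- it, is the sum of the squares of its values on a basis. Both gradients give the same derivative
  -- along it, so a nonnegative continuous function has integral zero.
  let w : UnitAddCircle → F := fun y => ∑ i, Θ y (b i) • b i
  have hw : ContDiff ℝ ∞ fun x : ℝ => w x := by
    refine ContDiff.sum fun i _ => (hΘ (b i)).smul contDiff_const
  obtain ⟨O', C, hp, hC⟩ := exists_isSpread (G := ℝ) (P := ℝ) A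
    (W := fun _ y => ContinuousLinearMap.toSpanSingleton ℝ (w y)) (c := fun _ => γ) isOpen_univ
    hconst (by
      refine ContDiff.contDiffOn ?_
      exact (ContinuousLinearMap.toSpanSingletonCLE (𝕜 := ℝ) (E := F)).contDiff.comp
        (hw.comp contDiff_snd)) (p₀ := (0 : ℝ)) trivial
  have hC0 := hC.eq_of_zero hp
  have hm : ContDiff ℝ ∞ fun t : ℝ => (t, (0 : ℝ)) := by fun_prop
  have hfam := hC.smooth.comp hm
  have hOm : IsOpen ((fun t : ℝ => (t, (0 : ℝ))) ⁻¹' O') := hC.isOpen.preimage (by fun_prop)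
  have hder : ∀ x : ℝ, (famDeriv (fun t : ℝ => (C (t, 0)).1) (0, x) (1, 0) : 𝔼) =
      A.push (γ.1 (x : UnitAddCircle)) (w x) := by
    intro x
    have h1 := famDeriv_comp hC.isOpen hC.smooth (hasFDerivAt_prodMk_left (0 : ℝ) (0 : ℝ)) hp x 1
    refine Eq.trans h1 ?_
    have h2 := hC.famDeriv_left hp x 1
    simpa using h2
  have e1 := hd.hasDerivAt _ (fun t => C (t, 0)) hOm hfam 0 hp hC0
  have e2 := hd'.hasDerivAt _ (fun t => C (t, 0)) hOm hfam 0 hp hC0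
  have e3 := e1.unique e2
  simp only [hder] at e3
  have hval : ∀ y : UnitAddCircle, δ y (A.push (γ.1 y) (w y)) = ∑ i, Θ y (b i) ^ 2 := by
    intro y
    simp only [w, map_sum, map_smul, smul_eq_mul, Θ, sq]
  have hcont : Continuous fun x : ℝ => ∑ i, Θ x (b i) ^ 2 :=
    continuous_finsetSum _ fun i _ => (hΘ (b i)).continuous.pow 2
  have hint : ∫ x in (0 : ℝ)..1, ∑ i, Θ x (b i) ^ 2 = 0 := by
    have hi : ∀ (e : ∀ y : UnitAddCircle, TangentSpace (𝓡 N) (γ.1 y) →L[ℝ] ℝ),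
        IsGradientAt I γ e → IntervalIntegrable
          (fun x : ℝ => e x (A.push (γ.1 (x : UnitAddCircle)) (w x))) MeasureTheory.volume 0 1 := by
      intro e he
      refine Continuous.intervalIntegrable ?_ _ _
      have : (fun x : ℝ => e x (A.push (γ.1 (x : UnitAddCircle)) (w x))) = fun x : ℝ =>
          ∑ i, Θ x (b i) * e x (A.push _ (b i)) := by
        ext x
        simp only [w, map_sum, map_smul, smul_eq_mul]
      rw [this]
      exact continuous_finsetSum _ fun i _ =>
        (hΘ (b i)).continuous.mul (hsm e he (b i)).continuous
    have h := intervalIntegral.integral_sub (hi d hd) (hi d' hd')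
    have h' := h.trans (sub_eq_zero.2 e3 : (_ : ℝ) - _ = 0)
    refine Eq.trans (intervalIntegral.integral_congr fun x _ => ?_) h'
    exact (hval x).symm
  have hzero : ∀ y : UnitAddCircle, ∀ i, Θ y (b i) = 0 := by
    intro y i
    obtain ⟨x, hx, rfl⟩ := exists_mem_Icc_coe_eq y
    have h0 : ∑ i, Θ x (b i) ^ 2 = 0 := by
      by_contra hne
      have hpos := intervalIntegral.integral_pos (zero_lt_one' ℝ) hcont.continuousOn
        (fun x _ => Finset.sum_nonneg fun i _ => sq_nonneg (Θ x (b i)))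
        ⟨x, hx, lt_of_le_of_ne (Finset.sum_nonneg fun i _ => sq_nonneg (Θ x (b i))) (Ne.symm hne)⟩
      exact hpos.ne' hint
    have h1 := (Finset.sum_eq_zero_iff_of_nonneg fun i _ => sq_nonneg (Θ x (b i))).1 h0 i
      (Finset.mem_univ i)
    exact pow_eq_zero_iff two_ne_zero |>.1 h1
  funext y
  ext v
  have h1 : ∀ u, Θ y u = 0 := by
    intro u
    rw [← b.sum_repr u]
    simp only [Θ, map_sum, map_smul, smul_eq_mul]
    exact Finset.sum_eq_zero fun i _ => mul_eq_zero_of_right _ (hzero y i)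
  -- Since `δ` vanishes on the image of `push`, it vanishes on a positive multiple of every `v`.
  have h2 := h1 (A.lift _ v)
  simp only [Θ] at h2
  rw [A.push_lift, map_smul, smul_eq_mul] at h2
  have h3 : δ y v = 0 := (mul_eq_zero.1 h2).resolve_left (hA _ ⟨y, rfl⟩).ne'
  exact sub_eq_zero.1 h3

end UniquenessProof

/-! ### Isolating the pointwise part of the variation of the bracket -/

section Variation

variable {N : ℕ} {M : Type*} [TopologicalSpace M] [ChartedSpace (EuclideanSpace ℝ (Fin N)) M]

local notation "𝔼" => EuclideanSpace ℝ (Fin N)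

variable {π : PoissonStructure N M} {T : ClosedThreeForm N M}
variable {P : Type} [NormedAddCommGroup P] [NormedSpace ℝ P]
  {φ : OpenPartialHomeomorph M (EuclideanSpace ℝ (Fin N))} {O : Set P}
  {c : P → regularLoops π T} {α β : CovectorField (regularLoops π T)}

/-- The density of the second variation along a family of loops. -/
noncomputable def crossDensity {U : Set (Loop N M)} (α : CovectorField U) (c : P → U) (e₁ e₂ : P)
    (q : P × ℝ) : ℝ :=
  fderiv ℝ (varDensity α c e₂) q (e₁, 0) - fderiv ℝ (varDensity α c e₁) q (e₂, 0)

/-- The 3-form on two Hamiltonian vector fields and the variation of a family of loops. -/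
noncomputable def cubicDensity (α β : CovectorField (regularLoops π T))
    (c : P → regularLoops π T) (e : P) (q : P × ℝ) : ℝ :=
  T.form ((c q.1).1 (q.2 : UnitAddCircle))
    ![hamVec β (c q.1) q.2, famDeriv (fun p => (c p).1) q (e, 0), hamVec α (c q.1) q.2]

/-- The covector `ξ ↦ T(X_β, ξ, X_α)` in a chart. -/
noncomputable def cubicCoord (φ : OpenPartialHomeomorph M 𝔼)
    (α β : CovectorField (regularLoops π T)) (c : P → regularLoops π T) (q : P × ℝ) :
    𝔼 →L[ℝ] ℝ :=
  (formAlong T φ (fun p => (c p).1) q (hamCoord φ β c q)).flip (hamCoord φ α c q)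

/-- The part of the derivative of the bracket that depends pointwise on the derivatives of the
functionals. -/
noncomputable def localForm (φ : OpenPartialHomeomorph M 𝔼)
    (α β : CovectorField (regularLoops π T)) (c : P → regularLoops π T) (q : P × ℝ) :
    𝔼 →L[ℝ] ℝ :=
  (covCoord φ α c q - formAlong T φ (fun p => (c p).1) q (hamCoord φ α c q)
      (velAlong φ (fun p => (c p).1) q)) ∘L
    (fderiv ℝ (sharpChart π φ) (coord φ (fun p => (c p).1) q)).flip
      (covCoord φ β c q - formAlong T φ (fun p => (c p).1) q (hamCoord φ β c q)
        (velAlong φ (fun p => (c p).1) q))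
  + (((fderiv ℝ (formChart T φ) (coord φ (fun p => (c p).1) q)).flip (hamCoord φ β c q)).flip
      (velAlong φ (fun p => (c p).1) q)).flip (hamCoord φ α c q)
  - fderiv ℝ (cubicCoord φ α β c) q (0, 1)

variable [IsManifold (𝓡 N) ∞ M]

theorem cubicDensity_eq (hO : IsOpen O) (hc : IsSmoothFamilyOn O fun p => (c p).1)
    (hφ : φ ∈ atlas 𝔼 M) {q : P × ℝ} (hq : q ∈ chartDomain O (fun p => (c p).1) φ) (e : P) :
    cubicDensity α β c e q =
      cubicCoord φ α β c q (fderiv ℝ (coord φ fun p => (c p).1) q (e, 0)) := by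
  rw [cubicDensity, form_eq_formChart T hφ hq.2, chartDiff_famDeriv hO hc hφ hq]
  rfl

theorem contDiffOn_flip {V₁ V₂ V₃ Q : Type*} [NormedAddCommGroup V₁] [NormedSpace ℝ V₁]
    [NormedAddCommGroup V₂] [NormedSpace ℝ V₂] [NormedAddCommGroup V₃] [NormedSpace ℝ V₃]
    [NormedAddCommGroup Q] [NormedSpace ℝ Q] {f : Q → V₁ →L[ℝ] V₂ →L[ℝ] V₃} {s : Set Q}
    (hf : ContDiffOn ℝ ∞ f s) : ContDiffOn ℝ ∞ (fun q => (f q).flip) s :=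
  (ContinuousLinearMap.flipₗᵢ ℝ V₁ V₂ V₃).contDiff.comp_contDiffOn hf

theorem contDiffOn_cubicCoord (hO : IsOpen O) (hc : IsSmoothFamilyOn O fun p => (c p).1)
    (hφ : φ ∈ atlas 𝔼 M)
    (hα : ContDiffOn ℝ ∞ (covCoord φ α c) (chartDomain O (fun p => (c p).1) φ))
    (hβ : ContDiffOn ℝ ∞ (covCoord φ β c) (chartDomain O (fun p => (c p).1) φ)) :
    ContDiffOn ℝ ∞ (cubicCoord φ α β c) (chartDomain O (fun p => (c p).1) φ) :=
  (contDiffOn_flip ((contDiffOn_formAlong T hO hc hφ).clm_apply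
    (contDiffOn_hamCoord hO hc hφ hβ))).clm_apply (contDiffOn_hamCoord hO hc hφ hα)

theorem contDiffOn_localForm (hO : IsOpen O) (hc : IsSmoothFamilyOn O fun p => (c p).1)
    (hφ : φ ∈ atlas 𝔼 M)
    (hα : ContDiffOn ℝ ∞ (covCoord φ α c) (chartDomain O (fun p => (c p).1) φ))
    (hβ : ContDiffOn ℝ ∞ (covCoord φ β c) (chartDomain O (fun p => (c p).1) φ)) :
    ContDiffOn ℝ ∞ (localForm φ α β c) (chartDomain O (fun p => (c p).1) φ) := by
  have hD := isOpen_chartDomain hO hc φ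
  have hX := contDiffOn_hamCoord hO hc hφ hα
  have hY := contDiffOn_hamCoord hO hc hφ hβ
  have hS := contDiffOn_formAlong T hO hc hφ
  have hv : ContDiffOn ℝ ∞ (velAlong φ fun p => (c p).1) (chartDomain O (fun p => (c p).1) φ) :=
    contDiffOn_fderiv_coord hO hc hφ _
  have hu := contDiffOn_coord hO hc hφ
  have hσ' : ContDiffOn ℝ ∞ (fun q => fderiv ℝ (sharpChart π φ) (coord φ (fun p => (c p).1) q))
      (chartDomain O (fun p => (c p).1) φ) :=
    ((contDiffOn_sharpChart π hφ).fderiv_of_isOpen φ.open_target (m := ∞) (by simp)).comp hu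
      fun _ hq => coord_mem_target hq
  have hS' : ContDiffOn ℝ ∞ (fun q => fderiv ℝ (formChart T φ) (coord φ (fun p => (c p).1) q))
      (chartDomain O (fun p => (c p).1) φ) :=
    ((contDiffOn_formChart T hφ).fderiv_of_isOpen φ.open_target (m := ∞) (by simp)).comp hu
      fun _ hq => coord_mem_target hq
  refine ContDiffOn.sub (ContDiffOn.add ?_ ?_) ?_
  · exact (hα.sub ((hS.clm_apply hX).clm_apply hv)).clm_comp
      ((contDiffOn_flip hσ').clm_apply (hβ.sub ((hS.clm_apply hY).clm_apply hv)))
  · exact (contDiffOn_flip ((contDiffOn_flip ((contDiffOn_flip hS').clm_apply hY)).clm_apply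
      hv)).clm_apply hX
  · exact ((contDiffOn_cubicCoord hO hc hφ hα hβ).fderiv_of_isOpen hD (m := ∞)
      (by simp)).clm_apply contDiffOn_const

/-- The variation of the density of the bracket, up to the densities of second variations and a
derivative along the loop. -/
theorem variation_bracketDensity (hO : IsOpen O) (hc : IsSmoothFamilyOn O fun p => (c p).1)
    (hφ : φ ∈ atlas 𝔼 M)
    (hα : ContDiffOn ℝ ∞ (covCoord φ α c) (chartDomain O (fun p => (c p).1) φ))
    (hβ : ContDiffOn ℝ ∞ (covCoord φ β c) (chartDomain O (fun p => (c p).1) φ))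
    {q : P × ℝ} (hq : q ∈ chartDomain O (fun p => (c p).1) φ) {e eX eY : P}
    (hX : fderiv ℝ (coord φ fun p => (c p).1) q (eX, 0) = hamCoord φ α c q)
    (hY : fderiv ℝ (coord φ fun p => (c p).1) q (eY, 0) = hamCoord φ β c q) :
    fderiv ℝ (bracketDensity α β c) q (e, 0) =
      crossDensity α c e eY q - crossDensity β c e eX q
      + fderiv ℝ (cubicDensity α β c e) q (0, 1)
      + (fderiv ℝ (covCoord φ α c) q (eY, 0) - fderiv ℝ (covCoord φ β c) q (eX, 0)
          + localForm φ α β c q) (fderiv ℝ (coord φ fun p => (c p).1) q (e, 0)) := by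
  have hD := (isOpen_chartDomain hO hc φ).mem_nhds hq
  have h1 := fderiv_bracketDensity hO hc hφ hα hβ hq e
  -- With `ξ` the variation in the direction `e`, this trades `α'(Y)` along `ξ` for the derivative
  -- of `α` in the direction `eY`, evaluated on `ξ`, at the cost of a cross density; `h3` does the
  -- same for `β`.
  have h2 := cross_density_eq hO hc hφ hq (hα.contDiffAt hD) e eY
  have h3 := cross_density_eq hO hc hφ hq (hβ.contDiffAt hD) e eX
  rw [hY] at h2
  rw [hX] at h3
  have hev : cubicDensity α β c e =ᶠ[nhds q] fun q =>
      cubicCoord φ α β c q (fderiv ℝ (coord φ fun p => (c p).1) q (e, 0)) := by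
    filter_upwards [hD] with r hr using cubicDensity_eq hO hc hφ hr e
  have hρ := ((contDiffOn_cubicCoord hO hc hφ hα hβ).contDiffAt hD).differentiableAt (by simp)
  have hξ := ((contDiffOn_fderiv_coord hO hc hφ (e, 0)).contDiffAt hD).differentiableAt (by simp)
  -- Integration by parts: the first term is the unwanted `T(Y, ξ_x, X)`, and the second, being
  -- linear in `ξ` itself, is subtracted in `localForm`.
  have h4 : fderiv ℝ (cubicDensity α β c e) q (0, 1) =
      cubicCoord φ α β c q
        (fderiv ℝ (fun q => fderiv ℝ (coord φ fun p => (c p).1) q (e, 0)) q (0, 1)) +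
      fderiv ℝ (cubicCoord φ α β c) q (0, 1)
        (fderiv ℝ (coord φ fun p => (c p).1) q (e, 0)) := by
    rw [hev.fderiv_eq, (hρ.hasFDerivAt.clm_apply hξ.hasFDerivAt).fderiv]
    rfl
  rw [h1, h4, crossDensity, crossDensity, h2, h3]
  simp only [localForm, cubicCoord, add_apply, sub_apply, ContinuousLinearMap.comp_apply,
    ContinuousLinearMap.flip_apply]
  ring

end Variation

/-! ### Derivatives along lines and periodicity -/

section Slices

theorem Loop.ext_toFun {N : ℕ} {M : Type*} [TopologicalSpace M]
    [ChartedSpace (EuclideanSpace ℝ (Fin N)) M] {γ γ' : Loop N M} (h : γ.toFun = γ'.toFun) :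
    γ = γ' := by
  cases γ
  cases γ'
  simp_all

variable {P : Type*} [NormedAddCommGroup P] [NormedSpace ℝ P] {V : Type*} [NormedAddCommGroup V]
  [NormedSpace ℝ V]

/-- The derivative in the loop direction sees only the slice at `p`; hence quantities built from
such derivatives depend on the loop and not on the family containing it. -/
theorem fderiv_apply_zero_one {f : P × ℝ → V} {p : P} {x : ℝ} (hf : DifferentiableAt ℝ f (p, x)) :
    fderiv ℝ f (p, x) (0, 1) = deriv (fun s => f (p, s)) x := by
  have h : HasDerivAt (fun s : ℝ => (p, s)) ((0 : P), (1 : ℝ)) x :=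
    (hasDerivAt_const _ _).prodMk (hasDerivAt_id x)
  exact (HasFDerivAt.comp_hasDerivAt x hf.hasFDerivAt h).deriv.symm

theorem fderiv_apply_line {Q : Type*} [NormedAddCommGroup Q] [NormedSpace ℝ Q] {f : Q → V} {q : Q}
    (hf : DifferentiableAt ℝ f q) (ξ : Q) :
    HasDerivAt (fun s : ℝ => f (q + s • ξ)) (fderiv ℝ f q ξ) 0 := by
  have h : HasDerivAt (fun s : ℝ => q + s • ξ) ξ 0 := by
    simpa using ((hasDerivAt_id (0 : ℝ)).smul_const ξ).const_add q
  exact HasFDerivAt.comp_hasDerivAt_of_eq (0 : ℝ) hf.hasFDerivAt h (by simp)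

theorem fderiv_add_period {f : P × ℝ → V} (hf : ∀ p x, f (p, x + 1) = f (p, x)) (p : P) (x : ℝ) :
    fderiv ℝ f (p, x + 1) = fderiv ℝ f (p, x) := by
  have h := fderiv_comp_add_right (𝕜 := ℝ) (f := f) (x := (p, x)) ((0 : P), (1 : ℝ))
  have e : (fun q : P × ℝ => f (q + (0, 1))) = f := by
    ext1 ⟨p, x⟩
    simp [hf]
  rw [e] at h
  rw [h]
  simp

theorem eq_of_coe_eq {β : Type*} {f : ℝ → β} (hf : ∀ x, f (x + 1) = f x) {x x' : ℝ}
    (h : (x : UnitAddCircle) = x') : f x = f x' := by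
  have hp : Function.Periodic f 1 := hf
  rw [← hp.lift_coe x, h, hp.lift_coe]

theorem coe_add_one (x : ℝ) : ((x + 1 : ℝ) : UnitAddCircle) = x := by simp

end Slices

/-! ### Independence of the family, and parameters for Hamiltonian directions -/

section Gradient

variable {N : ℕ} {M : Type*} [TopologicalSpace M] [ChartedSpace (EuclideanSpace ℝ (Fin N)) M]

local notation "𝔼" => EuclideanSpace ℝ (Fin N)

variable {π : PoissonStructure N M} {T : ClosedThreeForm N M}
variable {P P' G : Type} [NormedAddCommGroup P] [NormedSpace ℝ P] [NormedAddCommGroup P']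
  [NormedSpace ℝ P'] [NormedAddCommGroup G] [NormedSpace ℝ G]
  {φ : OpenPartialHomeomorph M (EuclideanSpace ℝ (Fin N))} {O : Set P} {O' : Set P'}
  {c : P → regularLoops π T} {c' : P' → regularLoops π T} {α β : CovectorField (regularLoops π T)}

theorem coord_congr {c : P → Loop N M} {c' : P' → Loop N M} {p : P} {p' : P'} (h : c p = c' p')
    (x : ℝ) : coord φ c (p, x) = coord φ c' (p', x) := by
  simp only [coord, h]

theorem covCoord_congr {U : Set (Loop N M)} {α : CovectorField U} {c : P → U} {c' : P' → U} {p : P}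
    {p' : P'} (h : c p = c' p') (x : ℝ) : covCoord φ α c (p, x) = covCoord φ α c' (p', x) := by
  -- Along a constant family the loop occurs as a single term, so equality of loops can be rewritten
  -- although the covectors have dependent types.
  change covCoord φ α (fun _ : ℝ => c p) (0, x) = covCoord φ α (fun _ : ℝ => c' p') (0, x)
  rw [h]

theorem hamCoord_congr {p : P} {p' : P'} (h : c p = c' p') (x : ℝ) :
    hamCoord φ α c (p, x) = hamCoord φ α c' (p', x) := by
  change hamCoord φ α (fun _ : ℝ => c p) (0, x) = hamCoord φ α (fun _ : ℝ => c' p') (0, x)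
  rw [h]

theorem coord_add_one (c : P → Loop N M) (p : P) (x : ℝ) :
    coord φ c (p, x + 1) = coord φ c (p, x) := by
  simp only [coord, coe_add_one]

theorem covCoord_add_one {U : Set (Loop N M)} (α : CovectorField U) (c : P → U) (p : P) (x : ℝ) :
    covCoord φ α c (p, x + 1) = covCoord φ α c (p, x) := by
  have : ∀ y y' : UnitAddCircle, y = y' → α (c p) y ∘L chartFrame φ ((c p).1 y) =
      α (c p) y' ∘L chartFrame φ ((c p).1 y') := by
    rintro _ _ rfl; rfl
  exact this _ _ (coe_add_one x)

theorem hamCoord_add_one (p : P) (x : ℝ) :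
    hamCoord φ α c (p, x + 1) = hamCoord φ α c (p, x) := by
  have : ∀ y y' : UnitAddCircle, y = y' → (chartDiff φ ((c p).1 y) (hamVec α (c p) y) : 𝔼) =
      chartDiff φ ((c p).1 y') (hamVec α (c p) y') := by
    rintro _ _ rfl; rfl
  exact this _ _ (coe_add_one x)

theorem velAlong_add_one (c : P → Loop N M) (p : P) (x : ℝ) :
    velAlong φ c (p, x + 1) = velAlong φ c (p, x) := by
  rw [velAlong, fderiv_add_period (coord_add_one c)]
  rfl

theorem cubicCoord_add_one (p : P) (x : ℝ) :
    cubicCoord φ α β c (p, x + 1) = cubicCoord φ α β c (p, x) := by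
  simp only [cubicCoord, formAlong, hamCoord_add_one, coord_add_one]

theorem localForm_add_one (p : P) (x : ℝ) :
    localForm φ α β c (p, x + 1) = localForm φ α β c (p, x) := by
  simp only [localForm, formAlong, covCoord_add_one, hamCoord_add_one, coord_add_one,
    velAlong_add_one, fderiv_add_period (fun p x => cubicCoord_add_one (c := c) p x)]

variable [IsManifold (𝓡 N) ∞ M]

theorem velAlong_congr {c : P → Loop N M} {c' : P' → Loop N M} (hO : IsOpen O)
    (hc : IsSmoothFamilyOn O c) (hO' : IsOpen O') (hc' : IsSmoothFamilyOn O' c')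
    (hφ : φ ∈ atlas 𝔼 M) {p : P} {p' : P'} (h : c p = c' p') {x : ℝ}
    (hq : (p, x) ∈ chartDomain O c φ) (hq' : (p', x) ∈ chartDomain O' c' φ) :
    velAlong φ c (p, x) = velAlong φ c' (p', x) := by
  have d := ((contDiffOn_coord hO hc hφ).contDiffAt
    ((isOpen_chartDomain hO hc φ).mem_nhds hq)).differentiableAt (by simp)
  have d' := ((contDiffOn_coord hO' hc' hφ).contDiffAt
    ((isOpen_chartDomain hO' hc' φ).mem_nhds hq')).differentiableAt (by simp)
  rw [velAlong, velAlong, fderiv_apply_zero_one d, fderiv_apply_zero_one d']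
  congr 1
  ext1 s
  exact coord_congr h s

/-- All derivatives of the family in `localForm` are taken along the loop, so its value is
determined by the loop. -/
theorem localForm_congr (hO : IsOpen O)
    (hc : IsSmoothFamilyOn O fun p => (c p).1) (hO' : IsOpen O')
    (hc' : IsSmoothFamilyOn O' fun p => (c' p).1) (hφ : φ ∈ atlas 𝔼 M)
    (hα : ContDiffOn ℝ ∞ (covCoord φ α c) (chartDomain O (fun p => (c p).1) φ))
    (hβ : ContDiffOn ℝ ∞ (covCoord φ β c) (chartDomain O (fun p => (c p).1) φ))
    (hα' : ContDiffOn ℝ ∞ (covCoord φ α c') (chartDomain O' (fun p => (c' p).1) φ))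
    (hβ' : ContDiffOn ℝ ∞ (covCoord φ β c') (chartDomain O' (fun p => (c' p).1) φ))
    {p : P} {p' : P'} (h : c p = c' p') {x : ℝ}
    (hq : (p, x) ∈ chartDomain O (fun p => (c p).1) φ)
    (hq' : (p', x) ∈ chartDomain O' (fun p => (c' p).1) φ) :
    localForm φ α β c (p, x) = localForm φ α β c' (p', x) := by
  have h1 : (c p).1 = (c' p').1 := congrArg _ h
  have d := ((contDiffOn_cubicCoord hO hc hφ hα hβ).contDiffAt
    ((isOpen_chartDomain hO hc φ).mem_nhds hq)).differentiableAt (by simp)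
  have d' := ((contDiffOn_cubicCoord hO' hc' hφ hα' hβ').contDiffAt
    ((isOpen_chartDomain hO' hc' φ).mem_nhds hq')).differentiableAt (by simp)
  have e1 : ∀ s, coord φ (fun p => (c p).1) (p, s) = coord φ (fun p => (c' p).1) (p', s) :=
    fun s => coord_congr h1 s
  have e2 : ∀ s, cubicCoord φ α β c (p, s) = cubicCoord φ α β c' (p', s) := fun s => by
    simp only [cubicCoord, formAlong, e1, hamCoord_congr h]
  simp only [localForm, formAlong, e1, hamCoord_congr h, covCoord_congr h,
    velAlong_congr hO hc hO' hc' hφ h1 hq hq', fderiv_apply_zero_one d, fderiv_apply_zero_one d',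
    e2]

variable {F : Type*} [NormedAddCommGroup F] [NormedSpace ℝ F]

theorem IsSpread.fderiv_coord_right {U : Set (Loop N M)} {A : LocalAddition N M F}
    {W : P → UnitAddCircle → G →L[ℝ] F}
    {c : P → U} {O₁ : Set (G × P)} {C : G × P → U} (hc : IsSmoothFamilyOn O fun p => (c p).1)
    (hO : IsOpen O) (h : IsSpread A W O c O₁ C) (hφ : φ ∈ atlas 𝔼 M) {p : P} {x : ℝ}
    (hp : (0, p) ∈ O₁) (hx : (c p).1 (x : UnitAddCircle) ∈ φ.source) (e : P) :
    fderiv ℝ (coord φ fun z => (C z).1) ((0, p), x) ((0, e), 0) =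
      fderiv ℝ (coord φ fun p => (c p).1) (p, x) (e, 0) := by
  have hD : ((0, p), x) ∈ chartDomain O₁ (fun z => (C z).1) φ :=
    ⟨hp, by
      change (C (0, p)).1 (x : UnitAddCircle) ∈ φ.source
      rw [h.eq_of_zero hp]; exact hx⟩
  have hD' : (p, x) ∈ chartDomain O (fun p => (c p).1) φ := ⟨h.mem _ hp, hx⟩
  have d := ((contDiffOn_coord h.isOpen h.smooth hφ).contDiffAt
    ((isOpen_chartDomain h.isOpen h.smooth φ).mem_nhds hD)).differentiableAt (by simp)
  have d' := ((contDiffOn_coord hO hc hφ).contDiffAt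
    ((isOpen_chartDomain hO hc φ).mem_nhds hD')).differentiableAt (by simp)
  refine (fderiv_apply_line d ((0, e), 0)).unique
    ((fderiv_apply_line d' (e, 0)).congr_of_eventuallyEq ?_)
  have hcont : Filter.Tendsto (fun s : ℝ => ((0 : G), p + s • e)) (nhds 0) (nhds (0, p)) := by
    have hc' : Continuous fun s : ℝ => ((0 : G), p + s • e) := by fun_prop
    simpa using hc'.tendsto 0
  filter_upwards [hcont.eventually (h.isOpen.mem_nhds hp)] with s hs
  have h1 := coord_congr (φ := φ) (c := fun z => (C z).1) (c' := fun p => (c p).1)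
    (congrArg _ (h.eq_of_zero hs)) x
  simpa using h1

/-- The curve of loops `s ↦ C (s • g, p)` is determined for small `s` by `A`, the loop `c p` and `W
p`, so the derivative of `α` along it is the same in both extensions. -/
theorem IsSpread.fderiv_covCoord_eq {U : Set (Loop N M)} {α : CovectorField U}
    {A : LocalAddition N M F}
    {W : P → UnitAddCircle → G →L[ℝ] F} {W' : P' → UnitAddCircle → G →L[ℝ] F}
    {c : P → U} {O₁ : Set (G × P)} {C : G × P → U} (h : IsSpread A W O c O₁ C)
    {c' : P' → U} {O₁' : Set (G × P')} {C' : G × P' → U} (h' : IsSpread A W' O' c' O₁' C')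
    {p : P} {p' : P'} (hp : (0, p) ∈ O₁) (hp' : (0, p') ∈ O₁') (hcc : c p = c' p')
    (hW : W p = W' p') {x : ℝ}
    (d : DifferentiableAt ℝ (covCoord φ α C) ((0, p), x))
    (d' : DifferentiableAt ℝ (covCoord φ α C') ((0, p'), x)) (g : G) :
    fderiv ℝ (covCoord φ α C) ((0, p), x) ((g, 0), 0) =
      fderiv ℝ (covCoord φ α C') ((0, p'), x) ((g, 0), 0) := by
  refine (fderiv_apply_line d ((g, 0), 0)).unique
    ((fderiv_apply_line d' ((g, 0), 0)).congr_of_eventuallyEq ?_)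
  have hcont : Filter.Tendsto (fun s : ℝ => (s • g, p)) (nhds 0) (nhds (0, p)) := by
    have hc : Continuous fun s : ℝ => (s • g, p) := by fun_prop
    simpa using hc.tendsto 0
  have hcont' : Filter.Tendsto (fun s : ℝ => (s • g, p')) (nhds 0) (nhds (0, p')) := by
    have hc : Continuous fun s : ℝ => (s • g, p') := by fun_prop
    simpa using hc.tendsto 0
  filter_upwards [hcont.eventually (h.isOpen.mem_nhds hp),
    hcont'.eventually (h'.isOpen.mem_nhds hp')] with s hs hs'
  have hC : C (s • g, p) = C' (s • g, p') := by
    refine Subtype.ext (Loop.ext_toFun ?_)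
    ext1 y
    rw [h.eq _ hs, h'.eq _ hs', hcc, hW]
  simpa using covCoord_congr (φ := φ) (α := α) hC x

theorem eventually_weight_pos (A : LocalAddition N M F) {c : P → Loop N M} (hO : IsOpen O)
    (hc : IsSmoothFamilyOn O c) {p₀ : P} (hp₀ : p₀ ∈ O) (h : ∀ y, 0 < A.weight (c p₀ y)) :
    ∀ᶠ p in nhds p₀, ∀ y, 0 < A.weight (c p y) := by
  have h1 := isCompact_Icc.eventually_forall_of_forall_eventually
    (x₀ := p₀) (K := Set.Icc (0 : ℝ) 1)
    (P := fun p' x => 0 < A.weight (c p' (x : UnitAddCircle))) (fun x hx => by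
      have hcont : ContinuousAt (fun q : P × ℝ => A.weight (c q.1 (q.2 : UnitAddCircle))) (p₀, x) :=
        ContinuousAt.comp (f := fun q : P × ℝ => c q.1 (q.2 : UnitAddCircle))
          A.weight_smooth.continuous.continuousAt
          (hc.contMDiffAt hO (q := (p₀, x)) hp₀).continuousAt
      exact hcont.eventually (lt_mem_nhds (h x)))
  filter_upwards [h1] with p hp y
  obtain ⟨x, hx, rfl⟩ := exists_mem_Icc_coe_eq y
  exact hp x hx

theorem contDiffOn_weight (A : LocalAddition N M F) {c : P → Loop N M} (hO : IsOpen O)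
    (hc : IsSmoothFamilyOn O c) :
    ContDiffOn ℝ ∞ (fun q : P × ℝ => A.weight (c q.1 (q.2 : UnitAddCircle))) (O ×ˢ Set.univ) := by
  intro q hq
  exact (contMDiffAt_iff_contDiffAt.1 (ContMDiffAt.comp q (A.weight_smooth _)
    (hc.contMDiffAt hO hq.1))).contDiffWithinAt

theorem contDiffOn_lift_hamVec (A : LocalAddition N M F) (hO : IsOpen O)
    (hc : IsSmoothFamilyOn O fun p => (c p).1)
    (hα : ∀ φ ∈ atlas 𝔼 M, ContDiffOn ℝ ∞ (covCoord φ α c) (chartDomain O (fun p => (c p).1) φ)) :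
    ContDiffOn ℝ ∞ (fun q : P × ℝ => A.lift ((c q.1).1 (q.2 : UnitAddCircle))
      (hamVec α (c q.1) q.2)) (O ×ˢ Set.univ) := by
  refine contDiffOn_of_chartDomain hO hc fun φ hφ => ?_
  have h1 := (A.lift_smooth φ hφ).comp (contDiffOn_coord hO hc hφ) fun _ hq => coord_mem_target hq
  refine (h1.clm_apply (contDiffOn_hamCoord hO hc hφ (hα φ hφ))).congr fun q hq => ?_
  have key : ∀ p', p' = (c q.1).1 (q.2 : UnitAddCircle) →
      A.lift ((c q.1).1 (q.2 : UnitAddCircle)) (hamVec α (c q.1) q.2) =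
      (A.lift p' ∘L chartFrame φ p') (hamCoord φ α c q) := by
    rintro _ rfl
    rw [ContinuousLinearMap.comp_apply, hamCoord, chartFrame_chartDiff hφ hq.2]
  exact key _ (φ.left_inv hq.2)

/-- The parameters of a local addition that realize the Hamiltonian vector fields of two
functionals. -/
noncomputable def hamParam (A : LocalAddition N M F) (α β : CovectorField (regularLoops π T))
    (γ : regularLoops π T) (y : UnitAddCircle) : ℝ × ℝ →L[ℝ] F :=
  (ContinuousLinearMap.fst ℝ ℝ ℝ).smulRight ((A.weight (γ.1 y))⁻¹ • A.lift _ (hamVec α γ y)) +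
    (ContinuousLinearMap.snd ℝ ℝ ℝ).smulRight ((A.weight (γ.1 y))⁻¹ • A.lift _ (hamVec β γ y))

/-- The inverse weight in `hamParam` compensates the weight produced by `push_lift`, so the velocity
is the Hamiltonian field itself. -/
theorem push_hamParam_fst (A : LocalAddition N M F) {γ : regularLoops π T} {y : UnitAddCircle}
    (h : 0 < A.weight (γ.1 y)) : A.push (γ.1 y) (hamParam A α β γ y (1, 0)) = hamVec α γ y := by
  simp [hamParam, A.push_lift, smul_smul, h.ne']

theorem push_hamParam_snd (A : LocalAddition N M F) {γ : regularLoops π T} {y : UnitAddCircle}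
    (h : 0 < A.weight (γ.1 y)) : A.push (γ.1 y) (hamParam A α β γ y (0, 1)) = hamVec β γ y := by
  simp [hamParam, A.push_lift, smul_smul, h.ne']

theorem contDiffOn_hamParam (A : LocalAddition N M F) (hO : IsOpen O)
    (hc : IsSmoothFamilyOn O fun p => (c p).1)
    (hα : ∀ φ ∈ atlas 𝔼 M, ContDiffOn ℝ ∞ (covCoord φ α c) (chartDomain O (fun p => (c p).1) φ))
    (hβ : ∀ φ ∈ atlas 𝔼 M, ContDiffOn ℝ ∞ (covCoord φ β c) (chartDomain O (fun p => (c p).1) φ))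
    (hA : ∀ p ∈ O, ∀ y, 0 < A.weight ((c p).1 y)) :
    ContDiffOn ℝ ∞ (fun q : P × ℝ => hamParam A α β (c q.1) (q.2 : UnitAddCircle))
      (O ×ˢ Set.univ) := by
  have hw : ContDiffOn ℝ ∞ (fun q : P × ℝ => (A.weight ((c q.1).1 (q.2 : UnitAddCircle)))⁻¹)
      (O ×ˢ Set.univ) := (contDiffOn_weight A hO hc).inv fun q hq => (hA q.1 hq.1 _).ne'
  have h : ∀ L : ℝ × ℝ →L[ℝ] ℝ, ContDiff ℝ ∞ fun v : F => L.smulRight v := fun L =>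
    (ContinuousLinearMap.smulRightL ℝ (ℝ × ℝ) F L).contDiff
  exact ((h _).comp_contDiffOn (hw.smul (contDiffOn_lift_hamVec A hO hc hα))).add
    ((h _).comp_contDiffOn (hw.smul (contDiffOn_lift_hamVec A hO hc hβ)))

end Gradient

/-! ### The components of the gradient of the bracket -/

section VariationForm

variable {N : ℕ} {M : Type*} [TopologicalSpace M] [ChartedSpace (EuclideanSpace ℝ (Fin N)) M]

local notation "𝔼" => EuclideanSpace ℝ (Fin N)

variable {π : PoissonStructure N M} {T : ClosedThreeForm N M}
variable {P P' : Type} [NormedAddCommGroup P] [NormedSpace ℝ P] [NormedAddCommGroup P']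
  [NormedSpace ℝ P']
  {φ : OpenPartialHomeomorph M (EuclideanSpace ℝ (Fin N))} {O : Set P} {O' : Set P'}
  {c : P → regularLoops π T} {c' : P' → regularLoops π T} {α β : CovectorField (regularLoops π T)}

/-- The components in a chart of the variational derivative of the bracket, along the family `c`;
the family `C` extends `c` in the directions of the Hamiltonian vector fields. -/
noncomputable def variationForm (φ : OpenPartialHomeomorph M 𝔼)
    (α β : CovectorField (regularLoops π T)) (c : P → regularLoops π T)
    (C : (ℝ × ℝ) × P → regularLoops π T) (q : P × ℝ) : 𝔼 →L[ℝ] ℝ :=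
  fderiv ℝ (covCoord φ α C) ((0, q.1), q.2) (((0, 1), 0), 0) -
    fderiv ℝ (covCoord φ β C) ((0, q.1), q.2) (((1, 0), 0), 0) + localForm φ α β c q

theorem variationForm_add_one (C : (ℝ × ℝ) × P → regularLoops π T) (p : P) (x : ℝ) :
    variationForm φ α β c C (p, x + 1) = variationForm φ α β c C (p, x) := by
  simp only [variationForm, localForm_add_one,
    fderiv_add_period (fun p x => covCoord_add_one (φ := φ) α C p x),
    fderiv_add_period (fun p x => covCoord_add_one (φ := φ) β C p x)]

variable [IsManifold (𝓡 N) ∞ M] {F : Type*} [NormedAddCommGroup F] [NormedSpace ℝ F]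
  {A : LocalAddition N M F} {W : P → UnitAddCircle → ℝ × ℝ →L[ℝ] F}
  {W' : P' → UnitAddCircle → ℝ × ℝ →L[ℝ] F} {O₁ : Set ((ℝ × ℝ) × P)}
  {C : (ℝ × ℝ) × P → regularLoops π T} {O₁' : Set ((ℝ × ℝ) × P')}
  {C' : (ℝ × ℝ) × P' → regularLoops π T} {I J : regularLoops π T → ℝ}

theorem IsSpread.mem_chartDomain {U : Set (Loop N M)} {G : Type} [NormedAddCommGroup G]
    [NormedSpace ℝ G] {W : P → UnitAddCircle → G →L[ℝ] F}
    {c : P → U} {O₁ : Set (G × P)} {C : G × P → U} (h : IsSpread A W O c O₁ C) {p : P} {x : ℝ}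
    (hp : (0, p) ∈ O₁) (hx : (c p).1 (x : UnitAddCircle) ∈ φ.source) :
    ((0, p), x) ∈ chartDomain O₁ (fun z => (C z).1) φ :=
  ⟨hp, by
    change (C (0, p)).1 (x : UnitAddCircle) ∈ φ.source
    rw [h.eq_of_zero hp]; exact hx⟩

/-- The covector is computed from the family `c`, the variation belongs to any other family `c'`
through the same loop. Thus one covector serves all variations of this loop. Only the value of `W'`
at `p'` matters: the added directions need to be Hamiltonian at this loop alone. -/
theorem IsSpread.variation_bracketDensity [FiniteDimensional ℝ P] [FiniteDimensional ℝ P']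
    (hα : IsVariationalDerivative _ I α) (hβ : IsVariationalDerivative _ J β)
    (hO : IsOpen O) (hc : IsSmoothFamilyOn O fun p => (c p).1)
    (hO' : IsOpen O') (hc' : IsSmoothFamilyOn O' fun p => (c' p).1)
    (hC : IsSpread A W O c O₁ C) (hC' : IsSpread A W' O' c' O₁' C')
    {p : P} {p' : P'} (hp : (0, p) ∈ O₁) (hp' : (0, p') ∈ O₁') (hcc : c p = c' p')
    (hA : ∀ y, 0 < A.weight ((c p).1 y))
    (hW : W p = hamParam A α β (c p)) (hW' : W' p' = hamParam A α β (c p))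
    (hφ : φ ∈ atlas 𝔼 M) {x : ℝ} (hx : (c p).1 (x : UnitAddCircle) ∈ φ.source) (e : P') :
    fderiv ℝ (bracketDensity α β C') ((0, p'), x) ((0, e), 0) =
      crossDensity α C' (0, e) ((0, 1), 0) ((0, p'), x) -
      crossDensity β C' (0, e) ((1, 0), 0) ((0, p'), x) +
      fderiv ℝ (cubicDensity α β C' (0, e)) ((0, p'), x) (0, 1) +
      variationForm φ α β c C (p, x) (fderiv ℝ (coord φ fun p => (c' p).1) (p', x) (e, 0)) := by
  have hx' : (c' p').1 (x : UnitAddCircle) ∈ φ.source := hcc ▸ hx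
  have hD := hC.mem_chartDomain hp hx
  have hD' := hC'.mem_chartDomain hp' hx'
  have sα := hα.contDiffOn_covCoord hC.isOpen hC.smooth hφ
  have sβ := hβ.contDiffOn_covCoord hC.isOpen hC.smooth hφ
  have sα' := hα.contDiffOn_covCoord hC'.isOpen hC'.smooth hφ
  have sβ' := hβ.contDiffOn_covCoord hC'.isOpen hC'.smooth hφ
  have hn := (isOpen_chartDomain hC.isOpen hC.smooth φ).mem_nhds hD
  have hn' := (isOpen_chartDomain hC'.isOpen hC'.smooth φ).mem_nhds hD'
  have h0 : C' (0, p') = c' p' := hC'.eq_of_zero hp'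
  have hW'' : W' p' = hamParam A α β (c' p') := by rw [hW', hcc]
  have hA' : ∀ y, 0 < A.weight ((c' p').1 y) := by rw [← hcc]; exact hA
  have hX : fderiv ℝ (coord φ fun z => (C' z).1) ((0, p'), x) (((1, 0), 0), 0) =
      hamCoord φ α C' ((0, p'), x) := by
    rw [hC'.fderiv_coord_left hφ hp' hx', hW'', push_hamParam_fst A (hA' _)]
    exact hamCoord_congr (c := c') (c' := C') h0.symm x
  have hY : fderiv ℝ (coord φ fun z => (C' z).1) ((0, p'), x) (((0, 1), 0), 0) =
      hamCoord φ β C' ((0, p'), x) := by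
    rw [hC'.fderiv_coord_left hφ hp' hx', hW'', push_hamParam_snd A (hA' _)]
    exact hamCoord_congr (c := c') (c' := C') h0.symm x
  rw [LoopPoisson.variation_bracketDensity hC'.isOpen hC'.smooth hφ sα' sβ' hD' hX hY,
    hC'.fderiv_coord_right hc' hO' hφ hp' hx' e]
  have hWW : W p = W' p' := by rw [hW, hW']
  rw [variationForm, hC.fderiv_covCoord_eq hC' hp hp' hcc hWW
      ((sα.contDiffAt hn).differentiableAt (by simp))
      ((sα'.contDiffAt hn').differentiableAt (by simp)),
    hC.fderiv_covCoord_eq hC' hp hp' hcc hWW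
      ((sβ.contDiffAt hn).differentiableAt (by simp))
      ((sβ'.contDiffAt hn').differentiableAt (by simp)),
    localForm_congr (c' := C') hO hc hC'.isOpen hC'.smooth hφ (hα.contDiffOn_covCoord hO hc hφ)
      (hβ.contDiffOn_covCoord hO hc hφ) sα' sβ' (hcc.trans h0.symm) ⟨hC.mem _ hp, hx⟩ hD']

theorem contDiffOn_variationForm [FiniteDimensional ℝ P]
    (hα : IsVariationalDerivative _ I α) (hβ : IsVariationalDerivative _ J β)
    (hO : IsOpen O) (hc : IsSmoothFamilyOn O fun p => (c p).1) (hC : IsSpread A W O c O₁ C)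
    (hφ : φ ∈ atlas 𝔼 M) : ContDiffOn ℝ ∞ (variationForm φ α β c C)
      (chartDomain ((fun p => (0, p)) ⁻¹' O₁) (fun p => (c p).1) φ) := by
  have hm : ContDiff ℝ ∞ fun q : P × ℝ => (((0 : ℝ × ℝ), q.1), q.2) := by fun_prop
  have h1 : ∀ {κ : CovectorField (regularLoops π T)} {K : regularLoops π T → ℝ},
      IsVariationalDerivative _ K κ → ∀ ξ, ContDiffOn ℝ ∞
      (fun q : P × ℝ => fderiv ℝ (covCoord φ κ C) ((0, q.1), q.2) ξ)
      (chartDomain ((fun p => (0, p)) ⁻¹' O₁) (fun p => (c p).1) φ) := by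
    intro κ K hκ ξ
    exact ((((hκ.contDiffOn_covCoord hC.isOpen hC.smooth hφ).fderiv_of_isOpen
      (isOpen_chartDomain hC.isOpen hC.smooth φ) (m := ∞) (by simp)).clm_apply
      contDiffOn_const).comp hm.contDiffOn fun q hq => hC.mem_chartDomain hq.1 hq.2)
  have h2 := (contDiffOn_localForm hO hc hφ (hα.contDiffOn_covCoord hO hc hφ)
    (hβ.contDiffOn_covCoord hO hc hφ)).mono (s := chartDomain O (fun p => (c p).1) φ)
    (t := chartDomain ((fun p => (0, p)) ⁻¹' O₁) (fun p => (c p).1) φ)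
    fun q hq => ⟨hC.mem _ hq.1, hq.2⟩
  exact ((h1 hα _).sub (h1 hβ _)).add h2

theorem contDiffOn_hamParam_const (A : LocalAddition N M F)
    (hα : IsVariationalDerivative _ I α) (hβ : IsVariationalDerivative _ J β)
    {γ : regularLoops π T} (hA : ∀ y, 0 < A.weight (γ.1 y)) (s : Set (P × ℝ)) :
    ContDiffOn ℝ ∞ (fun q : P × ℝ => hamParam A α β γ (q.2 : UnitAddCircle)) s := by
  have h := contDiffOn_hamParam (P := ℝ) A (c := fun _ => γ) isOpen_univ
    (isSmoothFamilyOn_const γ.1 _)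
    (fun φ hφ => hα.contDiffOn_covCoord isOpen_univ (isSmoothFamilyOn_const γ.1 _) hφ)
    (fun φ hφ => hβ.contDiffOn_covCoord isOpen_univ (isSmoothFamilyOn_const γ.1 _) hφ)
    fun _ _ => hA
  have hm : ContDiff ℝ ∞ fun q : P × ℝ => ((0 : ℝ), q.2) := by fun_prop
  exact h.comp hm.contDiffOn fun _ _ => ⟨trivial, trivial⟩

/-- Every tangent vector at a point of a regular loop is the velocity of a variation of the
loop. -/
theorem exists_family_velocity (A : LocalAddition N M F) {γ : regularLoops π T}
    {y : UnitAddCircle} (hA : 0 < A.weight (γ.1 y)) (v : TangentSpace (𝓡 N) (γ.1 y)) :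
    ∃ (O : Set (ℝ × ℝ)) (c : ℝ × ℝ → regularLoops π T), IsOpen O ∧
      IsSmoothFamilyOn O (fun p => (c p).1) ∧ 0 ∈ O ∧ c 0 = γ ∧
      ∀ φ ∈ atlas 𝔼 M, ∀ x : ℝ, (x : UnitAddCircle) = y → γ.1 y ∈ φ.source →
        fderiv ℝ (coord φ fun p => (c p).1) (0, x) ((1, 0), 0) = chartDiff φ (γ.1 y) v := by
  obtain ⟨O, c, h0, hc⟩ := exists_isSpread (G := ℝ) (P := ℝ) A
    (W := fun _ _ => ContinuousLinearMap.toSpanSingleton ℝ ((A.weight (γ.1 y))⁻¹ • A.lift _ v))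
    (c := fun _ => γ) isOpen_univ (isSmoothFamilyOn_const γ.1 _) contDiffOn_const
    (p₀ := (0 : ℝ)) trivial
  refine ⟨O, c, hc.isOpen, hc.smooth, h0, hc.eq_of_zero h0, ?_⟩
  rintro φ hφ x rfl hx
  refine (hc.fderiv_coord_left hφ h0 hx 1).trans ?_
  simp [A.push_lift, smul_smul, hA.ne']

/-- Every tangent vector is the velocity of some variation. In the formula for that variation all
the other terms are defined without charts, so the term with the covector is the same in both
charts. -/
theorem variationForm_chartDiff [FiniteDimensional ℝ P]
    (hα : IsVariationalDerivative _ I α) (hβ : IsVariationalDerivative _ J β)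
    (hO : IsOpen O) (hc : IsSmoothFamilyOn O fun p => (c p).1) (hC : IsSpread A W O c O₁ C)
    {p : P} (hp : (0, p) ∈ O₁) (hA : ∀ y, 0 < A.weight ((c p).1 y))
    (hW : W p = hamParam A α β (c p)) {ψ : OpenPartialHomeomorph M 𝔼} (hφ : φ ∈ atlas 𝔼 M)
    (hψ : ψ ∈ atlas 𝔼 M) {x : ℝ} (hx : (c p).1 (x : UnitAddCircle) ∈ φ.source)
    (hx' : (c p).1 (x : UnitAddCircle) ∈ ψ.source)
    (v : TangentSpace (𝓡 N) ((c p).1 (x : UnitAddCircle))) :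
    variationForm φ α β c C (p, x) (chartDiff φ _ v) =
      variationForm ψ α β c C (p, x) (chartDiff ψ _ v) := by
  obtain ⟨O', c', hO', hc', h0, hcc, hv⟩ := exists_family_velocity A (hA x) v
  obtain ⟨O₁', C', h0', hC'⟩ := exists_isSpread A (W := fun _ => hamParam A α β (c p)) hO' hc'
    (contDiffOn_hamParam_const A hα hβ hA _) h0
  have h := fun {φ} (hφ : φ ∈ atlas 𝔼 M)
    (hx : (c p).1 (x : UnitAddCircle) ∈ φ.source) =>
    hC.variation_bracketDensity hα hβ hO hc hO' hc' hC' hp h0' hcc.symm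
      hA hW rfl hφ hx (1, 0)
  have h1 := (h hφ hx).symm.trans (h hψ hx')
  rw [hv φ hφ x rfl hx, hv ψ hψ x rfl hx'] at h1
  exact add_left_cancel h1

end VariationForm

/-! ### The gradient of the bracket at a loop -/

section BracketGradient

variable {N : ℕ} {M : Type*} [TopologicalSpace M] [ChartedSpace (EuclideanSpace ℝ (Fin N)) M]

local notation "𝔼" => EuclideanSpace ℝ (Fin N)

variable {π : PoissonStructure N M} {T : ClosedThreeForm N M}
variable {P : Type} [NormedAddCommGroup P] [NormedSpace ℝ P]
  {φ : OpenPartialHomeomorph M (EuclideanSpace ℝ (Fin N))} {O : Set P}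
  {c : P → regularLoops π T} {α β : CovectorField (regularLoops π T)}

/-- The variational derivative of the bracket along the family `c`; the family `C` extends `c` in
the directions of the Hamiltonian vector fields. -/
noncomputable def bracketGradient (α β : CovectorField (regularLoops π T))
    (c : P → regularLoops π T) (C : (ℝ × ℝ) × P → regularLoops π T) (p : P) (y : UnitAddCircle) :
    TangentSpace (𝓡 N) ((c p).1 y) →L[ℝ] ℝ :=
  variationForm (chartAt 𝔼 ((c p).1 y)) α β c C (p, (exists_mem_Icc_coe_eq y).choose) ∘L
    chartDiff (chartAt 𝔼 ((c p).1 y)) ((c p).1 y)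

/-- The value of the functional `{I, J}` expressed by the variational derivatives. -/
noncomputable def pairing (α β : CovectorField (regularLoops π T)) (γ : regularLoops π T) : ℝ :=
  ∫ x in (0 : ℝ)..1, α γ (x : UnitAddCircle) (hamVec β γ (x : UnitAddCircle))

variable [IsManifold (𝓡 N) ∞ M] {F : Type*} [NormedAddCommGroup F] [NormedSpace ℝ F]
  {A : LocalAddition N M F} {W : P → UnitAddCircle → ℝ × ℝ →L[ℝ] F}
  {O₁ : Set ((ℝ × ℝ) × P)}
  {C : (ℝ × ℝ) × P → regularLoops π T} {I J : regularLoops π T → ℝ}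

/-- The definition uses the preferred chart at the point and a chosen representative of the point of
the circle; periodicity and chart independence show that neither choice matters. -/
theorem bracketGradient_apply [FiniteDimensional ℝ P]
    (hα : IsVariationalDerivative _ I α) (hβ : IsVariationalDerivative _ J β)
    (hO : IsOpen O) (hc : IsSmoothFamilyOn O fun p => (c p).1) (hC : IsSpread A W O c O₁ C)
    {p : P} (hp : (0, p) ∈ O₁) (hA : ∀ y, 0 < A.weight ((c p).1 y))
    (hW : W p = hamParam A α β (c p)) (hφ : φ ∈ atlas 𝔼 M)
    {x : ℝ} (hx : (c p).1 (x : UnitAddCircle) ∈ φ.source)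
    (v : TangentSpace (𝓡 N) ((c p).1 (x : UnitAddCircle))) :
    bracketGradient α β c C p x v = variationForm φ α β c C (p, x) (chartDiff φ _ v) := by
  have hs := (exists_mem_Icc_coe_eq (x : UnitAddCircle)).choose_spec.2
  rw [bracketGradient, ContinuousLinearMap.comp_apply,
    eq_of_coe_eq (f := fun s => variationForm (chartAt 𝔼 ((c p).1 (x : UnitAddCircle))) α β c C
      (p, s)) (variationForm_add_one C p) hs]
  exact variationForm_chartDiff hα hβ hO hc hC hp hA hW (chart_mem_atlas _ _) hφ
    (mem_chart_source _ _) hx v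

theorem bracketGradient_comp_chartFrame [FiniteDimensional ℝ P]
    (hα : IsVariationalDerivative _ I α) (hβ : IsVariationalDerivative _ J β)
    (hO : IsOpen O) (hc : IsSmoothFamilyOn O fun p => (c p).1) (hC : IsSpread A W O c O₁ C)
    {p : P} (hp : (0, p) ∈ O₁) (hA : ∀ y, 0 < A.weight ((c p).1 y))
    (hW : W p = hamParam A α β (c p)) (hφ : φ ∈ atlas 𝔼 M)
    {x : ℝ} (hx : (c p).1 (x : UnitAddCircle) ∈ φ.source) :
    bracketGradient α β c C p x ∘L chartFrame φ ((c p).1 (x : UnitAddCircle)) =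
      variationForm φ α β c C (p, x) := by
  ext v
  rw [ContinuousLinearMap.comp_apply, bracketGradient_apply hα hβ hO hc hC hp hA hW hφ hx,
    chartDiff_chartFrame hφ hx]

theorem contDiffOn_bracketGradient [FiniteDimensional ℝ P]
    (hα : IsVariationalDerivative _ I α) (hβ : IsVariationalDerivative _ J β)
    (hO : IsOpen O) (hc : IsSmoothFamilyOn O fun p => (c p).1) (hC : IsSpread A W O c O₁ C)
    (hA : ∀ p, (0, p) ∈ O₁ → ∀ y, 0 < A.weight ((c p).1 y))
    (hW : ∀ p, (0, p) ∈ O₁ → W p = hamParam A α β (c p)) (hφ : φ ∈ atlas 𝔼 M) :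
    ContDiffOn ℝ ∞ (fun q : P × ℝ => bracketGradient α β c C q.1 (q.2 : UnitAddCircle) ∘L
      chartFrame φ ((c q.1).1 (q.2 : UnitAddCircle)))
      (chartDomain ((fun p => (0, p)) ⁻¹' O₁) (fun p => (c p).1) φ) :=
  (contDiffOn_variationForm hα hβ hO hc hC hφ).congr fun _ hq =>
    bracketGradient_comp_chartFrame hα hβ hO hc hC hq.1 (hA _ hq.1) (hW _ hq.1) hφ hq.2

theorem contDiffOn_cubicDensity (hO : IsOpen O) (hc : IsSmoothFamilyOn O fun p => (c p).1)
    (hα : ∀ φ ∈ atlas 𝔼 M, ContDiffOn ℝ ∞ (covCoord φ α c) (chartDomain O (fun p => (c p).1) φ))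
    (hβ : ∀ φ ∈ atlas 𝔼 M, ContDiffOn ℝ ∞ (covCoord φ β c) (chartDomain O (fun p => (c p).1) φ))
    (e : P) : ContDiffOn ℝ ∞ (cubicDensity α β c e) (O ×ˢ Set.univ) := by
  refine contDiffOn_of_chartDomain hO hc fun φ hφ => ?_
  exact ((contDiffOn_cubicCoord hO hc hφ (hα φ hφ) (hβ φ hφ)).clm_apply
    (contDiffOn_fderiv_coord hO hc hφ (e, 0))).congr fun q hq => cubicDensity_eq hO hc hφ hq e

theorem cubicDensity_add_one (hO : IsOpen O) (hc : IsSmoothFamilyOn O fun p => (c p).1)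
    (e : P) {p : P} (hp : p ∈ O) (x : ℝ) :
    cubicDensity α β c e (p, x + 1) = cubicDensity α β c e (p, x) := by
  obtain ⟨φ, hφ, hx⟩ := exists_chart_mem (N := N) ((c p).1 (x : UnitAddCircle))
  have hx' : (c p).1 ((x + 1 : ℝ) : UnitAddCircle) ∈ φ.source := by rwa [coe_add_one]
  rw [cubicDensity_eq hO hc hφ ⟨hp, hx'⟩, cubicDensity_eq hO hc hφ ⟨hp, hx⟩, cubicCoord_add_one,
    fderiv_add_period (coord_add_one _)]

/-- The integral over the circle of a derivative vanishes. -/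
theorem integral_fderiv_loop {f : P × ℝ → ℝ} (hO : IsOpen O)
    (hf : ContDiffOn ℝ ∞ f (O ×ˢ Set.univ)) {p : P} (hp : p ∈ O)
    (hper : ∀ x, f (p, x + 1) = f (p, x)) :
    ∫ x in (0 : ℝ)..1, fderiv ℝ f (p, x) (0, 1) = 0 := by
  have hm : ∀ x : ℝ, (p, x) ∈ O ×ˢ (Set.univ : Set ℝ) := fun x => ⟨hp, trivial⟩
  have hd : ∀ x : ℝ, HasDerivAt (fun s => f (p, s)) (fderiv ℝ f (p, x) (0, 1)) x := by
    intro x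
    have h1 := (hf.contDiffAt ((hO.prod isOpen_univ).mem_nhds (hm x))).differentiableAt (by simp)
    have h : HasDerivAt (fun s : ℝ => (p, s)) ((0 : P), (1 : ℝ)) x :=
      (hasDerivAt_const _ _).prodMk (hasDerivAt_id x)
    exact HasFDerivAt.comp_hasDerivAt x h1.hasFDerivAt h
  have hcont : Continuous fun x : ℝ => fderiv ℝ f (p, x) (0, 1) := by
    have h1 := (hf.continuousOn_fderiv_of_isOpen (hO.prod isOpen_univ) (by simp)).clm_apply
      (continuousOn_const (c := ((0 : P), (1 : ℝ))))
    exact continuousOn_univ.1 (h1.comp (Continuous.continuousOn (by fun_prop)) fun x _ => hm x)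
  rw [intervalIntegral.integral_eq_sub_of_hasDerivAt (fun x _ => hd x)
    (hcont.intervalIntegrable _ _)]
  have := hper 0
  rw [zero_add] at this
  rw [this, sub_self]

theorem continuous_fderiv_slice {f : P × ℝ → ℝ} (hO : IsOpen O)
    (hf : ContDiffOn ℝ ∞ f (O ×ˢ Set.univ)) {p : P} (hp : p ∈ O) (ξ : P × ℝ) :
    Continuous fun x : ℝ => fderiv ℝ f (p, x) ξ := by
  have h1 := (hf.continuousOn_fderiv_of_isOpen (hO.prod isOpen_univ) (by simp)).clm_apply
    (continuousOn_const (c := ξ))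
  exact continuousOn_univ.1 (h1.comp (Continuous.continuousOn (by fun_prop))
    fun x _ => ⟨hp, trivial⟩)

theorem IsVariationalDerivative.continuous_crossDensity [FiniteDimensional ℝ P]
    {U : Set (Loop N M)} {I : U → ℝ} {α : CovectorField U} {c : P → U}
    (hα : IsVariationalDerivative U I α) (hO : IsOpen O)
    (hc : IsSmoothFamilyOn O fun p => (c p).1) {p : P} (hp : p ∈ O) (e₁ e₂ : P) :
    Continuous fun x => crossDensity α c e₁ e₂ (p, x) := by
  have hv := fun e => contDiffOn_varDensity_of_covCoord hO hc
    (fun φ hφ => hα.contDiffOn_covCoord hO hc hφ) e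
  exact (continuous_fderiv_slice hO (hv e₂) hp _).sub (continuous_fderiv_slice hO (hv e₁) hp _)

/-- The cross densities and the total derivative do not contribute to the variation. -/
theorem integral_variation [FiniteDimensional ℝ P]
    (hα : IsVariationalDerivative _ I α) (hβ : IsVariationalDerivative _ J β)
    (hO : IsOpen O) (hc : IsSmoothFamilyOn O fun p => (c p).1) {p : P} (hp : p ∈ O) (e eX eY : P)
    {g : ℝ → ℝ} (hg : ∀ x, fderiv ℝ (bracketDensity α β c) (p, x) (e, 0) =
      crossDensity α c e eY (p, x) - crossDensity β c e eX (p, x) +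
      fderiv ℝ (cubicDensity α β c e) (p, x) (0, 1) + g x) :
    ∫ x in (0 : ℝ)..1, g x = ∫ x in (0 : ℝ)..1, fderiv ℝ (bracketDensity α β c) (p, x) (e, 0) := by
  have sα := fun φ hφ => hα.contDiffOn_covCoord (φ := φ) hO hc hφ
  have sβ := fun φ hφ => hβ.contDiffOn_covCoord (φ := φ) hO hc hφ
  have hf := contDiffOn_bracketDensity hO hc sα sβ
  have hcub := contDiffOn_cubicDensity hO hc sα sβ e
  have ca : IntervalIntegrable _ MeasureTheory.volume 0 1 :=
    (hα.continuous_crossDensity hO hc hp e eY).intervalIntegrable 0 1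
  have cb : IntervalIntegrable _ MeasureTheory.volume 0 1 :=
    (hβ.continuous_crossDensity hO hc hp e eX).intervalIntegrable 0 1
  have cc : IntervalIntegrable _ MeasureTheory.volume 0 1 :=
    (continuous_fderiv_slice hO hcub hp (0, 1)).intervalIntegrable 0 1
  have cf : IntervalIntegrable _ MeasureTheory.volume 0 1 :=
    (continuous_fderiv_slice hO hf hp (e, 0)).intervalIntegrable 0 1
  have ia : ∫ x in (0 : ℝ)..1, crossDensity α c e eY (p, x) = 0 :=
    hα.integral_cross hO hc hp _ _
  have ib : ∫ x in (0 : ℝ)..1, crossDensity β c e eX (p, x) = 0 :=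
    hβ.integral_cross hO hc hp _ _
  have ic := integral_fderiv_loop hO hcub hp (cubicDensity_add_one hO hc e hp)
  have key : ∀ x : ℝ, g x = fderiv ℝ (bracketDensity α β c) (p, x) (e, 0) -
      crossDensity α c e eY (p, x) + crossDensity β c e eX (p, x) -
      fderiv ℝ (cubicDensity α β c e) (p, x) (0, 1) := by
    intro x
    rw [hg x]
    ring
  rw [intervalIntegral.integral_congr (fun x _ => key x), intervalIntegral.integral_sub
    ((cf.sub ca).add cb) cc, intervalIntegral.integral_add (cf.sub ca) cb,
    intervalIntegral.integral_sub cf ca, ia, ib, ic]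
  ring

theorem hasDerivAt_pairing [FiniteDimensional ℝ P]
    (hα : IsVariationalDerivative _ I α) (hβ : IsVariationalDerivative _ J β)
    (hO : IsOpen O) (hc : IsSmoothFamilyOn O fun p => (c p).1) {p : P} (hp : p ∈ O) (e : P) :
    HasDerivAt (fun s : ℝ => pairing α β (c (p + s • e)))
      (∫ x in (0 : ℝ)..1, fderiv ℝ (bracketDensity α β c) (p, x) (e, 0)) 0 :=
  hasDerivAt_integral_line hO (contDiffOn_bracketDensity hO hc
    (fun _ hφ => hα.contDiffOn_covCoord hO hc hφ) fun _ hφ => hβ.contDiffOn_covCoord hO hc hφ) hp e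

theorem IsSpread.hasDerivAt_pairing {c : ℝ → regularLoops π T} {O : Set ℝ}
    {W : ℝ → UnitAddCircle → ℝ × ℝ →L[ℝ] F} {O₁ : Set ((ℝ × ℝ) × ℝ)}
    {C : (ℝ × ℝ) × ℝ → regularLoops π T}
    (hα : IsVariationalDerivative _ I α) (hβ : IsVariationalDerivative _ J β)
    (hC : IsSpread A W O c O₁ C) {t : ℝ} (h0 : (0, t) ∈ O₁) :
    HasDerivAt (fun s => pairing α β (c s))
      (∫ x in (0 : ℝ)..1, fderiv ℝ (bracketDensity α β C) ((0, t), x) ((0, 1), 0)) t := by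
  have h1 := LoopPoisson.hasDerivAt_pairing hα hβ hC.isOpen hC.smooth h0 (0, 1)
  -- `C` restricts to `c` at new parameter `0`, so the derivative can be computed in the family `C`;
  -- the shift moves the base time from `0` to `t`.
  have h2 : HasDerivAt (fun s => pairing α β (c (t + s)))
      (∫ x in (0 : ℝ)..1, fderiv ℝ (bracketDensity α β C) ((0, t), x) ((0, 1), 0)) (t - t) := by
    rw [sub_self]
    refine h1.congr_of_eventuallyEq ?_
    have hcont : Filter.Tendsto (fun s : ℝ => ((0 : ℝ × ℝ), t + s)) (nhds 0) (nhds (0, t)) := by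
      have hc' : Continuous fun s : ℝ => ((0 : ℝ × ℝ), t + s) := by fun_prop
      simpa using hc'.tendsto 0
    filter_upwards [hcont.eventually (hC.isOpen.mem_nhds h0)] with s hs
    have e : ((0, t) : (ℝ × ℝ) × ℝ) + s • (0, 1) = (0, t + s) := by simp
    rw [e, ← hC.eq_of_zero hs]
  have h3 := h2.comp_sub_const t t
  simp only [add_sub_cancel] at h3
  exact h3

theorem isGradientAt_pairing [FiniteDimensional ℝ P]
    (hα : IsVariationalDerivative _ I α) (hβ : IsVariationalDerivative _ J β)
    (hO : IsOpen O) (hc : IsSmoothFamilyOn O fun p => (c p).1) (hC : IsSpread A W O c O₁ C)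
    (hA : ∀ p, (0, p) ∈ O₁ → ∀ y, 0 < A.weight ((c p).1 y))
    (hW : ∀ p, (0, p) ∈ O₁ → W p = hamParam A α β (c p)) {p : P} (hp : (0, p) ∈ O₁) :
    IsGradientAt (pairing α β) (c p) (bracketGradient α β c C p) where
  smooth φ hφ := by
    have hm : ContDiff ℝ ∞ fun x : ℝ => (p, x) := by fun_prop
    have h := (contDiffOn_variationForm hα hβ hO hc hC hφ).comp hm.contDiffOn
      (s := {x : ℝ | (c p).1 (x : UnitAddCircle) ∈ φ.source}) fun x hx => ⟨hp, hx⟩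
    exact h.congr fun x hx =>
      bracketGradient_comp_chartFrame hα hβ hO hc hC hp (hA p hp) (hW p hp) hφ hx
  hasDerivAt O' c' hO' hc' t ht hcc := by
    -- An arbitrary curve through the loop is extended by the two Hamiltonian directions at this
    -- loop, in order that the symmetry of second variations applies to it.
    obtain ⟨O₁', C', h0, hC'⟩ := exists_isSpread A (W := fun _ => hamParam A α β (c p)) hO' hc'
      (contDiffOn_hamParam_const A hα hβ (hA p hp) _) ht
    have h3 := hC'.hasDerivAt_pairing hα hβ h0
    rw [← integral_variation hα hβ hC'.isOpen hC'.smooth h0 (0, 1) ((1, 0), 0) ((0, 1), 0)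
      (g := fun x : ℝ => (bracketGradient α β c C p (x : UnitAddCircle) : 𝔼 →L[ℝ] ℝ)
        (famDeriv (fun t => (c' t).1) (t, x) (1, 0) : 𝔼)) ?_] at h3
    · exact h3
    intro x
    obtain ⟨φ, hφ, hx⟩ := exists_chart_mem (N := N) ((c p).1 (x : UnitAddCircle))
    have hx' : (c' t).1 (x : UnitAddCircle) ∈ φ.source := hcc ▸ hx
    have e1 := hC.variation_bracketDensity hα hβ hO hc hO' hc' hC' hp h0 hcc.symm (hA p hp)
      (hW p hp) rfl hφ hx 1
    have e2 := bracketGradient_apply hα hβ hO hc hC hp (hA p hp) (hW p hp) hφ hx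
      (famDeriv (fun t => (c' t).1) (t, x) (1, 0) : 𝔼)
    have e3 : (chartDiff φ ((c p).1 (x : UnitAddCircle)) : 𝔼 →L[ℝ] 𝔼)
        (famDeriv (fun t => (c' t).1) (t, x) (1, 0) : 𝔼) =
        fderiv ℝ (coord φ fun t => (c' t).1) (t, x) (1, 0) := by
      rw [← hcc]
      exact chartDiff_famDeriv (q := (t, x)) hO' hc' hφ ⟨ht, hx'⟩ _
    rw [e1, ← e3]
    exact congrArg _ e2.symm

end BracketGradient

/-! ### Admissibility, linearity and skewness of the bracket -/

section Admissible

variable {N : ℕ} {M : Type*} [TopologicalSpace M] [ChartedSpace (EuclideanSpace ℝ (Fin N)) M]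
  [IsManifold (𝓡 N) ∞ M] [T2Space M]

local notation "𝔼" => EuclideanSpace ℝ (Fin N)

variable {π : PoissonStructure N M} {T : ClosedThreeForm N M}
  {α β : CovectorField (regularLoops π T)} {I J K : regularLoops π T → ℝ}

/-- One local addition has positive weight along all loops near `c p₀`. Here the added directions
are Hamiltonian at every loop of the family, which makes the gradient depend smoothly on the
parameter. -/
theorem exists_gradient_near {P : Type} [NormedAddCommGroup P] [NormedSpace ℝ P]
    [FiniteDimensional ℝ P] {O : Set P} {c : P → regularLoops π T}
    (hα : IsVariationalDerivative _ I α) (hβ : IsVariationalDerivative _ J β)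
    (hO : IsOpen O) (hc : IsSmoothFamilyOn O fun p => (c p).1) {p₀ : P} (hp₀ : p₀ ∈ O) :
    ∃ (O' : Set P) (d : ∀ (p : P) (y : UnitAddCircle), TangentSpace (𝓡 N) ((c p).1 y) →L[ℝ] ℝ),
      IsOpen O' ∧ p₀ ∈ O' ∧ O' ⊆ O ∧ (∀ p ∈ O', IsGradientAt (pairing α β) (c p) (d p)) ∧
      ∀ φ ∈ atlas 𝔼 M, ContDiffOn ℝ ∞ (fun q : P × ℝ => d q.1 (q.2 : UnitAddCircle) ∘L
        chartFrame φ ((c q.1).1 (q.2 : UnitAddCircle)))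
        (chartDomain O' (fun p => (c p).1) φ) := by
  obtain ⟨F, _, _, _, A, hA⟩ := exists_localAddition (N := N) (isCompact_range_loop (c p₀).1)
  have hpos := eventually_weight_pos A hO hc hp₀ fun y => hA _ ⟨y, rfl⟩
  obtain ⟨O₀, hO₀, hO₀o, hp₀'⟩ := mem_nhds_iff.1 (Filter.inter_mem hpos (hO.mem_nhds hp₀))
  have hc₀ : IsSmoothFamilyOn O₀ fun p => (c p).1 :=
    ContMDiffOn.mono hc (Set.prod_mono (fun p hp => (hO₀ hp).2) subset_rfl)
  obtain ⟨O₁, C, h0, hC⟩ := exists_isSpread A (W := fun p => hamParam A α β (c p)) hO₀o hc₀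
    (contDiffOn_hamParam A hO₀o hc₀ (fun φ hφ => hα.contDiffOn_covCoord hO₀o hc₀ hφ)
      (fun φ hφ => hβ.contDiffOn_covCoord hO₀o hc₀ hφ) fun p hp => (hO₀ hp).1) hp₀'
  have hA' : ∀ p, (0, p) ∈ O₁ → ∀ y, 0 < A.weight ((c p).1 y) := fun p hp =>
    (hO₀ (hC.mem _ hp)).1
  exact ⟨(fun p => (0, p)) ⁻¹' O₁, bracketGradient α β c C, hC.isOpen.preimage (by fun_prop), h0,
    fun p hp => (hO₀ (hC.mem _ hp)).2,
    fun p hp => isGradientAt_pairing hα hβ hO₀o hc₀ hC hA' (fun _ _ => rfl) hp,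
    fun φ hφ => contDiffOn_bracketGradient hα hβ hO₀o hc₀ hC hA' (fun _ _ => rfl) hφ⟩

/-- The bracket of two functionals with smooth variational derivatives has a smooth variational
derivative. -/
theorem isAdmissible_pairing (hα : IsVariationalDerivative _ I α)
    (hβ : IsVariationalDerivative _ J β) : IsAdmissible (regularLoops π T) (pairing α β) := by
  have h : ∀ γ : regularLoops π T, ∃ d, IsGradientAt (pairing α β) γ d := by
    intro γ
    obtain ⟨O', d, -, h0, -, hd, -⟩ := exists_gradient_near (P := ℝ) (c := fun _ => γ) hα hβ
      isOpen_univ (isSmoothFamilyOn_const γ.1 _) (p₀ := 0) trivial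
    exact ⟨d 0, hd 0 h0⟩
  -- The gradients are chosen loop by loop with no regard for smoothness. By uniqueness they agree
  -- near each parameter with the smooth local ones.
  choose κ hκ using h
  refine ⟨κ, isVariationalDerivative_of_isGradientAt hκ ?_⟩
  intro P _ _ _ O c hO hc φ hφ q hq
  obtain ⟨O', d, hO', h0, hO'O, hd, hs⟩ := exists_gradient_near hα hβ hO hc hq.1
  have hc' : IsSmoothFamilyOn O' fun p => (c p).1 :=
    ContMDiffOn.mono hc (Set.prod_mono hO'O subset_rfl)
  have hn := (isOpen_chartDomain hO' hc' φ).mem_nhds (x := q) ⟨h0, hq.2⟩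
  refine (((hs φ hφ).contDiffAt hn).congr_of_eventuallyEq ?_).contDiffWithinAt
  filter_upwards [hn] with r hr
  rw [covCoord, (hκ (c r.1)).unique (hd r.1 hr.1)]

theorem IsVariationalDerivative.unique {κ κ' : CovectorField (regularLoops π T)}
    (h : IsVariationalDerivative _ I κ) (h' : IsVariationalDerivative _ I κ') : κ = κ' :=
  funext fun γ => (h.isGradientAt γ).unique (h'.isGradientAt γ)

theorem isVariationalDerivative_varDeriv {U : Set (Loop N M)} {I : U → ℝ} (h : IsAdmissible U I) :
    IsVariationalDerivative U I (varDeriv U I) := by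
  rw [varDeriv, dif_pos h]
  exact h.choose_spec

theorem bracket_eq_pairing (I J : regularLoops π T → ℝ) :
    bracket π T I J = pairing (varDeriv _ I) (varDeriv _ J) := rfl

theorem IsVariationalDerivative.smul_add {U : Set (Loop N M)} {I J : U → ℝ} {α β : CovectorField U}
    (hα : IsVariationalDerivative U I α) (hβ : IsVariationalDerivative U J β) (r : ℝ) :
    IsVariationalDerivative U (r • I + J) (fun γ y => r • α γ y + β γ y) where
  hasDerivAt O c hO hc t ht := by
    have ci : ∀ {κ : CovectorField U} {K : U → ℝ}, IsVariationalDerivative U K κ →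
        IntervalIntegrable (fun x => varDensity κ c 1 (t, x)) MeasureTheory.volume 0 1 := by
      intro κ K hκ
      have h := contDiffOn_varDensity_of_covCoord hO hc
        (fun φ hφ => hκ.contDiffOn_covCoord hO hc hφ) 1
      exact (continuousOn_univ.1 (h.continuousOn.comp (Continuous.continuousOn (by fun_prop))
        fun x _ => ⟨ht, trivial⟩)).intervalIntegrable 0 1
    have e : ∀ κ : CovectorField U, ∫ x in (0 : ℝ)..1, κ (c t) (x : UnitAddCircle)
        (mfderiv 𝓘(ℝ, ℝ) (𝓡 N) (fun s : ℝ => (c s).1 (x : UnitAddCircle)) t (1 : ℝ)) =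
        ∫ x in (0 : ℝ)..1, varDensity κ c 1 (t, x) := fun κ =>
      intervalIntegral.integral_congr fun x _ =>
        congrArg (κ (c t) x) (mfderiv_param_eq_famDeriv hO hc ht x)
    have h1 := hα.hasDerivAt O c hO hc t ht
    have h2 := hβ.hasDerivAt O c hO hc t ht
    rw [e] at h1 h2
    refine ((h1.const_mul r).add h2).congr_deriv ?_
    refine Eq.trans ?_ (e fun γ y => r • α γ y + β γ y).symm
    rw [← intervalIntegral.integral_const_mul, ← intervalIntegral.integral_add
      ((ci hα).const_mul r) (ci hβ)]
    rfl
  smooth P _ _ _ O c hO hc φ hφ :=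
    ((hα.smooth P O c hO hc φ hφ).const_smul r).add (hβ.smooth P O c hO hc φ hφ)

theorem IsVariationalDerivative.intervalIntegrable (hα : IsVariationalDerivative _ I α)
    (hβ : IsVariationalDerivative _ J β) (γ : regularLoops π T) :
    IntervalIntegrable (fun x : ℝ => α γ (x : UnitAddCircle) (hamVec β γ (x : UnitAddCircle)))
      MeasureTheory.volume 0 1 := by
  have hc := isSmoothFamilyOn_const (P := ℝ) γ.1 Set.univ
  have h := contDiffOn_bracketDensity (c := fun _ : ℝ => γ) isOpen_univ hc
    (fun φ hφ => hα.contDiffOn_covCoord isOpen_univ hc hφ)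
    (fun φ hφ => hβ.contDiffOn_covCoord isOpen_univ hc hφ)
  exact (continuousOn_univ.1 (h.continuousOn.comp (f := fun x : ℝ => ((0 : ℝ), x))
    (Continuous.continuousOn (by fun_prop)) fun x _ => ⟨trivial, trivial⟩)).intervalIntegrable 0 1

/-- Skewness holds already for the densities, so no admissibility is needed. -/
theorem pairing_skew_symm (α β : CovectorField (regularLoops π T)) :
    pairing α β = -pairing β α := by
  ext γ
  rw [Pi.neg_apply, pairing, pairing, ← intervalIntegral.integral_neg]
  exact intervalIntegral.integral_congr fun x _ => bracketDensity_skew (P := ℝ) (c := fun _ => γ)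
    isOpen_univ (isSmoothFamilyOn_const γ.1 _) α β (q := (0, x)) trivial

theorem pairing_smul_add {κ : CovectorField (regularLoops π T)} (hα : IsVariationalDerivative _ I α)
    (hβ : IsVariationalDerivative _ J β) (hκ : IsVariationalDerivative _ K κ) (r : ℝ) :
    pairing (fun γ y => r • α γ y + β γ y) κ = r • pairing α κ + pairing β κ := by
  ext γ
  rw [Pi.add_apply, Pi.smul_apply, smul_eq_mul, pairing, pairing, pairing,
    ← intervalIntegral.integral_const_mul,
    ← intervalIntegral.integral_add ((hα.intervalIntegrable hκ γ).const_mul r)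
      (hβ.intervalIntegrable hκ γ)]
  rfl

end Admissible

/-! ### The 3-form on three variations and its total derivative -/

section FormDensity

variable {N : ℕ} {M : Type*} [TopologicalSpace M] [ChartedSpace (EuclideanSpace ℝ (Fin N)) M]
  [IsManifold (𝓡 N) ∞ M]

local notation "𝔼" => EuclideanSpace ℝ (Fin N)

variable {P : Type} [NormedAddCommGroup P] [NormedSpace ℝ P]
  {φ : OpenPartialHomeomorph M (EuclideanSpace ℝ (Fin N))} {O : Set P} {c : P → Loop N M}

/-- The 3-form on three variations of a family of loops. -/
noncomputable def formDensity (T : ClosedThreeForm N M) (c : P → Loop N M) (e₁ e₂ e₃ : P)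
    (q : P × ℝ) : ℝ :=
  T.form (c q.1 (q.2 : UnitAddCircle))
    ![famDeriv c q (e₁, 0), famDeriv c q (e₂, 0), famDeriv c q (e₃, 0)]

theorem formDensity_eq (T : ClosedThreeForm N M) (hO : IsOpen O) (hc : IsSmoothFamilyOn O c)
    (hφ : φ ∈ atlas 𝔼 M) {q : P × ℝ} (hq : q ∈ chartDomain O c φ) (e₁ e₂ e₃ : P) :
    formDensity T c e₁ e₂ e₃ q = formAlong T φ c q (fderiv ℝ (coord φ c) q (e₁, 0))
      (fderiv ℝ (coord φ c) q (e₂, 0)) (fderiv ℝ (coord φ c) q (e₃, 0)) := by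
  rw [formDensity, form_eq_formChart T hφ hq.2, chartDiff_famDeriv hO hc hφ hq,
    chartDiff_famDeriv hO hc hφ hq, chartDiff_famDeriv hO hc hφ hq]
  rfl

theorem contDiffOn_formDensity (T : ClosedThreeForm N M) (hO : IsOpen O)
    (hc : IsSmoothFamilyOn O c) (e₁ e₂ e₃ : P) :
    ContDiffOn ℝ ∞ (formDensity T c e₁ e₂ e₃) (O ×ˢ Set.univ) := by
  refine contDiffOn_of_chartDomain hO hc fun φ hφ => ?_
  exact ((((contDiffOn_formAlong T hO hc hφ).clm_apply
    (contDiffOn_fderiv_coord hO hc hφ _)).clm_apply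
    (contDiffOn_fderiv_coord hO hc hφ _)).clm_apply (contDiffOn_fderiv_coord hO hc hφ _)).congr
    fun q hq => formDensity_eq T hO hc hφ hq e₁ e₂ e₃

theorem formDensity_add_one (T : ClosedThreeForm N M) (hO : IsOpen O)
    (hc : IsSmoothFamilyOn O c) (e₁ e₂ e₃ : P) {p : P} (hp : p ∈ O) (x : ℝ) :
    formDensity T c e₁ e₂ e₃ (p, x + 1) = formDensity T c e₁ e₂ e₃ (p, x) := by
  obtain ⟨φ, hφ, hx⟩ := exists_chart_mem (N := N) (c p (x : UnitAddCircle))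
  have hx' : c p ((x + 1 : ℝ) : UnitAddCircle) ∈ φ.source := by rwa [coe_add_one]
  rw [formDensity_eq T hO hc hφ ⟨hp, hx'⟩, formDensity_eq T hO hc hφ ⟨hp, hx⟩,
    fderiv_add_period (coord_add_one _), formAlong, formAlong, coord_add_one]

theorem fderiv_formDensity (T : ClosedThreeForm N M) (hO : IsOpen O) (hc : IsSmoothFamilyOn O c)
    (hφ : φ ∈ atlas 𝔼 M) {q : P × ℝ} (hq : q ∈ chartDomain O c φ) (e₁ e₂ e₃ : P) :
    fderiv ℝ (formDensity T c e₁ e₂ e₃) q (0, 1) =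
      fderiv ℝ (formChart T φ) (coord φ c q) (velAlong φ c q)
        (fderiv ℝ (coord φ c) q (e₁, 0)) (fderiv ℝ (coord φ c) q (e₂, 0))
        (fderiv ℝ (coord φ c) q (e₃, 0)) +
      formAlong T φ c q (fderiv ℝ (fun q => fderiv ℝ (coord φ c) q (e₁, 0)) q (0, 1))
        (fderiv ℝ (coord φ c) q (e₂, 0)) (fderiv ℝ (coord φ c) q (e₃, 0)) +
      formAlong T φ c q (fderiv ℝ (coord φ c) q (e₁, 0))
        (fderiv ℝ (fun q => fderiv ℝ (coord φ c) q (e₂, 0)) q (0, 1))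
        (fderiv ℝ (coord φ c) q (e₃, 0)) +
      formAlong T φ c q (fderiv ℝ (coord φ c) q (e₁, 0)) (fderiv ℝ (coord φ c) q (e₂, 0))
        (fderiv ℝ (fun q => fderiv ℝ (coord φ c) q (e₃, 0)) q (0, 1)) := by
  have hD := (isOpen_chartDomain hO hc φ).mem_nhds hq
  have hut := coord_mem_target hq
  have hS : HasFDerivAt (formAlong T φ c)
      (fderiv ℝ (formChart T φ) (coord φ c q) ∘L fderiv ℝ (coord φ c) q) q :=
    (((contDiffOn_formChart T hφ).contDiffAt (φ.open_target.mem_nhds hut)).differentiableAt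
      (by simp)).hasFDerivAt.comp q
      (((contDiffOn_coord hO hc hφ).contDiffAt hD).differentiableAt (by simp)).hasFDerivAt
  have hd := fun ξ => (((contDiffOn_fderiv_coord hO hc hφ ξ).contDiffAt hD).differentiableAt
    (by simp)).hasFDerivAt
  have hev : formDensity T c e₁ e₂ e₃ =ᶠ[nhds q] fun q => formAlong T φ c q
      (fderiv ℝ (coord φ c) q (e₁, 0)) (fderiv ℝ (coord φ c) q (e₂, 0))
      (fderiv ℝ (coord φ c) q (e₃, 0)) := by
    filter_upwards [hD] with r hr using formDensity_eq T hO hc hφ hr e₁ e₂ e₃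
  rw [hev.fderiv_eq, (((hS.clm_apply (hd (e₁, 0))).clm_apply (hd (e₂, 0))).clm_apply
    (hd (e₃, 0))).fderiv]
  simp only [ContinuousLinearMap.flip_apply, add_apply, ContinuousLinearMap.comp_apply, velAlong]
  ring

end FormDensity

/-! ### The Jacobi identity -/

section Jacobi

variable {N : ℕ} {M : Type*} [TopologicalSpace M] [ChartedSpace (EuclideanSpace ℝ (Fin N)) M]
  [IsManifold (𝓡 N) ∞ M]

local notation "𝔼" => EuclideanSpace ℝ (Fin N)

variable {π : PoissonStructure N M} {T : ClosedThreeForm N M}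
  {P : Type} [NormedAddCommGroup P] [NormedSpace ℝ P] [FiniteDimensional ℝ P]
  {φ : OpenPartialHomeomorph M (EuclideanSpace ℝ (Fin N))} {O : Set P}
  {c : P → regularLoops π T}
  {α β κ : CovectorField (regularLoops π T)} {I J K : regularLoops π T → ℝ}

/-- The six derivatives of covectors pair up into the three cross densities, and the Jacobi identity
of `ω` for the twisted covectors kills its derivatives. Closedness of `T` on `u_x, X, Y, Z` converts
the three derivatives of `T` into its derivative along the loop; the terms with `X_x, Y_x, Z_x`
complete this to the total derivative of `T(X, Y, Z)`. -/
theorem sum_fderiv_bracketDensity (hα : IsVariationalDerivative _ I α)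
    (hβ : IsVariationalDerivative _ J β) (hκ : IsVariationalDerivative _ K κ) (hO : IsOpen O)
    (hc : IsSmoothFamilyOn O fun p => (c p).1) (hφ : φ ∈ atlas 𝔼 M) {q : P × ℝ}
    (hq : q ∈ chartDomain O (fun p => (c p).1) φ) {e₁ e₂ e₃ : P}
    (h₁ : fderiv ℝ (coord φ fun p => (c p).1) q (e₁, 0) = hamCoord φ α c q)
    (h₂ : fderiv ℝ (coord φ fun p => (c p).1) q (e₂, 0) = hamCoord φ β c q)
    (h₃ : fderiv ℝ (coord φ fun p => (c p).1) q (e₃, 0) = hamCoord φ κ c q) :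
    fderiv ℝ (bracketDensity α β c) q (e₃, 0) + fderiv ℝ (bracketDensity β κ c) q (e₁, 0) +
      fderiv ℝ (bracketDensity κ α c) q (e₂, 0) =
    crossDensity α c e₃ e₂ q + crossDensity β c e₁ e₃ q + crossDensity κ c e₂ e₁ q +
      fderiv ℝ (formDensity T (fun p => (c p).1) e₁ e₂ e₃) q (0, 1) := by
  have hD := (isOpen_chartDomain hO hc φ).mem_nhds hq
  have sα := hα.contDiffOn_covCoord hO hc hφ
  have sβ := hβ.contDiffOn_covCoord hO hc hφ
  have sκ := hκ.contDiffOn_covCoord hO hc hφ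
  have hut := coord_mem_target hq
  rw [fderiv_bracketDensity hO hc hφ sα sβ hq, fderiv_bracketDensity hO hc hφ sβ sκ hq,
    fderiv_bracketDensity hO hc hφ sκ sα hq, fderiv_formDensity T hO hc hφ hq,
    crossDensity, crossDensity, crossDensity, cross_density_eq hO hc hφ hq (sα.contDiffAt hD),
    cross_density_eq hO hc hφ hq (sβ.contDiffAt hD),
    cross_density_eq hO hc hφ hq (sκ.contDiffAt hD)]
  have eX := hamCoord_eq hO hc hφ α hq
  have eY := hamCoord_eq hO hc hφ β hq
  have eZ := hamCoord_eq hO hc hφ κ hq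
  have hj := sharpChart_jacobi π hφ hut
    (covCoord φ α c q - formAlong T φ (fun p => (c p).1) q (hamCoord φ α c q)
      (velAlong φ (fun p => (c p).1) q))
    (covCoord φ β c q - formAlong T φ (fun p => (c p).1) q (hamCoord φ β c q)
      (velAlong φ (fun p => (c p).1) q))
    (covCoord φ κ c q - formAlong T φ (fun p => (c p).1) q (hamCoord φ κ c q)
      (velAlong φ (fun p => (c p).1) q))
  change _ = (sharpChart π φ (coord φ (fun p => (c p).1) q)) _ at eX
  change _ = (sharpChart π φ (coord φ (fun p => (c p).1) q)) _ at eY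
  change _ = (sharpChart π φ (coord φ (fun p => (c p).1) q)) _ at eZ
  rw [← eX, ← eY, ← eZ] at hj
  have hS : IsAlt (formAlong T φ (fun p => (c p).1) q) := isAlt_formChart T φ _
  have hDS := isAlt_fderiv_formChart T hφ hut
  have hcl := formChart_closed T hφ hut (velAlong φ (fun p => (c p).1) q)
    (hamCoord φ α c q) (hamCoord φ β c q) (hamCoord φ κ c q)
  rw [h₁, h₂, h₃]
  -- What is left is linear algebra in the vectors and their derivatives along the loop; the facts
  -- `a1` to `b5` only reorder arguments of alternating forms.
  generalize fderiv ℝ (fun q => fderiv ℝ (coord φ fun p => (c p).1) q (e₁, 0)) q (0, 1) = X'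
  generalize fderiv ℝ (fun q => fderiv ℝ (coord φ fun p => (c p).1) q (e₂, 0)) q (0, 1) = Y'
  generalize fderiv ℝ (fun q => fderiv ℝ (coord φ fun p => (c p).1) q (e₃, 0)) q (0, 1) = Z'
  clear eX eY eZ h₁ h₂ h₃
  generalize hamCoord φ α c q = X at *
  generalize hamCoord φ β c q = Y at *
  generalize hamCoord φ κ c q = Z at *
  generalize velAlong φ (fun p => (c p).1) q = v at *
  have a1 := hS.swap₁₂ Y Z' X
  have a2 := hS.swap₂₃ Z' Y X
  have a2' := hS.swap₁₂ Z' X Y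
  have a2'' := hS.swap₂₃ X Z' Y
  have a3 := hS.swap₁₂ Z X' Y
  have a4 := hS.swap₂₃ X' Z Y
  have b1 := (hDS Z).swap₁₂ Y v X
  have b2 := (hDS Z).swap₂₃ v Y X
  have b3 := (hDS X).swap₁₂ Z v Y
  have b4 := (hDS X).swap₂₃ v Z Y
  have b5 := (hDS Y).swap₁₂ X v Z
  linarith

variable [T2Space M]

/-- `η` is the gradient of `{I, J}`, so pairing it with the Hamiltonian field of `κ` is
differentiating `{I, J}` in a direction whose velocity is that field. -/
theorem pairing_eq_integral_fderiv {η : CovectorField (regularLoops π T)}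
    (hα : IsVariationalDerivative _ I α) (hβ : IsVariationalDerivative _ J β)
    (hη : IsVariationalDerivative _ (pairing α β) η) (hO : IsOpen O)
    (hc : IsSmoothFamilyOn O fun p => (c p).1) {p : P} (hp : p ∈ O) {e : P}
    (he : ∀ x : ℝ, famDeriv (fun p => (c p).1) (p, x) (e, 0) = hamVec κ (c p) x) :
    pairing η κ (c p) = ∫ x in (0 : ℝ)..1, fderiv ℝ (bracketDensity α β c) (p, x) (e, 0) := by
  rw [← (hη.hasDerivAt_line hO hc hp e).unique (hasDerivAt_pairing hα hβ hO hc hp e)]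
  refine intervalIntegral.integral_congr fun x _ => ?_
  exact congrArg (η (c p) x) (he x).symm

theorem pairing_jacobi_of_family {η₁ η₂ η₃ : CovectorField (regularLoops π T)}
    (hα : IsVariationalDerivative _ I α) (hβ : IsVariationalDerivative _ J β)
    (hκ : IsVariationalDerivative _ K κ)
    (hη₁ : IsVariationalDerivative _ (pairing α β) η₁)
    (hη₂ : IsVariationalDerivative _ (pairing β κ) η₂)
    (hη₃ : IsVariationalDerivative _ (pairing κ α) η₃) (hO : IsOpen O)
    (hc : IsSmoothFamilyOn O fun p => (c p).1) {p : P} (hp : p ∈ O) {e₁ e₂ e₃ : P}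
    (h₁ : ∀ x : ℝ, famDeriv (fun p => (c p).1) (p, x) (e₁, 0) = hamVec α (c p) x)
    (h₂ : ∀ x : ℝ, famDeriv (fun p => (c p).1) (p, x) (e₂, 0) = hamVec β (c p) x)
    (h₃ : ∀ x : ℝ, famDeriv (fun p => (c p).1) (p, x) (e₃, 0) = hamVec κ (c p) x) :
    pairing η₁ κ (c p) + pairing η₂ α (c p) + pairing η₃ β (c p) = 0 := by
  rw [pairing_eq_integral_fderiv hα hβ hη₁ hO hc hp h₃,
    pairing_eq_integral_fderiv hβ hκ hη₂ hO hc hp h₁,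
    pairing_eq_integral_fderiv hκ hα hη₃ hO hc hp h₂]
  have cb : ∀ {α β : CovectorField (regularLoops π T)} {I J : regularLoops π T → ℝ},
      IsVariationalDerivative _ I α → IsVariationalDerivative _ J β → ∀ e : P,
      IntervalIntegrable (fun x => fderiv ℝ (bracketDensity α β c) (p, x) (e, 0))
        MeasureTheory.volume 0 1 := fun hα hβ e =>
    (continuous_fderiv_slice hO (contDiffOn_bracketDensity hO hc
      (fun φ hφ => hα.contDiffOn_covCoord hO hc hφ)
      fun φ hφ => hβ.contDiffOn_covCoord hO hc hφ) hp _).intervalIntegrable 0 1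
  have cf := contDiffOn_formDensity T hO hc e₁ e₂ e₃
  have i₁ := (hα.continuous_crossDensity hO hc hp e₃ e₂).intervalIntegrable
    (μ := MeasureTheory.volume) 0 1
  have i₂ := (hβ.continuous_crossDensity hO hc hp e₁ e₃).intervalIntegrable
    (μ := MeasureTheory.volume) 0 1
  have i₃ := (hκ.continuous_crossDensity hO hc hp e₂ e₁).intervalIntegrable
    (μ := MeasureTheory.volume) 0 1
  have i₄ := (continuous_fderiv_slice hO cf hp (0, 1)).intervalIntegrable
    (μ := MeasureTheory.volume) 0 1
  rw [← intervalIntegral.integral_add (cb hα hβ e₃) (cb hβ hκ e₁),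
    ← intervalIntegral.integral_add ((cb hα hβ e₃).add (cb hβ hκ e₁)) (cb hκ hα e₂)]
  have key : ∀ x : ℝ, fderiv ℝ (bracketDensity α β c) (p, x) (e₃, 0) +
      fderiv ℝ (bracketDensity β κ c) (p, x) (e₁, 0) +
      fderiv ℝ (bracketDensity κ α c) (p, x) (e₂, 0) =
      crossDensity α c e₃ e₂ (p, x) + crossDensity β c e₁ e₃ (p, x) +
      crossDensity κ c e₂ e₁ (p, x) +
      fderiv ℝ (formDensity T (fun p => (c p).1) e₁ e₂ e₃) (p, x) (0, 1) := by
    intro x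
    obtain ⟨φ, hφ, hx⟩ := exists_chart_mem (N := N) ((c p).1 (x : UnitAddCircle))
    have hq : (p, x) ∈ chartDomain O (fun p => (c p).1) φ := ⟨hp, hx⟩
    refine sum_fderiv_bracketDensity hα hβ hκ hO hc hφ hq ?_ ?_ ?_
    · rw [← chartDiff_famDeriv hO hc hφ hq, h₁]
      rfl
    · rw [← chartDiff_famDeriv hO hc hφ hq, h₂]
      rfl
    · rw [← chartDiff_famDeriv hO hc hφ hq, h₃]
      rfl
  have z₁ : ∫ x in (0 : ℝ)..1, crossDensity α c e₃ e₂ (p, x) = 0 :=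
    hα.integral_cross hO hc hp _ _
  have z₂ : ∫ x in (0 : ℝ)..1, crossDensity β c e₁ e₃ (p, x) = 0 :=
    hβ.integral_cross hO hc hp _ _
  have z₃ : ∫ x in (0 : ℝ)..1, crossDensity κ c e₂ e₁ (p, x) = 0 :=
    hκ.integral_cross hO hc hp _ _
  rw [intervalIntegral.integral_congr fun x _ => key x,
    intervalIntegral.integral_add ((i₁.add i₂).add i₃) i₄,
    intervalIntegral.integral_add (i₁.add i₂) i₃, intervalIntegral.integral_add i₁ i₂, z₁, z₂, z₃,
    integral_fderiv_loop hO cf hp (formDensity_add_one T hO hc e₁ e₂ e₃ hp)]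
  ring

theorem pairing_jacobi {η₁ η₂ η₃ : CovectorField (regularLoops π T)}
    (hα : IsVariationalDerivative _ I α) (hβ : IsVariationalDerivative _ J β)
    (hκ : IsVariationalDerivative _ K κ)
    (hη₁ : IsVariationalDerivative _ (pairing α β) η₁)
    (hη₂ : IsVariationalDerivative _ (pairing β κ) η₂)
    (hη₃ : IsVariationalDerivative _ (pairing κ α) η₃) :
    pairing η₁ κ + pairing η₂ α + pairing η₃ β = 0 := by
  ext γ
  obtain ⟨F, _, _, _, A, hA⟩ := exists_localAddition (N := N) (isCompact_range_loop γ.1)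
  replace hA : ∀ y, 0 < A.weight (γ.1 y) := fun y => hA _ ⟨y, rfl⟩
  -- Three Hamiltonian directions are needed and `hamParam` provides two at a time; the second copy
  -- of `κ` is a spare coordinate. The constant family over `ℝ` below is likewise a dummy parameter.
  let W : UnitAddCircle → (ℝ × ℝ) × (ℝ × ℝ) →L[ℝ] F := fun y =>
    (hamParam A α β γ y).coprod (hamParam A κ κ γ y)
  have hW : ContDiffOn ℝ ∞ (fun q : ℝ × ℝ => W (q.2 : UnitAddCircle)) (Set.univ ×ˢ Set.univ) :=
    (ContinuousLinearMap.coprodEquivL ℝ (E := ℝ × ℝ) (F := ℝ × ℝ) (G := F)).contDiff.comp_contDiffOn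
      ((contDiffOn_hamParam_const A hα hβ hA _).prodMk (contDiffOn_hamParam_const A hκ hκ hA _))
  obtain ⟨O, C, h0, hC⟩ := exists_isSpread A (W := fun _ => W) (c := fun _ : ℝ => γ) isOpen_univ
    (isSmoothFamilyOn_const γ.1 _) hW (p₀ := (0 : ℝ)) trivial
  have hC0 : C (0, 0) = γ := hC.eq_of_zero h0
  have hv : ∀ {κ : CovectorField (regularLoops π T)} {g : (ℝ × ℝ) × (ℝ × ℝ)},
      (∀ y, A.push (γ.1 y) (W y g) = hamVec κ γ y) → ∀ x : ℝ,
      famDeriv (fun z => (C z).1) ((0, 0), x) ((g, 0), 0) = hamVec κ (C (0, 0)) x := by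
    intro κ g hg x
    refine (hC.famDeriv_left h0 x g).trans ?_
    rw [hg, hC0]
  have h := pairing_jacobi_of_family hα hβ hκ hη₁ hη₂ hη₃ hC.isOpen hC.smooth h0
    (hv (κ := α) (g := ((1, 0), 0)) fun y => ?_) (hv (κ := β) (g := ((0, 1), 0)) fun y => ?_)
    (hv (κ := κ) (g := (0, (1, 0))) fun y => ?_)
  · rwa [hC0] at h
  · simpa [W] using push_hamParam_fst A (hA y)
  · simpa [W] using push_hamParam_snd A (hA y)
  · simpa [W] using push_hamParam_fst A (hA y)

end Jacobi

end Proofs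

end LoopPoisson

/-! ### The theorem -/

theorem theorem2 {N : ℕ} {M : Type*} [TopologicalSpace M] [T2Space M]
    [SecondCountableTopology M] [ChartedSpace (EuclideanSpace ℝ (Fin N)) M]
    [IsManifold (𝓡 N) ∞ M]
    (π : LoopPoisson.PoissonStructure N M) (T : LoopPoisson.ClosedThreeForm N M) :
    -- the variational derivative of an admissible functional is unique
    (∀ I : LoopPoisson.regularLoops π T → ℝ, LoopPoisson.IsAdmissible _ I →
      ∃! α, LoopPoisson.IsVariationalDerivative _ I α) ∧
    -- the bracket of admissible functionals is an admissible functional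
    (∀ I J : LoopPoisson.regularLoops π T → ℝ,
      LoopPoisson.IsAdmissible _ I → LoopPoisson.IsAdmissible _ J →
        LoopPoisson.IsAdmissible _ (LoopPoisson.bracket π T I J)) ∧
    -- linear combinations of admissible functionals are admissible, and the bracket is bilinear
    (∀ (r : ℝ) (I J K : LoopPoisson.regularLoops π T → ℝ),
      LoopPoisson.IsAdmissible _ I → LoopPoisson.IsAdmissible _ J →
        LoopPoisson.IsAdmissible _ K →
          LoopPoisson.IsAdmissible _ (r • I + J) ∧
          LoopPoisson.bracket π T (r • I + J) K =
            r • LoopPoisson.bracket π T I K + LoopPoisson.bracket π T J K ∧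
          LoopPoisson.bracket π T K (r • I + J) =
            r • LoopPoisson.bracket π T K I + LoopPoisson.bracket π T K J) ∧
    -- the bracket is skew-symmetric
    (∀ I J : LoopPoisson.regularLoops π T → ℝ,
      LoopPoisson.IsAdmissible _ I → LoopPoisson.IsAdmissible _ J →
        LoopPoisson.bracket π T I J = -LoopPoisson.bracket π T J I) ∧
    -- the Jacobi identity
    (∀ I J K : LoopPoisson.regularLoops π T → ℝ,
      LoopPoisson.IsAdmissible _ I → LoopPoisson.IsAdmissible _ J →
        LoopPoisson.IsAdmissible _ K →
          LoopPoisson.bracket π T (LoopPoisson.bracket π T I J) K +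
          LoopPoisson.bracket π T (LoopPoisson.bracket π T J K) I +
          LoopPoisson.bracket π T (LoopPoisson.bracket π T K I) J = 0) := by
  refine ⟨fun I hI => ?_, fun I J hI hJ => ?_, fun r I J K hI hJ hK => ?_, fun I J hI hJ => ?_,
    fun I J K hI hJ hK => ?_⟩
  · exact ⟨_, LoopPoisson.isVariationalDerivative_varDeriv hI, fun α hα =>
      hα.unique (LoopPoisson.isVariationalDerivative_varDeriv hI)⟩
  · exact LoopPoisson.isAdmissible_pairing (LoopPoisson.isVariationalDerivative_varDeriv hI)
      (LoopPoisson.isVariationalDerivative_varDeriv hJ)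
  · have h₁ := LoopPoisson.isVariationalDerivative_varDeriv hI
    have h₂ := LoopPoisson.isVariationalDerivative_varDeriv hJ
    have h₃ := LoopPoisson.isVariationalDerivative_varDeriv hK
    have h := h₁.smul_add h₂ r
    have hadm : LoopPoisson.IsAdmissible (LoopPoisson.regularLoops π T) (r • I + J) := ⟨_, h⟩
    have hv := (LoopPoisson.isVariationalDerivative_varDeriv hadm).unique h
    have hl := LoopPoisson.pairing_smul_add h₁ h₂ h₃ r
    refine ⟨hadm, ?_, ?_⟩
    · rw [LoopPoisson.bracket_eq_pairing, hv, hl]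
      rfl
    -- Linearity in the second argument is linearity in the first, conjugated by skewness.
    · rw [LoopPoisson.bracket_eq_pairing, hv, LoopPoisson.pairing_skew_symm, hl, neg_add,
        ← smul_neg, ← LoopPoisson.pairing_skew_symm, ← LoopPoisson.pairing_skew_symm]
      rfl
  · exact LoopPoisson.pairing_skew_symm _ _
  · have h₁ := LoopPoisson.isVariationalDerivative_varDeriv hI
    have h₂ := LoopPoisson.isVariationalDerivative_varDeriv hJ
    have h₃ := LoopPoisson.isVariationalDerivative_varDeriv hK
    exact LoopPoisson.pairing_jacobi h₁ h₂ h₃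
      (LoopPoisson.isVariationalDerivative_varDeriv (LoopPoisson.isAdmissible_pairing h₁ h₂))
      (LoopPoisson.isVariationalDerivative_varDeriv (LoopPoisson.isAdmissible_pairing h₂ h₃))
      (LoopPoisson.isVariationalDerivative_varDeriv (LoopPoisson.isAdmissible_pairing h₃ h₁))
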